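/- **Definitions.** A *(left) skew closed category* is a category $\mathcal C$ with a functor $[-,-]\colon\mathcal C^{\mathrm{op}}\times\mathcal C\to\mathcal C$, an object $I$, and (extra)natural families $L\colon[b,c]\to[[a,b],[a,c]]$, $i\colon[I,a]\to a$, $j\colon I\to[a,a]$ (none of them assumed invertible) such that 1. $[L,1]\circ L\circ L=[1,L]\circ L\colon[c,d]\to[[b,c],[[a,b],[a,d]]]$; 2. $[a,c]\xrightarrow{L}[[a,a],[a,c]]\xrightarrow{[j,1]}[I,[a,c]]\xrightarrow{i}[a,c]$ is the identity; 3. $[b,c]\xrightarrow{L}[[I,b],[I,c]]\xrightarrow{[1,i]}[[I,b],c]$ equals $[i,1]$; 4. $I\xrightarrow{j}[b,b]\xrightarrow{L}[[a,b],[a,b]]$ equals $j$; 5. $I\xrightarrow{j}[I,I]\xrightarrow{i}I$ is the identity. A *closed functor* is a functor $F$ with a natural family $\hat F\colon F[a,b]\to[Fa,Fb]$ and a morphism $F_0\colon I\to FI$ such that $\hat F\circ Fj\circ F_0=j$, $\;i\circ[F_0,1]\circ\hat F=Fi$, and $[1,\hat F]\circ\hat F\circ FL=[\hat F,1]\circ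 L\circ\hat F$. A *closed transformation* $\phi\colon F\to G$ is a natural transformation with $\phi_I\circ F_0=G_0$ and $[1,\phi_b]\circ\hat F=[\phi_a,1]\circ\hat G\circ\phi_{[a,b]}$. These form a 2-category $\mathbf{SkewCl}_\ell$. A *skew multicategory* $\mathbb A$ (an $\mathcal R$-multicategory) consists of a set of objects; for each list $a_1,\dots,a_n$ and each $b$ a set $\mathbb A_\ell(a_1,\dots,a_n;b)$ of loose multimaps and, if $n>0$, a set $\mathbb A_t(a_1,\dots,a_n;b)$ of tight multimaps with a function $\mathbb A_t(\bar a;b)\to\mathbb A_\ell(\bar a;b)$; identities $1_a\in\mathbb A_t(a;a)$; and substitutions $(g,f_1,\dots,f_n)\mapsto g(f_1,\dots,f_n)$, where $g(f_1,\dots,f_n)$ is tight if $g$ and $f_1$ are tight and loose otherwise. Substitution is associative and unital and commutes with the comparison functions in each argument. A morphism $F$ is a function on objects together with functions $\mathbb A_x(\bar a;b)\to\mathbb B_x(F\bar a;Fb)$ preserving the comparisons, identities and substitution. A 2-cell $\phi\colon F\to G$ is a family $\phi_a\in\mathbb B_t(Fa;Ga)$ with $\phi_b(Ff)=(Gf)(\phi_{a_1},\dots,\phi_{a_n})$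 for all multimaps $f\colon a_1,\dots,a_n\to b$, tight or loose. These form a 2-category $\mathbf{R}\text{-}\mathbf{Mult}$. A skew multicategory $\mathbb A$ is *closed* if for all $b,c$ there are an object $[b,c]$ and $e\in\mathbb A_t([b,c],b;c)$ such that $f\mapsto e(f,1_b)$ is a bijection $\mathbb A_x(a_1,\dots,a_n;[b,c])\to\mathbb A_x(a_1,\dots,a_n,b;c)$ for all $n\ge 0$, all $a_1,\dots,a_n$ and all $x\in\{t,\ell\}$ (only $x=\ell$ when $n=0$). It is *with unit* if it has a *nullary map classifier*: an object $u$ and $\theta\in\mathbb A_\ell(\;;u)$ such that $f\mapsto f(\theta)$ is a bijection $\mathbb A_t(u;b)\to\mathbb A_\ell(\;;b)$ for all $b$. **Theorem.** The 2-category $\mathbf{SkewCl}_\ell$ of skew closed categories, closed functors and closed transformations is 2-equivalent to the full sub-2-category of $\mathbf{R}\text{-}\mathbf{Mult}$ consisting of the closed skew multicategories with unit; that is, there are 2-functors in both directions whose two composites are 2-naturally isomorphic to the identity 2-functors. -/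

import Mathlib

open CategoryTheory Opposite Bicategory

universe w₁ w₂ v₁ v₂ u₁ u₂ v u

/-! ### 2-equivalences of strict 2-categories -/

section TwoEquivalence

variable {B : Type u₁} [Bicategory.{w₁, v₁} B] {C : Type u₂} [Bicategory.{w₂, v₂} C]

/-- A 2-natural isomorphism between 2-functors: invertible 1-cells (inverse up to equality)
that are strictly natural with respect to 1-cells and 2-cells. -/
structure TwoNatIso (F G : StrictPseudofunctor B C) where
  hom : ∀ a : B, F.obj a ⟶ G.obj a
  inv : ∀ a : B, G.obj a ⟶ F.obj a
  hom_inv : ∀ a : B, hom a ≫ inv a = 𝟙 (F.obj a)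
  inv_hom : ∀ a : B, inv a ≫ hom a = 𝟙 (G.obj a)
  naturality : ∀ {a b : B} (f : a ⟶ b), F.map f ≫ hom b = hom a ≫ G.map f
  naturality₂ : ∀ {a b : B} {f g : a ⟶ b} (η : f ⟶ g),
    F.map₂ η ▷ hom b =
      eqToHom (naturality f) ≫ hom a ◁ G.map₂ η ≫ eqToHom (naturality g).symm

variable (B C)

/-- A 2-equivalence between strict 2-categories: a pair of 2-functors, inverse to each other
up to 2-natural isomorphism. -/
structure TwoEquivalence [Bicategory.Strict B] [Bicategory.Strict C] where
  functor : StrictPseudofunctor B C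
  inverse : StrictPseudofunctor C B
  unitIso : TwoNatIso (StrictPseudofunctor.id B) (functor.comp inverse)
  counitIso : TwoNatIso (inverse.comp functor) (StrictPseudofunctor.id C)

end TwoEquivalence

/-! ### Skew closed categories -/

namespace InternalHom

variable {C : Type u} [Category.{v} C] (H : Cᵒᵖ ⥤ C ⥤ C)

/-- `[a,b]`, for a functor `[-,-] : Cᵒᵖ × C ⥤ C` in curried form. -/
def hom (a b : C) : C := (H.obj (op a)).obj b

/-- `[a,f] : [a,b] ⟶ [a,b']`. -/
def post (a : C) {b b' : C} (f : b ⟶ b') : hom H a b ⟶ hom H a b' := (H.obj (op a)).map f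

/-- `[f,b] : [a',b] ⟶ [a,b]`. -/
def pre {a a' : C} (f : a ⟶ a') (b : C) : hom H a' b ⟶ hom H a b := (H.map f.op).app b

@[simp] theorem post_id (a b : C) : post H a (𝟙 b) = 𝟙 (hom H a b) := by simp [post, hom]

@[simp] theorem pre_id (a b : C) : pre H (𝟙 a) b = 𝟙 (hom H a b) := by simp [pre, hom]

theorem post_comp (a : C) {b b' b'' : C} (f : b ⟶ b') (g : b' ⟶ b'') :
    post H a (f ≫ g) = post H a f ≫ post H a g :=
  (H.obj (op a)).map_comp f g

theorem pre_comp {a a' a'' : C} (f : a ⟶ a') (g : a' ⟶ a'') (b : C) :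
    pre H (f ≫ g) b = pre H g b ≫ pre H f b :=
  (congrArg (fun k => k.app b) (H.map_comp g.op f.op)).trans (NatTrans.comp_app _ _ b)

theorem pre_post {a a' b b' : C} (f : a ⟶ a') (g : b ⟶ b') :
    pre H f b ≫ post H a g = post H a' g ≫ pre H f b' :=
  ((H.map f.op).naturality g).symm

end InternalHom

open InternalHom in
/-- A (left) skew closed structure on a category: an internal hom, a unit object `I`, and natural
(respectively extranatural) families `L : [b,c] ⟶ [[a,b],[a,c]]`, `i : [I,a] ⟶ a` and
`j : I ⟶ [a,a]`, none of them assumed invertible, subject to five axioms. -/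
class SkewClosed (C : Type u) [Category.{v} C] where
  /-- the functor `[-,-] : Cᵒᵖ × C ⥤ C`, in curried form -/
  ihom : Cᵒᵖ ⥤ C ⥤ C
  unit : C
  L : ∀ a b c : C, hom ihom b c ⟶ hom ihom (hom ihom a b) (hom ihom a c)
  i : ∀ a : C, hom ihom unit a ⟶ a
  j : ∀ a : C, unit ⟶ hom ihom a a
  /-- `L` is natural in its third variable -/
  L_natural_right : ∀ (a b : C) {c c' : C} (f : c ⟶ c'),
    post ihom b f ≫ L a b c' = L a b c ≫ post ihom (hom ihom a b) (post ihom a f)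
  /-- `L` is natural in its second variable -/
  L_natural_middle : ∀ (a : C) {b b' : C} (f : b ⟶ b') (c : C),
    pre ihom f c ≫ L a b c = L a b' c ≫ pre ihom (post ihom a f) (hom ihom a c)
  /-- `L` is extranatural in its first variable -/
  L_extranatural : ∀ {a a' : C} (f : a ⟶ a') (b c : C),
    L a b c ≫ pre ihom (pre ihom f b) (hom ihom a c) =
      L a' b c ≫ post ihom (hom ihom a' b) (pre ihom f c)
  i_natural : ∀ {a a' : C} (f : a ⟶ a'), post ihom unit f ≫ i a' = i a ≫ f
  /-- `j` is extranatural -/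
  j_extranatural : ∀ {a a' : C} (f : a ⟶ a'),
    j a ≫ post ihom a f = j a' ≫ pre ihom f a'
  /-- `[c,d] ⟶ [[a,c],[a,d]] ⟶ [[[a,b],[a,c]],[[a,b],[a,d]]] ⟶ [[b,c],[[a,b],[a,d]]]` equals
  `[c,d] ⟶ [[b,c],[b,d]] ⟶ [[b,c],[[a,b],[a,d]]]` -/
  pentagon : ∀ a b c d : C,
    L a c d ≫ L (hom ihom a b) (hom ihom a c) (hom ihom a d) ≫
        pre ihom (L a b c) (hom ihom (hom ihom a b) (hom ihom a d)) =
      L b c d ≫ post ihom (hom ihom b c) (L a b d)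
  /-- `[a,c] ⟶ [[a,a],[a,c]] ⟶ [I,[a,c]] ⟶ [a,c]` is the identity -/
  L_j_i : ∀ a c : C,
    L a a c ≫ pre ihom (j a) (hom ihom a c) ≫ i (hom ihom a c) = 𝟙 (hom ihom a c)
  /-- `[b,c] ⟶ [[I,b],[I,c]] ⟶ [[I,b],c]` equals `[i,c]` -/
  L_i : ∀ b c : C,
    L unit b c ≫ post ihom (hom ihom unit b) (i c) = pre ihom (i b) c
  /-- `I ⟶ [b,b] ⟶ [[a,b],[a,b]]` equals `j` -/
  j_L : ∀ a b : C, j b ≫ L a b b = j (hom ihom a b)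
  /-- `I ⟶ [I,I] ⟶ I` is the identity -/
  j_i : j unit ≫ i unit = 𝟙 unit

set_option linter.checkUnivs false in
/-- A skew closed category. -/
structure SkewCl where
  carrier : Type u
  [category : Category.{v} carrier]
  [skewClosed : SkewClosed carrier]

namespace SkewCl

open SkewClosed

attribute [instance] SkewCl.category SkewCl.skewClosed

instance : CoeSort SkewCl.{v, u} (Type u) := ⟨SkewCl.carrier⟩

/-- The internal hom `[a,b]`. -/
abbrev hom {C : SkewCl.{v, u}} (a b : C) : C := InternalHom.hom ihom a b

/-- `[a,f] : [a,b] ⟶ [a,b']`. -/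
abbrev post {C : SkewCl.{v, u}} (a : C) {b b' : C} (f : b ⟶ b') : hom a b ⟶ hom a b' :=
  InternalHom.post ihom a f

/-- `[f,b] : [a',b] ⟶ [a,b]`. -/
abbrev pre {C : SkewCl.{v, u}} {a a' : C} (f : a ⟶ a') (b : C) : hom a' b ⟶ hom a b :=
  InternalHom.pre ihom f b

/-- A closed functor: a functor with a natural family `F[a,b] ⟶ [Fa,Fb]` and a morphism
`I ⟶ FI`, compatible with `j`, `i` and `L`. -/
structure ClosedFunctor (C D : SkewCl.{v, u}) extends C.carrier ⥤ D.carrier where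
  homComp : ∀ a b : C, obj (hom a b) ⟶ hom (obj a) (obj b)
  unitComp : unit ⟶ obj unit
  homComp_natural_right : ∀ (a : C) {b b' : C} (f : b ⟶ b'),
    map (post a f) ≫ homComp a b' = homComp a b ≫ post (obj a) (map f)
  homComp_natural_left : ∀ {a a' : C} (f : a ⟶ a') (b : C),
    map (pre f b) ≫ homComp a b = homComp a' b ≫ pre (map f) (obj b)
  map_j : ∀ a : C, unitComp ≫ map (j a) ≫ homComp a a = j (obj a)
  map_i : ∀ a : C, homComp unit a ≫ pre unitComp (obj a) ≫ i (obj a) = map (i a)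
  map_L : ∀ a b c : C,
    map (L a b c) ≫ homComp (hom a b) (hom a c) ≫ post (obj (hom a b)) (homComp a c) =
      homComp b c ≫ L (obj a) (obj b) (obj c) ≫ pre (homComp a b) (hom (obj a) (obj c))

namespace ClosedFunctor

variable {C D E : SkewCl.{v, u}}

/-- The identity closed functor. -/
def id (C : SkewCl.{v, u}) : ClosedFunctor C C where
  toFunctor := 𝟭 C.carrier
  homComp a b := 𝟙 (hom a b)
  unitComp := 𝟙 unit
  homComp_natural_right := by intros; simp
  homComp_natural_left := by intros; simp
  map_j := by intros; simp
  map_i := by intros; simp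
  map_L := by intros; simp

/-- Composition of closed functors. -/
def comp (F : ClosedFunctor C D) (G : ClosedFunctor D E) : ClosedFunctor C E where
  toFunctor := F.toFunctor ⋙ G.toFunctor
  homComp a b := G.map (F.homComp a b) ≫ G.homComp (F.obj a) (F.obj b)
  unitComp := G.unitComp ≫ G.map F.unitComp
  homComp_natural_right a b b' f := by
    have h := congrArg (fun k => G.map k) (F.homComp_natural_right a f)
    simp only [Functor.map_comp] at h
    simp only [Functor.comp_obj, Functor.comp_map, Category.assoc, reassoc_of% h,
      G.homComp_natural_right]
  homComp_natural_left {a a'} f b := by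
    have h := congrArg (fun k => G.map k) (F.homComp_natural_left f b)
    simp only [Functor.map_comp] at h
    simp only [Functor.comp_obj, Functor.comp_map, Category.assoc, reassoc_of% h,
      G.homComp_natural_left]
  map_j a := by
    have h := congrArg (fun k => G.map k) (F.map_j a)
    simp only [Functor.map_comp] at h
    simp only [Functor.comp_obj, Functor.comp_map, Category.assoc, reassoc_of% h, G.map_j]
  map_i a := by
    have h := G.homComp_natural_left F.unitComp (F.obj a)
    simp only [Functor.comp_obj, Functor.comp_map, ← F.map_i, Functor.map_comp, ← G.map_i,
      reassoc_of% h, Category.assoc, InternalHom.pre_comp]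
  map_L a b c := by
    have h1 := congrArg (fun k => G.map k) (F.map_L a b c)
    have h2 := G.map_L (F.obj a) (F.obj b) (F.obj c)
    have h3 := G.homComp_natural_right (F.obj (hom a b)) (F.homComp a c)
    have h4 := G.homComp_natural_left (F.homComp a b) (hom (F.obj a) (F.obj c))
    simp only [Functor.map_comp] at h1
    simp only [Functor.comp_obj, Functor.comp_map, Category.assoc, InternalHom.pre_comp,
      InternalHom.post_comp, ← reassoc_of% h2, reassoc_of% h3.symm, reassoc_of% h1,
      reassoc_of% h4, InternalHom.pre_post]

end ClosedFunctor

/-- A closed transformation: a natural transformation compatible with the structure morphisms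
of the two closed functors. -/
structure ClosedTrans {C D : SkewCl.{v, u}} (F G : ClosedFunctor C D) where
  app : ∀ a : C, F.obj a ⟶ G.obj a
  naturality : ∀ {a b : C} (f : a ⟶ b), F.map f ≫ app b = app a ≫ G.map f
  app_unit : F.unitComp ≫ app unit = G.unitComp
  app_hom : ∀ a b : C,
    F.homComp a b ≫ post (F.obj a) (app b) =
      app (hom a b) ≫ G.homComp a b ≫ pre (app a) (G.obj b)

theorem ClosedTrans.ext {C D : SkewCl.{v, u}} {F G : ClosedFunctor C D} {α β : ClosedTrans F G}
    (h : ∀ a, α.app a = β.app a) : α = β := by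
  cases α; cases β; congr 1; exact funext h

instance : CategoryStruct SkewCl.{v, u} where
  Hom := ClosedFunctor
  id := ClosedFunctor.id
  comp := ClosedFunctor.comp

variable {C D E : SkewCl.{v, u}}

@[simp] theorem id_obj (a : C) : (𝟙 C : C ⟶ C).obj a = a := rfl
@[simp] theorem id_map {a b : C} (f : a ⟶ b) : (𝟙 C : C ⟶ C).map f = f := rfl
@[simp] theorem comp_obj (F : C ⟶ D) (G : D ⟶ E) (a : C) : (F ≫ G).obj a = G.obj (F.obj a) := rfl
@[simp] theorem comp_map (F : C ⟶ D) (G : D ⟶ E) {a b : C} (f : a ⟶ b) :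
    (F ≫ G).map f = G.map (F.map f) := rfl

/-- Closed transformations compose componentwise. -/
instance homCategory (C D : SkewCl.{v, u}) : Category (C ⟶ D) where
  Hom F G := ClosedTrans F G
  id F :=
    { app := fun a => 𝟙 (F.obj a)
      naturality := by intros; simp
      app_unit := by simp
      app_hom := by intros; simp }
  comp {F G H} α β :=
    { app := fun a => α.app a ≫ β.app a
      naturality := fun f => by
        rw [← Category.assoc, α.naturality, Category.assoc, β.naturality, Category.assoc]
      app_unit := by rw [← Category.assoc, α.app_unit, β.app_unit]
      app_hom := fun a b => by
        simp only [InternalHom.post_comp, InternalHom.pre_comp, Category.assoc,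
          reassoc_of% (α.app_hom a b), InternalHom.pre_post, reassoc_of% (β.app_hom a b)] }
  id_comp α := ClosedTrans.ext fun a => Category.id_comp (α.app a)
  comp_id α := ClosedTrans.ext fun a => Category.comp_id (α.app a)
  assoc α β γ := ClosedTrans.ext fun a => Category.assoc (α.app a) (β.app a) (γ.app a)

theorem hom₂_ext {F G : C ⟶ D} {α β : F ⟶ G} (h : ∀ a, α.app a = β.app a) : α = β :=
  ClosedTrans.ext h

@[simp] theorem id_app (F : C ⟶ D) (a : C) : ClosedTrans.app (𝟙 F) a = 𝟙 (F.obj a) := rfl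
@[simp] theorem comp_app {F G H : C ⟶ D} (α : F ⟶ G) (β : G ⟶ H) (a : C) :
    ClosedTrans.app (α ≫ β) a = α.app a ≫ β.app a := rfl

theorem ClosedFunctor.ext' {F G : ClosedFunctor C D} (h : F.toFunctor = G.toFunctor)
    (h' : HEq F.homComp G.homComp) (h'' : HEq F.unitComp G.unitComp) : F = G := by
  cases F; cases G; cases h; cases h'; cases h''; rfl

theorem id_comp' (F : C ⟶ D) : 𝟙 C ≫ F = F :=
  ClosedFunctor.ext' rfl
    (heq_of_eq (funext fun a => funext fun b => by
      change F.map (𝟙 (hom a b)) ≫ F.homComp a b = _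
      simp))
    (heq_of_eq (by
      change F.unitComp ≫ F.map (𝟙 unit) = _
      simp))

theorem comp_id' (F : C ⟶ D) : F ≫ 𝟙 D = F :=
  ClosedFunctor.ext' rfl
    (heq_of_eq (funext fun a => funext fun b => Category.comp_id (F.homComp a b)))
    (heq_of_eq (Category.id_comp F.unitComp))

theorem assoc' {C' : SkewCl.{v, u}} (F : C ⟶ D) (G : D ⟶ E) (H : E ⟶ C') :
    (F ≫ G) ≫ H = F ≫ G ≫ H :=
  ClosedFunctor.ext' rfl
    (heq_of_eq (funext fun a => funext fun b => by
      change H.map (G.map (F.homComp a b) ≫ G.homComp _ _) ≫ H.homComp _ _ =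
        H.map (G.map (F.homComp a b)) ≫ H.map (G.homComp _ _) ≫ H.homComp _ _
      simp))
    (heq_of_eq (by
      change H.unitComp ≫ H.map (G.unitComp ≫ G.map F.unitComp) =
        (H.unitComp ≫ H.map G.unitComp) ≫ H.map (G.map F.unitComp)
      simp))

/-- `F ◁ η` has components `η (F a)`. -/
def whiskerL (F : C ⟶ D) {G H : D ⟶ E} (η : G ⟶ H) : F ≫ G ⟶ F ≫ H where
  app a := η.app (F.obj a)
  naturality f := η.naturality (F.map f)
  app_unit := by
    change (G.unitComp ≫ G.map F.unitComp) ≫ η.app (F.obj unit) = H.unitComp ≫ H.map F.unitComp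
    rw [Category.assoc, η.naturality, ← Category.assoc, η.app_unit]
  app_hom a b := by
    change (G.map (F.homComp a b) ≫ G.homComp _ _) ≫ post _ (η.app (F.obj b)) =
      η.app (F.obj (hom a b)) ≫ (H.map (F.homComp a b) ≫ H.homComp _ _) ≫ pre (η.app (F.obj a)) _
    rw [Category.assoc, η.app_hom, ← Category.assoc, η.naturality]
    simp only [Category.assoc]

/-- `η ▷ H` has components `H (η a)`. -/
def whiskerR {F G : C ⟶ D} (η : F ⟶ G) (H : D ⟶ E) : F ≫ H ⟶ G ≫ H where
  app a := H.map (η.app a)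
  naturality f := by
    change H.map (F.map f) ≫ H.map _ = H.map _ ≫ H.map (G.map f)
    rw [← Functor.map_comp, η.naturality, Functor.map_comp]
  app_unit := by
    change (H.unitComp ≫ H.map F.unitComp) ≫ H.map (η.app unit) = H.unitComp ≫ H.map G.unitComp
    rw [Category.assoc, ← Functor.map_comp, η.app_unit]
  app_hom a b := by
    change (H.map (F.homComp a b) ≫ H.homComp _ _) ≫ post _ (H.map (η.app b)) =
      H.map (η.app (hom a b)) ≫ (H.map (G.homComp a b) ≫ H.homComp _ _) ≫ pre (H.map (η.app a)) _
    have h := congrArg (fun k => H.map k) (η.app_hom a b)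
    simp only [Functor.map_comp] at h
    simp only [Category.assoc, ← H.homComp_natural_right, ← H.homComp_natural_left,
      reassoc_of% h]

theorem eqToHom_app {F G : C ⟶ D} (h : F = G) (a : C) :
    ClosedTrans.app (eqToHom h) a = eqToHom (by rw [h]) := by
  subst h; rfl

@[simp] theorem eqToHom_assoc_app {C' : SkewCl.{v, u}} (F : C ⟶ D) (G : D ⟶ E) (H : E ⟶ C')
    (a : C) : ClosedTrans.app (eqToHom (assoc' F G H)) a = 𝟙 (H.obj (G.obj (F.obj a))) := by
  rw [eqToHom_app]; rfl

@[simp] theorem eqToHom_assoc_symm_app {C' : SkewCl.{v, u}} (F : C ⟶ D) (G : D ⟶ E)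
    (H : E ⟶ C') (a : C) :
    ClosedTrans.app (eqToHom (assoc' F G H).symm) a = 𝟙 (H.obj (G.obj (F.obj a))) := by
  rw [eqToHom_app]; rfl

@[simp] theorem eqToHom_id_comp_app (F : C ⟶ D) (a : C) :
    ClosedTrans.app (eqToHom (id_comp' F)) a = 𝟙 (F.obj a) := by
  rw [eqToHom_app]; rfl

@[simp] theorem eqToHom_id_comp_symm_app (F : C ⟶ D) (a : C) :
    ClosedTrans.app (eqToHom (id_comp' F).symm) a = 𝟙 (F.obj a) := by
  rw [eqToHom_app]; rfl

@[simp] theorem eqToHom_comp_id_app (F : C ⟶ D) (a : C) :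
    ClosedTrans.app (eqToHom (comp_id' F)) a = 𝟙 (F.obj a) := by
  rw [eqToHom_app]; rfl

@[simp] theorem eqToHom_comp_id_symm_app (F : C ⟶ D) (a : C) :
    ClosedTrans.app (eqToHom (comp_id' F).symm) a = 𝟙 (F.obj a) := by
  rw [eqToHom_app]; rfl

/-- The 2-category of skew closed categories, closed functors and closed transformations. -/
instance bicategory : Bicategory SkewCl.{v, u} where
  homCategory := homCategory
  whiskerLeft F _ _ η := whiskerL F η
  whiskerRight η H := whiskerR η H
  associator F G H := eqToIso (assoc' F G H)
  leftUnitor F := eqToIso (id_comp' F)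
  rightUnitor F := eqToIso (comp_id' F)
  whiskerLeft_id _ _ := rfl
  whiskerLeft_comp _ _ _ _ _ _ := rfl
  id_whiskerLeft η := hom₂_ext fun a => by
    simp [whiskerL]
  comp_whiskerLeft _ _ _ _ _ := hom₂_ext fun a => by
    simp [whiskerL]
  id_whiskerRight F G := hom₂_ext fun a => G.map_id _
  comp_whiskerRight _ _ H := hom₂_ext fun a => H.map_comp _ _
  whiskerRight_id η := hom₂_ext fun a => by
    simp [whiskerR]
  whiskerRight_comp _ _ _ := hom₂_ext fun a => by
    simp [whiskerR]
  whisker_assoc _ _ _ _ _ := hom₂_ext fun a => by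
    simp [whiskerR, whiskerL]
  whisker_exchange η θ := hom₂_ext fun a => (θ.naturality (η.app a)).symm
  pentagon _ _ _ _ := hom₂_ext fun a => by
    simp [whiskerR, whiskerL]
    rw [eqToHom_app]; rfl
  triangle _ _ := hom₂_ext fun a => by
    simp [whiskerR, whiskerL]

instance : Bicategory.Strict SkewCl.{v, u} where
  id_comp := id_comp'
  comp_id := comp_id'
  assoc := assoc'

end SkewCl

/-! ### Skew multicategories -/

/-- The two types of multimaps. The `Cat`-operad `R` has `R₀ = {ℓ}` and `Rₙ = {t ⟶ ℓ}` for
`n > 0`: there are tight and loose `n`-ary multimaps for `n > 0`, but nullary multimaps are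
always loose. -/
inductive Tightness : Type
  | tight : Tightness
  | loose : Tightness

namespace Tightness

/-- The composite type `x(y,...)` in `R`, where `y` is the type of the first argument: it is
tight if and only if `x` and `y` are. -/
def comp : Tightness → Tightness → Tightness
  | tight, y => y
  | loose, _ => loose

end Tightness

/-- A multimap of unspecified type, source and target, in a family of sets of multimaps. -/
structure MultiArrow {Obj : Type u} (Hom : Tightness → List Obj → Obj → Type v) where
  type : Tightness
  src : List Obj
  tgt : Obj
  map : Hom type src tgt

namespace MultiArrow

variable {Obj : Type u} {Hom : Tightness → List Obj → Obj → Type v}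

/-- The type of the first multimap of a list. (The value for the empty list plays no role in
the types of composites, since a nullary multimap is loose.) -/
def headType : List (MultiArrow Hom) → Tightness
  | [] => Tightness.loose
  | f :: _ => f.type

/-- The action on multimaps of a function on objects and a family of functions on the sets of
multimaps. -/
def mapArrow {Obj' : Type u} {Hom' : Tightness → List Obj' → Obj' → Type v} (obj : Obj → Obj')
    (map : ∀ (x : Tightness) (as : List Obj) (b : Obj),
      Hom x as b → Hom' x (as.map obj) (obj b))
    (f : MultiArrow Hom) : MultiArrow Hom' :=
  ⟨f.type, f.src.map obj, obj f.tgt, map f.type f.src f.tgt f.map⟩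

end MultiArrow

set_option linter.checkUnivs false in
/-- The data of a skew multicategory. -/
structure SkewMulticatData where
  Obj : Type u
  /-- `Hom x [a₁,...,aₙ] b` is the set of multimaps `a₁,...,aₙ ⟶ b` of type `x`. -/
  Hom : Tightness → List Obj → Obj → Type v
  /-- The comparison, viewing a tight multimap as a loose one. -/
  loosen : ∀ {as : List Obj} {b : Obj}, Hom Tightness.tight as b → Hom Tightness.loose as b
  one : ∀ a : Obj, Hom Tightness.tight [a] a
  /-- The substitution `g(f₁,...,fₙ)`, where `fs = [f₁,...,fₙ]` is a list of multimaps whose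
  targets form the source of `g`. The source of `g(f₁,...,fₙ)` is the concatenation of the
  sources of the `fᵢ`, and its type is tight if and only if `g` and `f₁` are tight. -/
  sub : ∀ {x : Tightness} {c : Obj} (fs : List (MultiArrow Hom)),
    Hom x (fs.map MultiArrow.tgt) c →
      Hom (x.comp (MultiArrow.headType fs)) (fs.flatMap MultiArrow.src) c

namespace SkewMulticatData

variable (A : SkewMulticatData.{v, u})

/-- The multimaps of all types, sources and targets. -/
abbrev Arrow : Type (max u v) := MultiArrow A.Hom

variable {A}

/-- A multimap, with its type, source and target. -/
abbrev arrow {x : Tightness} {as : List A.Obj} {b : A.Obj} (f : A.Hom x as b) : A.Arrow :=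
  ⟨x, as, b, f⟩

/-- The identity multimap. -/
abbrev idArrow (a : A.Obj) : A.Arrow := arrow (A.one a)

/-- A multimap viewed as a loose one. -/
def loosenArrow : A.Arrow → A.Arrow
  | ⟨Tightness.tight, as, b, f⟩ => ⟨Tightness.loose, as, b, A.loosen f⟩
  | ⟨Tightness.loose, as, b, f⟩ => ⟨Tightness.loose, as, b, f⟩

/-- The substitution `g(f₁,...,fₙ)`, for multimaps such that the list of targets of the `fᵢ` is
equal to the source of `g`. -/
def subst (g : A.Arrow) (fs : List A.Arrow) (h : g.src = fs.map MultiArrow.tgt) : A.Arrow :=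
  ⟨g.type.comp (MultiArrow.headType fs), fs.flatMap MultiArrow.src, g.tgt, A.sub fs (h ▸ g.map)⟩

variable (A) in
/-- A multimap `g` with a list of multimaps `f₁,...,fₙ` that can be substituted in it. -/
structure Composable where
  outer : A.Arrow
  inner : List A.Arrow
  src_eq : outer.src = inner.map MultiArrow.tgt

/-- The multimap `g(f₁,...,fₙ)`. -/
def Composable.comp (p : A.Composable) : A.Arrow := subst p.outer p.inner p.src_eq

@[simp] theorem subst_src (g : A.Arrow) (fs : List A.Arrow) (h : g.src = fs.map MultiArrow.tgt) :
    (subst g fs h).src = fs.flatMap MultiArrow.src := rfl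

@[simp] theorem subst_tgt (g : A.Arrow) (fs : List A.Arrow) (h : g.src = fs.map MultiArrow.tgt) :
    (subst g fs h).tgt = g.tgt := rfl

@[simp] theorem loosenArrow_src (f : A.Arrow) : (loosenArrow f).src = f.src := by
  rcases f with ⟨_ | _, _, _, _⟩ <;> rfl

@[simp] theorem loosenArrow_tgt (f : A.Arrow) : (loosenArrow f).tgt = f.tgt := by
  rcases f with ⟨_ | _, _, _, _⟩ <;> rfl

theorem flatMap_src_outer (L : List A.Composable) :
    (L.map Composable.outer).flatMap MultiArrow.src =
      (L.flatMap Composable.inner).map MultiArrow.tgt := by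
  induction L with
  | nil => rfl
  | cons p L ih => simp [p.src_eq, ih]

theorem map_tgt_comp (L : List A.Composable) :
    (L.map Composable.comp).map MultiArrow.tgt =
      (L.map Composable.outer).map MultiArrow.tgt := by
  simp only [List.map_map]; rfl

theorem map_tgt_idArrow (as : List A.Obj) : as = (as.map idArrow).map MultiArrow.tgt := by
  rw [List.map_map]; exact (List.map_id as).symm

end SkewMulticatData

set_option linter.checkUnivs false in
open SkewMulticatData in
/-- A skew multicategory, that is, an `R`-multicategory: each functor `Rₙ ⥤ Type` amounts to the
sets of tight and loose multimaps with the comparison function between them, and associativity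
and the identity laws are equations between multimaps of the same type, source and target. -/
structure SkewMulticat extends SkewMulticatData.{v, u} where
  /-- There are no tight nullary multimaps. -/
  tight_nullary : ∀ b : Obj, IsEmpty (Hom Tightness.tight [] b)
  /-- `1(f) = f` -/
  one_subst : ∀ f : toSkewMulticatData.Arrow, subst (idArrow f.tgt) [f] (by simp) = f
  /-- `f(1,...,1) = f` -/
  subst_one : ∀ f : toSkewMulticatData.Arrow,
    subst f (f.src.map idArrow) (map_tgt_idArrow f.src) = f
  /-- `(h(g₁,...,gₙ))(f₁₁,...,fₙₖ) = h(g₁(f₁₁,...),...,gₙ(...,fₙₖ))` -/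
  assoc : ∀ (h : toSkewMulticatData.Arrow) (L : List toSkewMulticatData.Composable)
    (hh : h.src = (L.map Composable.outer).map MultiArrow.tgt),
    subst (subst h (L.map Composable.outer) hh) (L.flatMap Composable.inner)
        ((subst_src h _ hh).trans (flatMap_src_outer L)) =
      subst h (L.map Composable.comp) (hh.trans (map_tgt_comp L).symm)
  /-- Substitution is natural in the type of `g`. -/
  loosen_subst : ∀ (g : toSkewMulticatData.Arrow) (fs : List toSkewMulticatData.Arrow)
    (h : g.src = fs.map MultiArrow.tgt),
    subst (loosenArrow g) fs ((loosenArrow_src g).trans h) = loosenArrow (subst g fs h)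
  /-- Substitution is natural in the type of `f₁`. -/
  subst_loosen_head : ∀ (g f : toSkewMulticatData.Arrow) (fs : List toSkewMulticatData.Arrow)
    (h : g.src = (f :: fs).map MultiArrow.tgt),
    subst g (loosenArrow f :: fs) (by simpa using h) = loosenArrow (subst g (f :: fs) h)
  /-- Substitution is natural in the types of `f₂,...,fₙ`, on which the type of `g(f₁,...,fₙ)`
  does not depend. -/
  subst_loosen_tail : ∀ (g f₁ : toSkewMulticatData.Arrow)
    (fs : List toSkewMulticatData.Arrow) (f : toSkewMulticatData.Arrow)
    (fs' : List toSkewMulticatData.Arrow)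
    (h : g.src = (f₁ :: (fs ++ f :: fs')).map MultiArrow.tgt),
    subst g (f₁ :: (fs ++ loosenArrow f :: fs')) (by simpa using h) =
      subst g (f₁ :: (fs ++ f :: fs')) h

namespace SkewMulticat

open SkewMulticatData

/-- A morphism of skew multicategories. -/
structure Multifunctor (A B : SkewMulticat.{v, u}) where
  obj : A.Obj → B.Obj
  map : ∀ {x : Tightness} {as : List A.Obj} {b : A.Obj},
    A.Hom x as b → B.Hom x (as.map obj) (obj b)
  map_loosen : ∀ {as : List A.Obj} {b : A.Obj} (f : A.Hom Tightness.tight as b),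
    map (A.loosen f) = B.loosen (map f)
  map_one : ∀ a : A.Obj, map (A.one a) = B.one (obj a)
  map_subst : ∀ (g : A.Arrow) (fs : List A.Arrow) (h : g.src = fs.map MultiArrow.tgt),
    MultiArrow.mapArrow (Hom' := B.Hom) obj (fun _ _ _ f => map f) (subst g fs h) =
      subst (MultiArrow.mapArrow (Hom' := B.Hom) obj (fun _ _ _ f => map f) g)
        (fs.map (MultiArrow.mapArrow (Hom' := B.Hom) obj (fun _ _ _ f => map f)))
        (by simp [MultiArrow.mapArrow, h])

namespace Multifunctor

variable {A B C : SkewMulticat.{v, u}}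

/-- The action of a morphism on multimaps of all types, sources and targets. -/
def arr (F : Multifunctor A B) : A.Arrow → B.Arrow :=
  MultiArrow.mapArrow F.obj (fun _ _ _ f => F.map f)

@[simp] theorem arr_type (F : Multifunctor A B) (f : A.Arrow) : (F.arr f).type = f.type := rfl
@[simp] theorem arr_src (F : Multifunctor A B) (f : A.Arrow) :
    (F.arr f).src = f.src.map F.obj := rfl
@[simp] theorem arr_tgt (F : Multifunctor A B) (f : A.Arrow) :
    (F.arr f).tgt = F.obj f.tgt := rfl

theorem arr_src_eq (F : Multifunctor A B) {g : A.Arrow} {fs : List A.Arrow}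
    (h : g.src = fs.map MultiArrow.tgt) :
    (F.arr g).src = (fs.map F.arr).map MultiArrow.tgt := by
  simp [h]

theorem arr_subst (F : Multifunctor A B) (g : A.Arrow) (fs : List A.Arrow)
    (h : g.src = fs.map MultiArrow.tgt) :
    F.arr (subst g fs h) = subst (F.arr g) (fs.map F.arr) (F.arr_src_eq h) :=
  F.map_subst g fs h

theorem arrow_injective {A : SkewMulticatData.{v, u}} {x : Tightness} {as : List A.Obj}
    {b : A.Obj} {f g : A.Hom x as b} (h : arrow f = arrow g) : f = g := by
  cases h; rfl

theorem arrow_cast {A : SkewMulticatData.{v, u}} {x : Tightness} {as as' : List A.Obj}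
    {b : A.Obj} (h : as = as') (f : A.Hom x as b) : arrow (h ▸ f : A.Hom x as' b) = arrow f := by
  subst h; rfl

theorem loosen_cast {A : SkewMulticatData.{v, u}} {as as' : List A.Obj}
    {b : A.Obj} (h : as = as') (f : A.Hom Tightness.tight as b) :
    A.loosen (h ▸ f : A.Hom Tightness.tight as' b) = h ▸ A.loosen f := by
  subst h; rfl

theorem subst_congr {A : SkewMulticatData.{v, u}} {g g' : A.Arrow} {fs fs' : List A.Arrow}
    (hg : g = g') (hfs : fs = fs') (h : g.src = fs.map MultiArrow.tgt)
    (h' : g'.src = fs'.map MultiArrow.tgt) : subst g fs h = subst g' fs' h' := by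
  subst hg hfs; rfl

theorem ext {F G : Multifunctor A B} (h : ∀ a, F.obj a = G.obj a)
    (h' : ∀ f : A.Arrow, F.arr f = G.arr f) : F = G := by
  obtain ⟨o, m, _, _, _⟩ := F
  obtain ⟨o', m', _, _, _⟩ := G
  obtain rfl : o = o' := funext h
  have : @m = @m' := by
    funext x as b f
    exact arrow_injective (h' (arrow f))
  subst this
  rfl

/-- The identity morphism. -/
def id (A : SkewMulticat.{v, u}) : Multifunctor A A where
  obj a := a
  map {_ as _} f := (List.map_id as).symm ▸ f
  map_loosen {as b} f := (loosen_cast (List.map_id as).symm f).symm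
  map_one a := rfl
  map_subst g fs h := by
    have e : ∀ f : A.Arrow, MultiArrow.mapArrow (Hom := A.Hom) (Hom' := A.Hom) (fun a => a)
        (fun _ as _ f => (List.map_id as).symm ▸ f) f = f := fun f =>
      arrow_cast (List.map_id f.src).symm f.map
    rw [e]
    refine subst_congr (e _).symm ?_ _ _
    conv_lhs => rw [← List.map_id fs]
    exact List.map_congr_left fun f _ => (e f).symm

theorem id_arr (f : A.Arrow) : (id A).arr f = f := arrow_cast (List.map_id f.src).symm f.map

/-- Composition of morphisms. -/
def comp (F : Multifunctor A B) (G : Multifunctor B C) : Multifunctor A C where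
  obj a := G.obj (F.obj a)
  map {_ as _} f := (List.map_map (f := F.obj) (g := G.obj) (l := as)) ▸ G.map (F.map f)
  map_loosen {as b} f := by
    rw [F.map_loosen, G.map_loosen]
    exact (loosen_cast _ _).symm
  map_one a := by
    change G.map (F.map (A.one a)) = _
    rw [F.map_one, G.map_one]
  map_subst g fs h := by
    have e : ∀ f : A.Arrow, MultiArrow.mapArrow (Hom := A.Hom) (Hom' := C.Hom)
        (fun a => G.obj (F.obj a))
        (fun _ as _ f =>
          (List.map_map (f := F.obj) (g := G.obj) (l := as)) ▸ G.map (F.map f)) f =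
        G.arr (F.arr f) := fun f => arrow_cast _ (G.map (F.map f.map))
    rw [e, F.arr_subst, G.arr_subst]
    refine subst_congr (e _).symm ?_ _ _
    rw [List.map_map]
    exact List.map_congr_left fun f _ => (e f).symm

theorem comp_arr (F : Multifunctor A B) (G : Multifunctor B C) (f : A.Arrow) :
    (F.comp G).arr f = G.arr (F.arr f) := arrow_cast _ (G.map (F.map f.map))

end Multifunctor

/-- A 2-cell `φ : F ⟶ G` of skew multicategories: tight unary multimaps `φ a : F a ⟶ G a` such
that `φ_b (F f) = (G f)(φ_{a₁},...,φ_{aₙ})` for all multimaps `f : a₁,...,aₙ ⟶ b`. -/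
structure MultiTrans {A B : SkewMulticat.{v, u}} (F G : Multifunctor A B) where
  app : ∀ a : A.Obj, B.Hom Tightness.tight [F.obj a] (G.obj a)
  naturality : ∀ f : A.Arrow,
    subst (arrow (app f.tgt)) [F.arr f] (by simp) =
      subst (G.arr f) (f.src.map fun a => arrow (app a))
        (by rw [List.map_map]; exact List.map_congr_left fun a _ => rfl)

namespace MultiTrans

open Multifunctor

variable {A B C : SkewMulticat.{v, u}}

theorem ext {F G : Multifunctor A B} {φ ψ : MultiTrans F G}
    (h : ∀ a, arrow (φ.app a) = arrow (ψ.app a)) : φ = ψ := by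
  cases φ; cases ψ; congr 1; exact funext fun a => arrow_injective (h a)

theorem src_eq {F G : Multifunctor A B} (φ : MultiTrans F G) (as : List A.Obj) :
    as.map G.obj = (as.map fun a => arrow (φ.app a)).map MultiArrow.tgt := by
  rw [List.map_map]; exact List.map_congr_left fun a _ => rfl

theorem subst_subst_unary (h g : B.Arrow) (fs : List B.Arrow) (hh : h.src = [g.tgt])
    (hg : g.src = fs.map MultiArrow.tgt) :
    subst (subst h [g] hh) fs (by simpa [subst] using hg) = subst h [subst g fs hg] hh :=
  (subst_congr rfl (by simp) _ _).trans (B.assoc h [⟨g, fs, hg⟩] hh)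

theorem subst_subst_map {ι : Type u} (h : B.Arrow) (l : List ι) (g f : ι → B.Arrow)
    (hg : ∀ a, (g a).src = [(f a).tgt]) (hh : h.src = (l.map g).map MultiArrow.tgt) :
    subst (subst h (l.map g) hh) (l.map f)
        (by
          change (l.map g).flatMap MultiArrow.src = _
          clear hh
          induction l with
          | nil => rfl
          | cons a l ih => simp [hg, ih]) =
      subst h (l.map fun a => subst (g a) [f a] (hg a))
        (by rw [hh, List.map_map, List.map_map]; exact List.map_congr_left fun a _ => rfl) := by
  let L : List B.Composable := l.map fun a => ⟨g a, [f a], hg a⟩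
  have h1 : l.map g = L.map Composable.outer := by
    rw [List.map_map]; exact List.map_congr_left fun a _ => rfl
  have h2 : l.map f = L.flatMap Composable.inner := by
    simp only [L]
    clear hh h1 L
    induction l with
    | nil => rfl
    | cons a l ih => simp [ih]
  have h3 : (l.map fun a => subst (g a) [f a] (hg a)) = L.map Composable.comp := by
    rw [List.map_map]; exact List.map_congr_left fun a _ => rfl
  refine (subst_congr (subst_congr rfl h1 _ (h1 ▸ hh)) h2 _ (flatMap_src_outer L)).trans
    ((B.assoc h L (h1 ▸ hh)).trans (subst_congr rfl h3.symm _ _))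

/-- The identity 2-cell. -/
def id (F : Multifunctor A B) : MultiTrans F F where
  app a := B.one (F.obj a)
  naturality f := by
    refine (B.one_subst (F.arr f)).trans ((B.subst_one (F.arr f)).symm.trans ?_)
    refine subst_congr rfl ?_ _ _
    rw [arr_src, List.map_map]
    exact List.map_congr_left fun a _ => rfl

/-- Vertical composition of 2-cells. -/
def comp {F G H : Multifunctor A B} (φ : MultiTrans F G) (ψ : MultiTrans G H) :
    MultiTrans F H where
  app a := B.sub [arrow (φ.app a)] (ψ.app a)
  naturality f := by
    have h1 := subst_subst_unary (arrow (ψ.app f.tgt)) (arrow (φ.app f.tgt)) [F.arr f] rfl rfl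
    have h2 := subst_subst_unary (arrow (ψ.app f.tgt)) (G.arr f)
      (f.src.map fun a => arrow (φ.app a)) rfl (φ.src_eq f.src)
    have h3 := subst_subst_map (H.arr f) f.src (fun a => arrow (ψ.app a))
      (fun a => arrow (φ.app a)) (fun _ => rfl) (ψ.src_eq f.src)
    refine h1.trans ((subst_congr rfl (by rw [φ.naturality f]) _ _).trans (h2.symm.trans
      ((subst_congr (ψ.naturality f) rfl _ _).trans h3)))

/-- The 2-cell with components `φ_{F a}`. -/
def whiskerL (F : Multifunctor A B) {G H : Multifunctor B C} (φ : MultiTrans G H) :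
    MultiTrans (F.comp G) (F.comp H) where
  app a := φ.app (F.obj a)
  naturality f := by
    refine (subst_congr rfl (by rw [comp_arr]) _ _).trans ((φ.naturality (F.arr f)).trans
      (subst_congr (comp_arr F H f).symm ?_ _ _))
    rw [arr_src, List.map_map]
    exact List.map_congr_left fun a _ => rfl

/-- The 2-cell with components `H φ_a`. -/
def whiskerR {F G : Multifunctor A B} (φ : MultiTrans F G) (H : Multifunctor B C) :
    MultiTrans (F.comp H) (G.comp H) where
  app a := H.map (φ.app a)
  naturality f := by
    have h1 := H.arr_subst (arrow (φ.app f.tgt)) [F.arr f] rfl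
    have h2 := H.arr_subst (G.arr f) (f.src.map fun a => arrow (φ.app a)) (φ.src_eq f.src)
    refine (subst_congr rfl ?_ _ _).trans (h1.symm.trans
      ((congrArg H.arr (φ.naturality f)).trans (h2.trans
        (subst_congr (comp_arr G H f).symm ?_ _ _))))
    · rw [comp_arr]; rfl
    · rw [List.map_map]
      exact List.map_congr_left fun a _ => rfl

end MultiTrans

instance : CategoryStruct SkewMulticat.{v, u} where
  Hom := Multifunctor
  id := Multifunctor.id
  comp := Multifunctor.comp

variable {A B C D : SkewMulticat.{v, u}}

/-- 2-cells compose componentwise. -/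
instance homCategory (A B : SkewMulticat.{v, u}) : Category (A ⟶ B) where
  Hom F G := MultiTrans F G
  id F := MultiTrans.id F
  comp φ ψ := MultiTrans.comp φ ψ
  id_comp φ := MultiTrans.ext fun a => B.subst_one (arrow (φ.app a))
  comp_id φ := MultiTrans.ext fun a => B.one_subst (arrow (φ.app a))
  assoc φ ψ χ := MultiTrans.ext fun a =>
    (MultiTrans.subst_subst_unary (arrow (χ.app a)) (arrow (ψ.app a)) [arrow (φ.app a)]
      rfl rfl).symm

theorem hom₂_ext {F G : A ⟶ B} {φ ψ : F ⟶ G} (h : ∀ a, φ.app a = ψ.app a) : φ = ψ :=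
  MultiTrans.ext fun a => by rw [h a]

theorem id_comp' (F : A ⟶ B) : 𝟙 A ≫ F = F :=
  Multifunctor.ext (fun _ => rfl) fun f => by
    refine (Multifunctor.comp_arr (Multifunctor.id A) F f).trans ?_
    rw [Multifunctor.id_arr]

theorem comp_id' (F : A ⟶ B) : F ≫ 𝟙 B = F :=
  Multifunctor.ext (fun _ => rfl) fun f => by
    refine (Multifunctor.comp_arr F (Multifunctor.id B) f).trans ?_
    rw [Multifunctor.id_arr]

theorem assoc' (F : A ⟶ B) (G : B ⟶ C) (H : C ⟶ D) : (F ≫ G) ≫ H = F ≫ G ≫ H :=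
  Multifunctor.ext (fun _ => rfl) fun f => by
    change (Multifunctor.comp (Multifunctor.comp F G) H).arr f =
      (Multifunctor.comp F (Multifunctor.comp G H)).arr f
    simp only [Multifunctor.comp_arr]

theorem eqToHom_app {F G : A ⟶ B} (h : F = G) (a : A.Obj) :
    arrow (MultiTrans.app (eqToHom h) a) = idArrow (F.obj a) := by
  subst h; rfl

theorem eqToHom_comp_app {F F' G : A ⟶ B} (h : F = F') (φ : F' ⟶ G) (a : A.Obj) :
    arrow (MultiTrans.app (eqToHom h ≫ φ) a) = arrow (φ.app a) := by
  subst h; rw [eqToHom_refl, Category.id_comp]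

theorem comp_eqToHom_app {F G G' : A ⟶ B} (φ : F ⟶ G) (h : G = G') (a : A.Obj) :
    arrow (MultiTrans.app (φ ≫ eqToHom h) a) = arrow (φ.app a) := by
  subst h; rw [eqToHom_refl, Category.comp_id]

theorem whiskerL_eqToHom (F : A ⟶ B) {G H : B ⟶ C} (h : G = H) :
    MultiTrans.whiskerL F (eqToHom h) = eqToHom (C := A ⟶ C) (congrArg (F ≫ ·) h) := by
  subst h; rfl

theorem whiskerR_eqToHom {F G : A ⟶ B} (h : F = G) (H : B ⟶ C) :
    MultiTrans.whiskerR (eqToHom h) H = eqToHom (C := A ⟶ C) (congrArg (· ≫ H) h) := by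
  subst h; exact hom₂_ext fun a => H.map_one _

/-- The 2-category of skew multicategories. -/
instance bicategory : Bicategory SkewMulticat.{v, u} where
  homCategory := homCategory
  whiskerLeft F _ _ φ := MultiTrans.whiskerL F φ
  whiskerRight φ H := MultiTrans.whiskerR φ H
  associator F G H := eqToIso (assoc' F G H)
  leftUnitor F := eqToIso (id_comp' F)
  rightUnitor F := eqToIso (comp_id' F)
  whiskerLeft_id _ _ := rfl
  whiskerLeft_comp _ _ _ _ _ _ := rfl
  id_whiskerLeft φ := MultiTrans.ext fun a => by
    rw [eqToIso.hom, eqToIso.inv, eqToHom_comp_app, comp_eqToHom_app]; rfl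
  comp_whiskerLeft _ _ _ _ _ := MultiTrans.ext fun a => by
    rw [eqToIso.hom, eqToIso.inv, eqToHom_comp_app, comp_eqToHom_app]; rfl
  id_whiskerRight F G := hom₂_ext fun a => G.map_one _
  comp_whiskerRight φ ψ H := MultiTrans.ext fun a =>
    H.arr_subst (arrow (ψ.app a)) [arrow (φ.app a)] rfl
  whiskerRight_id φ := MultiTrans.ext fun a => by
    rw [eqToIso.hom, eqToIso.inv, eqToHom_comp_app, comp_eqToHom_app]; rfl
  whiskerRight_comp _ _ _ := MultiTrans.ext fun a => by
    rw [eqToIso.hom, eqToIso.inv, eqToHom_comp_app, comp_eqToHom_app]; rfl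
  whisker_assoc _ _ _ _ _ := MultiTrans.ext fun a => by
    rw [eqToIso.hom, eqToIso.inv, eqToHom_comp_app, comp_eqToHom_app]; rfl
  whisker_exchange φ ψ := MultiTrans.ext fun a => (ψ.naturality (arrow (φ.app a))).symm
  pentagon _ _ _ _ := by
    simp only [eqToIso.hom, whiskerL_eqToHom, whiskerR_eqToHom, eqToHom_trans]
  triangle _ _ := by
    simp only [eqToIso.hom, whiskerL_eqToHom, whiskerR_eqToHom, eqToHom_trans]

instance : Bicategory.Strict SkewMulticat.{v, u} where
  id_comp := id_comp'
  comp_id := comp_id'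
  assoc := assoc'

/-- The function `f ↦ e(f,1)`, for a tight multimap `e : h, b ⟶ c`. -/
def substFirst (A : SkewMulticat.{v, u}) {h b c : A.Obj} (e : A.Hom Tightness.tight [h, b] c)
    (x : Tightness) (as : List A.Obj) (f : A.Hom x as h) : A.Hom x (as ++ [b]) c :=
  A.sub [arrow f, idArrow b] e

/-- A skew multicategory is closed if for all `b, c` there are an object `[b,c]` and a tight
multimap `e : [b,c], b ⟶ c` such that `f ↦ e(f,1)` is a bijection from the multimaps
`a₁,...,aₙ ⟶ [b,c]` of type `x` to the multimaps `a₁,...,aₙ,b ⟶ c` of type `x`, for all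
`a₁,...,aₙ` and all types `x` of `n`-ary multimaps (so `x` is loose if `n = 0`). -/
def IsClosed (A : SkewMulticat.{v, u}) : Prop :=
  ∀ b c : A.Obj, ∃ (h : A.Obj) (e : A.Hom Tightness.tight [h, b] c),
    ∀ (x : Tightness) (as : List A.Obj), (as = [] → x = Tightness.loose) →
      Function.Bijective (A.substFirst e x as)

/-- The function `f ↦ f(θ)`, for a nullary multimap `θ`. -/
def substNullary (A : SkewMulticat.{v, u}) {i : A.Obj} (θ : A.Hom Tightness.loose [] i)
    (b : A.Obj) (f : A.Hom Tightness.tight [i] b) : A.Hom Tightness.loose [] b :=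
  A.sub [arrow θ] f

/-- A skew multicategory has a unit (a nullary map classifier) if there are an object `i` and a
nullary multimap `θ` with target `i` such that `f ↦ f(θ)` is a bijection from the tight unary
multimaps `i ⟶ b` to the nullary multimaps with target `b`, for all `b`. -/
def HasUnit (A : SkewMulticat.{v, u}) : Prop :=
  ∃ (i : A.Obj) (θ : A.Hom Tightness.loose [] i),
    ∀ b : A.Obj, Function.Bijective (A.substNullary θ b)

end SkewMulticat

set_option linter.checkUnivs false in
/-- The full sub-2-category of the 2-category of skew multicategories on the closed skew
multicategories with unit. -/
abbrev ClosedSkewMulticatWithUnit : Type (max (u + 1) (v + 1)) :=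
  InducedBicategory SkewMulticat.{v, u}
    (fun A : {A : SkewMulticat.{v, u} // A.IsClosed ∧ A.HasUnit} => A.1)

/-! A 2-functor that is bijective on 1-cells and on 2-cells, and surjective on objects up to
isomorphism, is half of a 2-equivalence (`TwoEquivalence.nonempty_of_locally_bijective`). The
2-functor used is `toSkewCl`: a closed skew multicategory with unit goes to its category of tight
unary multimaps, with `[b,c]` and `u` as internal hom and unit. Writing `x(y)` for `e(x,y)`, the
structure maps are given on generalized elements by `L(x)(y)(z) = x(y(z))`, `i(x) = x(θ)` and
`j(θ)(y) = y` made loose, and each axiom is checked by evaluating both sides.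

Bijectivity on 1-cells and 2-cells rests on generation: a nullary multimap is `k(θ)` for a unique
tight `k`, and any other multimap is either tight unary or `e(f,1)` for a unique `f` of smaller
arity (`nonempty_application`, `arrow_induction`). A morphism of skew multicategories is therefore
determined by its closed functor (`arr_eq`). Conversely a closed functor defines an action on
multimaps by recursion on arity. The maps `i`, `L` and precomposition rewrite any `e(x,y)` in terms
of applications to an identity, so the axioms of a closed functor force compatibility with
evaluation (`arr_ap`) and then with all substitutions (`arr_subst`). The same induction extends the
naturality of a closed transformation from unary multimaps to all multimaps (`act_closedTransApp`).

For surjectivity on objects, a skew closed category `C` yields the skew multicategory `multicat C`,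
whose tight multimaps are morphisms `a₁ ⟶ [a₂,...,[aₙ,b]]` and whose loose ones are morphisms `I ⟶
[a₁,...,[aₙ,b]]`. The difficulty is associativity. A multimap `a₁,...,aₙ ⟶ b` of either type induces
a transformation `[b,-] ⟶ [a₁,...,[aₙ,-]]` compatible with `L`. Substitution into a loose multimap
is the action of the tensor product of these transformations; into a tight one it is composition in
the first variable and such an action in the others. The transformation of a substitute is the
composite of the transformations (`toTrans_subst`), so associativity reduces to that of composition
and the interchange law. The skew closed category recovered from `multicat C` has the same objects,
morphisms and structure as `C`, up to the choice of closed structure. -/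

/-! ### Locally bijective 2-functors -/

section LocallyBijective

variable {B : Type u₁} [Bicategory.{w₁, v₁} B] {C : Type u₂} [Bicategory.{w₂, v₂} C]

/-- A 2-cell with unspecified source and target 1-cells. -/
@[ext] structure TwoCell (a b : B) where
  src : a ⟶ b
  tgt : a ⟶ b
  cell : src ⟶ tgt

namespace TwoCell

/-- A 2-cell as a `TwoCell`. -/
abbrev of {a b : B} {f g : a ⟶ b} (η : f ⟶ g) : TwoCell a b := ⟨f, g, η⟩

theorem of_injective {a b : B} {f g : a ⟶ b} {η θ : f ⟶ g} (h : of η = of θ) : η = θ := by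
  cases h; rfl

/-- Left whiskering. -/
def wl {a b c : B} (f : a ⟶ b) (p : TwoCell b c) : TwoCell a c := of (f ◁ p.cell)

/-- Right whiskering. -/
def wr {a b c : B} (p : TwoCell a b) (g : b ⟶ c) : TwoCell a c := of (p.cell ▷ g)

-- The point of packing a 2-cell with its ends: the coherence isomorphisms of a strict bicategory
-- are `eqToHom`s, and they disappear after packing. Whiskering then satisfies the unit and
-- associativity laws as plain equations.
@[simp] theorem of_eqToHom_comp {a b : B} {f f' g : a ⟶ b} (h : f = f') (η : f' ⟶ g) :
    of (eqToHom h ≫ η) = of η := by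
  subst h; simp

@[simp] theorem of_comp_eqToHom {a b : B} {f g g' : a ⟶ b} (η : f ⟶ g) (h : g = g') :
    of (η ≫ eqToHom h) = of η := by
  subst h; simp

theorem of_whiskerLeft {a b c : B} (f : a ⟶ b) {g h : b ⟶ c} (η : g ⟶ h) :
    of (f ◁ η) = wl f (of η) := rfl

theorem of_whiskerRight {a b c : B} {f g : a ⟶ b} (η : f ⟶ g) (h : b ⟶ c) :
    of (η ▷ h) = wr (of η) h := rfl

section Strict

variable [Strict B]

@[simp] theorem wl_id {a b : B} (p : TwoCell a b) : wl (𝟙 a) p = p := by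
  obtain ⟨f, g, η⟩ := p
  have := id_whiskerLeft η
  rw [Strict.leftUnitor_eqToIso, Strict.leftUnitor_eqToIso, eqToIso.hom, eqToIso.inv] at this
  change of (𝟙 a ◁ η) = of η
  rw [this]; simp

@[simp] theorem wr_id {a b : B} (p : TwoCell a b) : wr p (𝟙 b) = p := by
  obtain ⟨f, g, η⟩ := p
  have := whiskerRight_id η
  rw [Strict.rightUnitor_eqToIso, Strict.rightUnitor_eqToIso, eqToIso.hom, eqToIso.inv] at this
  change of (η ▷ 𝟙 b) = of η
  rw [this]; simp

theorem wl_comp {a b c d : B} (f : a ⟶ b) (g : b ⟶ c) (p : TwoCell c d) :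
    wl (f ≫ g) p = wl f (wl g p) := by
  obtain ⟨h, k, η⟩ := p
  have := comp_whiskerLeft f g η
  rw [Strict.associator_eqToIso, Strict.associator_eqToIso, eqToIso.hom, eqToIso.inv] at this
  change of ((f ≫ g) ◁ η) = of (f ◁ g ◁ η)
  rw [this]; simp

theorem wr_comp {a b c d : B} (p : TwoCell a b) (f : b ⟶ c) (g : c ⟶ d) :
    wr p (f ≫ g) = wr (wr p f) g := by
  obtain ⟨h, k, η⟩ := p
  have := whiskerRight_comp η f g
  rw [Strict.associator_eqToIso, Strict.associator_eqToIso, eqToIso.hom, eqToIso.inv] at this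
  change of (η ▷ (f ≫ g)) = of ((η ▷ f) ▷ g)
  rw [this]; simp

theorem wr_wl {a b c d : B} (f : a ⟶ b) (p : TwoCell b c) (g : c ⟶ d) :
    wr (wl f p) g = wl f (wr p g) := by
  obtain ⟨h, k, η⟩ := p
  have := whisker_assoc f η g
  rw [Strict.associator_eqToIso, Strict.associator_eqToIso, eqToIso.hom, eqToIso.inv] at this
  change of ((f ◁ η) ▷ g) = of (f ◁ η ▷ g)
  rw [this]; simp

end Strict

/-- The action of a 2-functor. -/
def map (K : StrictPseudofunctor B C) {a b : B} (p : TwoCell a b) : TwoCell (K.obj a) (K.obj b) :=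
  of (K.map₂ p.cell)

theorem of_map₂ (K : StrictPseudofunctor B C) {a b : B} {f g : a ⟶ b} (η : f ⟶ g) :
    of (K.map₂ η) = map K (of η) := rfl

theorem map_wl (K : StrictPseudofunctor B C) {a b c : B} (f : a ⟶ b) (p : TwoCell b c) :
    map K (wl f p) = wl (K.map f) (map K p) := by
  obtain ⟨g, h, η⟩ := p
  change of (K.map₂ (f ◁ η)) = of (K.map f ◁ K.map₂ η)
  rw [K.map₂_whisker_left]
  simp [K.mapComp_eq_eqToIso]

theorem map_wr (K : StrictPseudofunctor B C) {a b c : B} (p : TwoCell a b) (f : b ⟶ c) :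
    map K (wr p f) = wr (map K p) (K.map f) := by
  obtain ⟨g, h, η⟩ := p
  change of (K.map₂ (η ▷ f)) = of (K.map₂ η ▷ K.map f)
  rw [K.map₂_whisker_right]
  simp [K.mapComp_eq_eqToIso]

end TwoCell

variable [Strict B] [Strict C]

/-- A 2-functor that is bijective on 1-cells and on 2-cells between given objects, and
surjective on objects up to isomorphism, is one half of a 2-equivalence. -/
theorem TwoEquivalence.nonempty_of_locally_bijective (K : StrictPseudofunctor B C)
    (h₁ : ∀ a b : B, Function.Bijective fun f : a ⟶ b => K.map f)
    (h₂ : ∀ {a b : B} (f g : a ⟶ b), Function.Bijective fun η : f ⟶ g => K.map₂ η)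
    (h₀ : ∀ c : C, ∃ (b : B) (e : K.obj b ⟶ c) (e' : c ⟶ K.obj b),
      e ≫ e' = 𝟙 (K.obj b) ∧ e' ≫ e = 𝟙 c) :
    Nonempty (TwoEquivalence C B) := by
  choose G r r' hr hr' using h₀
  have inj₁ : ∀ {a b : B} {f g : a ⟶ b}, K.map f = K.map g → f = g :=
    fun {a b _ _} h => (h₁ a b).1 h
  have injc : ∀ {a b : B} {p q : TwoCell a b}, p.map K = q.map K → p = q := by
    rintro a b ⟨f, g, η⟩ ⟨f', g', θ⟩ h
    have e₁ : f = f' := inj₁ (congrArg TwoCell.src h)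
    have e₂ : g = g' := inj₁ (congrArg TwoCell.tgt h)
    subst e₁ e₂
    obtain rfl : η = θ := (h₂ f g).1 (TwoCell.of_injective h)
    rfl
  choose k hk using fun a b => (h₁ a b).2
  simp only at hk
  have hr_assoc : ∀ (c : C) {d : C} (f : K.obj (G c) ⟶ d), r c ≫ r' c ≫ f = f := fun c d f => by
    rw [← Strict.assoc, hr, Strict.id_comp]
  have hr'_assoc : ∀ (c : C) {d : C} (f : c ⟶ d), r' c ≫ r c ≫ f = f := fun c d f => by
    rw [← Strict.assoc, hr', Strict.id_comp]
  -- Transport of structure: `M f` is the unique 1-cell that `K` sends to the conjugate of `f` by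
  -- the isomorphisms `r`. As `K` is injective on 1-cells and 2-cells, functoriality is checked
  -- after applying `K`, where each inner `r'` cancels against `r`.
  let M : ∀ {c d : C}, (c ⟶ d) → (G c ⟶ G d) := fun {c d} f => k _ _ (r c ≫ f ≫ r' d)
  have hM : ∀ {c d : C} (f : c ⟶ d), K.map (M f) = r c ≫ f ≫ r' d := fun f => hk _ _ _
  choose k₂ hk₂ using fun {a b : B} (f g : a ⟶ b) => (h₂ f g).2
  simp only at hk₂
  let M₂ : ∀ {c d : C} {f g : c ⟶ d}, (f ⟶ g) → (M f ⟶ M g) := fun {c d f g} η =>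
    k₂ _ _ (eqToHom (hM f) ≫ (r c ◁ (η ▷ r' d)) ≫ eqToHom (hM g).symm)
  have hM₂ : ∀ {c d : C} {f g : c ⟶ d} (η : f ⟶ g),
      K.map₂ (M₂ η) = eqToHom (hM f) ≫ (r c ◁ (η ▷ r' d)) ≫ eqToHom (hM g).symm :=
    fun η => hk₂ _ _ _
  have hMc : ∀ {c d : C} {f g : c ⟶ d} (η : f ⟶ g),
      (TwoCell.of (M₂ η)).map K = .wl (r c) (.wr (.of η) (r' d)) := fun η => by
    rw [← TwoCell.of_map₂, hM₂]
    simp [TwoCell.of_whiskerLeft, TwoCell.of_whiskerRight]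
  let S : StrictPseudofunctorPreCore C B :=
    { obj := G
      map := M
      map₂ := M₂
      map₂_id := fun f => (h₂ _ _).1 (by simp [hM₂])
      map₂_comp := fun η θ => (h₂ _ _).1 (by simp [hM₂])
      map_id := fun c => inj₁ (by rw [hM, K.map_id, Strict.id_comp, hr])
      map_comp := fun f g => inj₁ (by
        simp only [hM, K.map_comp, Strict.assoc, hr'_assoc])
      map₂_whisker_left := fun f _ _ η => TwoCell.of_injective (injc (by
        simp only [TwoCell.of_eqToHom_comp, TwoCell.of_comp_eqToHom]
        rw [hMc, TwoCell.of_whiskerLeft, TwoCell.of_whiskerLeft, TwoCell.map_wl, hM, hMc,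
          ← TwoCell.wl_comp, TwoCell.wr_wl, ← TwoCell.wl_comp, Strict.assoc, Strict.assoc, hr',
          Strict.comp_id]))
      map₂_whisker_right := fun η f => TwoCell.of_injective (injc (by
        simp only [TwoCell.of_eqToHom_comp, TwoCell.of_comp_eqToHom]
        rw [hMc, TwoCell.of_whiskerRight, TwoCell.of_whiskerRight, TwoCell.map_wr, hM, hMc,
          TwoCell.wr_wl, ← TwoCell.wr_comp, ← TwoCell.wr_comp, hr'_assoc])) }
  let G' : StrictPseudofunctor C B := StrictPseudofunctor.mk'' S
  -- One natural isomorphism has components `r'`. The other lies in `B`, so its components are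
  -- obtained by lifting `r` and `r'` at `K.obj b` through the bijection on 1-cells.
  let δ : ∀ b : B, (G (K.obj b) ⟶ b) := fun b => k _ _ (r (K.obj b))
  let δ' : ∀ b : B, (b ⟶ G (K.obj b)) := fun b => k _ _ (r' (K.obj b))
  have hδ : ∀ b, K.map (δ b) = r (K.obj b) := fun b => hk _ _ _
  have hδ' : ∀ b, K.map (δ' b) = r' (K.obj b) := fun b => hk _ _ _
  exact ⟨{
    functor := G'
    inverse := K
    unitIso :=
      { hom := r'
        inv := r
        hom_inv := hr'
        inv_hom := hr
        naturality := fun {a b} f => by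
          change f ≫ r' b = r' a ≫ K.map (M f)
          rw [hM, hr'_assoc]
        naturality₂ := fun {a b f g} η => TwoCell.of_injective (by
          simp only [TwoCell.of_eqToHom_comp, TwoCell.of_comp_eqToHom]
          change TwoCell.wr (.of η) (r' b) = TwoCell.wl (r' a) ((TwoCell.of (M₂ η)).map K)
          rw [hMc, ← TwoCell.wl_comp, hr', TwoCell.wl_id]) }
    counitIso :=
      { hom := δ
        inv := δ'
        hom_inv := fun b => inj₁ (by
          change K.map (δ b ≫ δ' b) = K.map (𝟙 (G (K.obj b)))
          rw [K.map_comp, hδ, hδ', hr, K.map_id])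
        inv_hom := fun b => inj₁ (by
          change K.map (δ' b ≫ δ b) = K.map (𝟙 b)
          rw [K.map_comp, hδ, hδ', hr', K.map_id])
        naturality := fun {a b} f => inj₁ (by
          change K.map (M (K.map f) ≫ δ b) = K.map (δ a ≫ f)
          rw [K.map_comp, K.map_comp, hM, hδ, hδ, Strict.assoc, Strict.assoc, hr',
            Strict.comp_id])
        naturality₂ := fun {a b f g} η => TwoCell.of_injective (injc (by
          simp only [TwoCell.of_eqToHom_comp, TwoCell.of_comp_eqToHom]
          change TwoCell.map K (TwoCell.wr (.of (M₂ (K.map₂ η))) (δ b)) =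
            TwoCell.map K (TwoCell.wl (δ a) (.of η))
          rw [TwoCell.map_wr, TwoCell.map_wl, hMc, hδ, hδ, TwoCell.wr_wl, ← TwoCell.wr_comp, hr',
            TwoCell.wr_id]
          rfl)) } }⟩

end LocallyBijective

/-! ### Iterated internal homs -/

namespace SkewCl

open SkewClosed InternalHom

variable {C : SkewCl.{v, u}}

/-- `[a₁,[a₂,...,[aₙ,b]]]`. -/
@[reducible] def ihoms : List C → C → C
  | [], b => b
  | a :: as, b => hom a (ihoms as b)

/-- The functorial action of `[a₁,...,[aₙ,-]]`. -/
@[reducible] def mapIhoms : ∀ (as : List C) {b c : C}, (b ⟶ c) → (ihoms as b ⟶ ihoms as c)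
  | [], _, _, f => f
  | a :: as, _, _, f => post a (mapIhoms as f)

/-- The iterated `L : [b,c] ⟶ [[a₁,...,[aₙ,b]],[a₁,...,[aₙ,c]]]`. -/
@[reducible] def Ls : ∀ (as : List C) (b c : C), hom b c ⟶ hom (ihoms as b) (ihoms as c)
  | [], _, _ => 𝟙 _
  | a :: as, b, c => Ls as b c ≫ L a (ihoms as b) (ihoms as c)

@[simp] theorem mapIhoms_id (as : List C) (b : C) : mapIhoms as (𝟙 b) = 𝟙 (ihoms as b) := by
  induction as with
  | nil => rfl
  | cons a as ih => simp only [mapIhoms, ih, post_id]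

theorem mapIhoms_comp (as : List C) {b c d : C} (f : b ⟶ c) (g : c ⟶ d) :
    mapIhoms as (f ≫ g) = mapIhoms as f ≫ mapIhoms as g := by
  induction as with
  | nil => rfl
  | cons a as ih => simp only [mapIhoms, ih, post_comp]

@[simp] theorem mapIhoms_eqToHom (as : List C) {b c : C} (h : b = c) :
    mapIhoms as (eqToHom h) = eqToHom (congrArg _ h) := by
  subst h; simp

@[simp] theorem post_eqToHom (a : C) {b c : C} (h : b = c) :
    post a (eqToHom h) = eqToHom (congrArg _ h) := by
  subst h; simp

/-- For a variable list `as` this is not a definitional equality; it is the source of the `eqToHom`s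
in every statement about concatenated lists. -/
theorem ihoms_append (as bs : List C) (c : C) : ihoms (as ++ bs) c = ihoms as (ihoms bs c) := by
  induction as with
  | nil => rfl
  | cons a as ih => simp only [ihoms, List.cons_append, ih]

theorem mapIhoms_append (as bs : List C) {b c : C} (f : b ⟶ c) :
    mapIhoms (as ++ bs) f =
      eqToHom (ihoms_append as bs b) ≫ mapIhoms as (mapIhoms bs f) ≫
        eqToHom (ihoms_append as bs c).symm := by
  induction as with
  | nil => simp [mapIhoms]
  | cons a as ih =>
    simp only [mapIhoms, List.cons_append, ih, post_comp, post_eqToHom]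

theorem Ls_natural_right (as : List C) (b : C) {c c' : C} (f : c ⟶ c') :
    post b f ≫ Ls as b c' = Ls as b c ≫ post (ihoms as b) (mapIhoms as f) := by
  induction as with
  | nil => simp only [Ls, Category.id_comp]; exact Category.comp_id _
  | cons a as ih =>
    simp only [Ls, reassoc_of% ih, L_natural_right, Category.assoc]

theorem Ls_natural_middle (as : List C) {b b' : C} (f : b ⟶ b') (c : C) :
    pre f c ≫ Ls as b c = Ls as b' c ≫ pre (mapIhoms as f) (ihoms as c) := by
  induction as with
  | nil => simp only [Ls, Category.id_comp]; exact Category.comp_id _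
  | cons a as ih =>
    simp only [Ls, reassoc_of% ih, L_natural_middle, Category.assoc]

theorem hom_congr {a a' b b' : C} (h : a = a') (h' : b = b') : hom a b = hom a' b' := by
  rw [h, h']

theorem L_congr (a : C) {b b' c c' : C} (h : b = b') (h' : c = c') :
    L a b c = eqToHom (hom_congr h h') ≫ L a b' c' ≫
      eqToHom (by rw [h, h']) := by
  subst h h'; simp

theorem Ls_append (as bs : List C) (b c : C) :
    Ls (as ++ bs) b c = Ls bs b c ≫ Ls as (ihoms bs b) (ihoms bs c) ≫
      eqToHom (by rw [ihoms_append, ihoms_append]) := by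
  induction as with
  | nil => simp only [Ls, Category.id_comp]; exact (Category.comp_id _).symm
  | cons a as ih =>
    simp only [Ls, List.cons_append, ih, Category.assoc,
      L_congr a (ihoms_append as bs b) (ihoms_append as bs c), eqToHom_trans_assoc,
      eqToHom_refl, Category.id_comp]

/-- The pentagon axiom, for the iterated `L`. -/
theorem Ls_pentagon (as : List C) (b c d : C) :
    L b c d ≫ post (hom b c) (Ls as b d) =
      Ls as c d ≫ L (ihoms as b) (ihoms as c) (ihoms as d) ≫
        pre (Ls as b c) (hom (ihoms as b) (ihoms as d)) := by
  induction as with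
  | nil => simp [Ls, ihoms]
  | cons a as ih =>
    simp only [Ls, post_comp, pre_comp, reassoc_of% ih, Category.assoc, pre_post]
    rw [← reassoc_of% (pentagon a (ihoms as b) (ihoms as c) (ihoms as d))]

/-- `j` for an iterated hom. -/
theorem j_Ls (as : List C) (b : C) : j b ≫ Ls as b b = j (ihoms as b) := by
  induction as with
  | nil => simp [Ls, ihoms]
  | cons a as ih => simp only [Ls, reassoc_of% ih, j_L]

/-! ### Strong transformations between iterated internal homs -/

/-- A natural transformation `[b₁,...,[bₘ,-]] ⟶ [a₁,...,[aₙ,-]]` compatible with `L`. -/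
structure HomTrans (C : SkewCl.{v, u}) where
  src : List C
  tgt : List C
  app : ∀ x : C, ihoms src x ⟶ ihoms tgt x
  naturality : ∀ {x y : C} (f : x ⟶ y), mapIhoms src f ≫ app y = app x ≫ mapIhoms tgt f
  strength : ∀ x y : C, Ls src x y ≫ post (ihoms src x) (app y) =
    Ls tgt x y ≫ pre (app x) (ihoms tgt y)

namespace HomTrans

theorem ext {P Q : HomTrans C} (h : P.src = Q.src) (h' : P.tgt = Q.tgt)
    (happ : ∀ x, P.app x = eqToHom (by rw [h]) ≫ Q.app x ≫ eqToHom (by rw [h'])) : P = Q := by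
  obtain ⟨s, t, p, _, _⟩ := P
  obtain ⟨s', t', q, _, _⟩ := Q
  dsimp only at h h'
  subst h h'
  obtain rfl : p = q := funext fun x => by simpa using happ x
  rfl

theorem app_congr (P : HomTrans C) {x y : C} (h : x = y) :
    P.app x = eqToHom (by rw [h]) ≫ P.app y ≫ eqToHom (by rw [h]) := by
  subst h; simp

/-- The identity transformation. -/
@[reducible] def id (as : List C) : HomTrans C where
  src := as
  tgt := as
  app x := 𝟙 _
  naturality := by simp
  strength := by simp

/-- Vertical composition. -/
@[reducible] def comp (P Q : HomTrans C) (h : P.tgt = Q.src) : HomTrans C where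
  src := P.src
  tgt := Q.tgt
  app x := P.app x ≫ eqToHom (by rw [h]) ≫ Q.app x
  naturality {x y} f := by
    obtain ⟨s, t, p, hp, _⟩ := P
    obtain ⟨s', t', q, hq, _⟩ := Q
    dsimp only at h
    subst h
    simp [reassoc_of% (hp f), hq]
  strength x y := by
    obtain ⟨s, t, p, _, hp⟩ := P
    obtain ⟨s', t', q, _, hq⟩ := Q
    dsimp only at h
    subst h
    simp only [eqToHom_refl, Category.id_comp, post_comp, pre_comp]
    rw [reassoc_of% (hp x y), pre_post, reassoc_of% (hq x y)]

/-- Horizontal composition. -/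
@[reducible] def tensor (P Q : HomTrans C) : HomTrans C where
  src := P.src ++ Q.src
  tgt := P.tgt ++ Q.tgt
  app x := eqToHom (ihoms_append _ _ x) ≫ P.app (ihoms Q.src x) ≫ mapIhoms P.tgt (Q.app x) ≫
    eqToHom (ihoms_append _ _ x).symm
  naturality {x y} f := by
    simp only [mapIhoms_append, Category.assoc, eqToHom_trans_assoc, eqToHom_refl,
      Category.id_comp, reassoc_of% P.naturality, ← reassoc_of% mapIhoms_comp, Q.naturality]
  strength x y := by
    -- The mathematical content, free of transports: the strengths of `P` and of `Q`, linked by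
    -- naturality of the iterated `L`.
    have key : Ls Q.src x y ≫ Ls P.src _ _ ≫
        post (ihoms P.src (ihoms Q.src x)) (P.app _ ≫ mapIhoms P.tgt (Q.app y)) =
        Ls Q.tgt x y ≫ Ls P.tgt _ _ ≫ pre (P.app _ ≫ mapIhoms P.tgt (Q.app x)) _ := by
      simp only [post_comp, pre_comp, reassoc_of% P.strength, pre_post]
      rw [← reassoc_of% Ls_natural_right, reassoc_of% Q.strength, reassoc_of% Ls_natural_middle]
    -- `e₁` and `e₂` carry the transports past `post` and `pre`; the objects are generalized so that
    -- the equalities between them can be eliminated.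
    have e₁ : ∀ {s s' y y' z z' d : C} (hs : s = s') (hy : y = y') (hz : z' = z)
        (f : y' ⟶ z') (a : d ⟶ hom s' y'),
        (a ≫ eqToHom (hom_congr hs hy).symm) ≫ post s (eqToHom hy ≫ f ≫ eqToHom hz) =
          (a ≫ post s' f) ≫ eqToHom (hom_congr hs.symm hz) := by
      intro s s' y y' z z' d hs hy hz f a; subst hs hy hz; simp
    have e₂ : ∀ {s s' y y' z z' d : C} (hs : s = s') (hy : y' = y) (hz : z' = z)
        (f : s' ⟶ z') (a : d ⟶ hom z' y'),
        (a ≫ eqToHom (hom_congr hz hy)) ≫ pre (eqToHom hs ≫ f ≫ eqToHom hz) y =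
          (a ≫ pre f y') ≫ eqToHom (hom_congr hs.symm hy) := by
      intro s s' y y' z z' d hs hy hz f a; subst hs hy hz; simp
    have h₁ := e₁ (ihoms_append P.src Q.src x) (ihoms_append P.src Q.src y)
      (ihoms_append P.tgt Q.tgt y).symm (P.app _ ≫ mapIhoms P.tgt (Q.app y))
      (Ls Q.src x y ≫ Ls P.src _ _)
    have h₂ := e₂ (ihoms_append P.src Q.src x) (ihoms_append P.tgt Q.tgt y).symm
      (ihoms_append P.tgt Q.tgt x).symm (P.app _ ≫ mapIhoms P.tgt (Q.app x))
      (Ls Q.tgt x y ≫ Ls P.tgt _ _)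
    simp only [Category.assoc] at h₁ h₂ key
    simp only [Ls_append, Category.assoc]
    rw [h₁, h₂, reassoc_of% key]

theorem tensor_assoc (P Q R : HomTrans C) :
    (P.tensor Q).tensor R = P.tensor (Q.tensor R) :=
  ext (List.append_assoc _ _ _) (List.append_assoc _ _ _) fun x => by
    dsimp only [tensor]
    simp only [mapIhoms_append, mapIhoms_comp, mapIhoms_eqToHom, Category.assoc,
      eqToHom_trans_assoc, eqToHom_trans, eqToHom_refl, Category.id_comp,
      P.app_congr (ihoms_append Q.src R.src x)]

theorem id_tensor (P : HomTrans C) : (id []).tensor P = P :=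
  ext rfl rfl fun x => by dsimp only [tensor, id]; simp

theorem tensor_id (P : HomTrans C) : P.tensor (id []) = P :=
  ext (List.append_nil _) (List.append_nil _) fun x => by dsimp only [tensor, id]; simp

theorem id_tensor_id (as bs : List C) : (id as).tensor (id bs) = id (as ++ bs) :=
  ext rfl rfl fun x => by dsimp only [tensor, id]; simp

theorem comp_id (P : HomTrans C) (as : List C) (h : P.tgt = as) : P.comp (id as) h = P := by
  subst h; exact ext rfl rfl fun x => by dsimp only [comp, id]; simp

/-- The interchange law, which is naturality of `Q` at the components of `P'`. -/
theorem tensor_comp_tensor (P P' Q Q' : HomTrans C) (h : P.tgt = Q.src) (h' : P'.tgt = Q'.src) :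
    (P.tensor P').comp (Q.tensor Q') (congrArg₂ (· ++ ·) h h') =
      (P.comp Q h).tensor (P'.comp Q' h') := by
  obtain ⟨s, t, p, hp, _⟩ := P
  obtain ⟨s', t', p', _, _⟩ := P'
  obtain ⟨_, w, q, hq, _⟩ := Q
  obtain ⟨_, w', q', _, _⟩ := Q'
  dsimp only at h h'
  subst h h'
  exact ext rfl rfl fun x => by
    dsimp only [tensor, comp]
    simp [mapIhoms_comp, reassoc_of% (hq (p' x))]

end HomTrans

end SkewCl

namespace SkewCl

open SkewClosed InternalHom

variable {C : SkewCl.{v, u}}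

theorem pre_post' {a a' b b' : C} (f : a ⟶ a') (g : b ⟶ b') :
    pre f b ≫ post a g = post a' g ≫ pre f b' := pre_post _ f g

theorem pre_comp' {a a' a'' : C} (f : a ⟶ a') (g : a' ⟶ a'') (b : C) :
    pre (f ≫ g) b = pre g b ≫ pre f b := pre_comp _ f g b

theorem i_natural' {a a' : C} (f : a ⟶ a') : post unit f ≫ i a' = i a ≫ f :=
  i_natural f

theorem eqToHom_pre_comp_eqToHom {d d' e z z' : C} (hz : z' = z) (hd : d' = d)
    (f : e ⟶ d') :
    eqToHom (hom_congr hd hz) ≫ pre (f ≫ eqToHom hd) z = pre f z' ≫ eqToHom (by rw [hz]) := by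
  subst hz hd; simp

theorem eqToHom_i {a a' : C} (h : a = a') :
    eqToHom (by rw [h]) ≫ i a' = i a ≫ eqToHom h := by
  subst h; simp

/-! ### Curried multimaps -/

/-- A morphism `d ⟶ [a₁,...,[aₙ,b]]`. -/
structure Curried (C : SkewCl.{v, u}) where
  dom : C
  src : List C
  tgt : C
  mor : dom ⟶ ihoms src tgt

namespace Curried

theorem ext {m n : Curried C} (h : m.dom = n.dom) (h' : m.src = n.src) (h'' : m.tgt = n.tgt)
    (hm : m.mor = eqToHom h ≫ n.mor ≫ eqToHom (by rw [h', h''])) : m = n := by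
  obtain ⟨d, s, t, m⟩ := m
  obtain ⟨d', s', t', n⟩ := n
  dsimp only at h h' h''
  subst h h' h''
  obtain rfl : m = n := by simpa using hm
  rfl

/-- The action of transformations between iterated homs. -/
@[reducible] def act (m : Curried C) (P : HomTrans C) (h : m.src = P.src) : Curried C where
  dom := m.dom
  src := P.tgt
  tgt := m.tgt
  mor := m.mor ≫ eqToHom (by rw [h]) ≫ P.app m.tgt

/-- Composition of curried multimaps. -/
@[reducible] def comp (m n : Curried C) (h : m.tgt = n.dom) : Curried C where
  dom := m.dom
  src := m.src ++ n.src
  tgt := n.tgt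
  mor := m.mor ≫ mapIhoms m.src (eqToHom h ≫ n.mor) ≫ eqToHom (ihoms_append _ _ _).symm

theorem act_id (m : Curried C) (as : List C) (h : m.src = as) : m.act (.id as) h = m := by
  subst h; exact ext rfl rfl rfl (by simp)

theorem act_act (m : Curried C) (P Q : HomTrans C) (h : m.src = P.src) (h' : P.tgt = Q.src) :
    (m.act P h).act Q h' = m.act (P.comp Q h') h := by
  obtain ⟨d, _, t, m⟩ := m
  obtain ⟨s, _, p, _, _⟩ := P
  dsimp only at h h'
  subst h h'
  exact ext rfl rfl rfl (by simp)

theorem comp_assoc (m n k : Curried C) (h : m.tgt = n.dom) (h' : n.tgt = k.dom) :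
    (m.comp n h).comp k h' = m.comp (n.comp k h') h := by
  obtain ⟨d, s, _, m⟩ := m
  obtain ⟨d', s', _, n⟩ := n
  dsimp only at h h'
  subst h h'
  exact ext rfl (List.append_assoc _ _ _) rfl (by
    simp [mapIhoms_append, mapIhoms_comp])

/-- Each tensor factor acts on its own half of the concatenated source; naturality of `P` moves its
component past the morphism of `n`. -/
theorem comp_act_tensor (m n : Curried C) (P Q : HomTrans C) (h : m.tgt = n.dom)
    (hP : m.src = P.src) (hQ : n.src = Q.src) :
    (m.comp n h).act (P.tensor Q) (congrArg₂ (· ++ ·) hP hQ) =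
      (m.act P hP).comp (n.act Q hQ) h := by
  obtain ⟨d, _, _, m⟩ := m
  obtain ⟨d', _, t', n⟩ := n
  obtain ⟨s, w, p, hp, _⟩ := P
  obtain ⟨s', w', q, _, _⟩ := Q
  dsimp only at h hP hQ
  subst h hP hQ
  exact ext rfl rfl rfl (by simp [mapIhoms_comp, reassoc_of% (hp n)])

/-- The transformation `[b,-] ⟶ [d,[a₁,...,[aₙ,-]]]`. -/
@[reducible] def tightTrans (m : Curried C) : HomTrans C where
  src := [m.tgt]
  tgt := m.dom :: m.src
  app x := Ls m.src m.tgt x ≫ pre m.mor (ihoms m.src x)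
  naturality {x y} f := by
    change post m.tgt f ≫ Ls m.src m.tgt y ≫ pre m.mor (ihoms m.src y) =
      (Ls m.src m.tgt x ≫ pre m.mor (ihoms m.src x)) ≫ post m.dom (mapIhoms m.src f)
    rw [reassoc_of% Ls_natural_right, Category.assoc, pre_post]
  strength x y := by
    change (𝟙 _ ≫ L m.tgt x y) ≫ post (hom m.tgt x) (Ls m.src m.tgt y ≫ pre m.mor _) =
      (Ls m.src x y ≫ L m.dom _ _) ≫ pre (Ls m.src m.tgt x ≫ pre m.mor _) _
    simp only [post_comp, pre_comp, Category.id_comp, Category.assoc]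
    rw [reassoc_of% Ls_pentagon, reassoc_of% (L_extranatural m.mor), pre_post]

/-- The transformation `[b,-] ⟶ [a₁,...,[aₙ,-]]`, for a morphism with domain `I`. -/
@[reducible] def looseTrans (m : Curried C) (h : m.dom = unit) : HomTrans C where
  src := [m.tgt]
  tgt := m.src
  app x := Ls m.src m.tgt x ≫ pre (eqToHom h.symm ≫ m.mor) (ihoms m.src x) ≫
    i (ihoms m.src x)
  naturality {x y} f := by
    obtain ⟨_, s, t, m⟩ := m
    dsimp only at h
    subst h
    change post t f ≫ Ls s t y ≫ pre (𝟙 _ ≫ m) (ihoms s y) ≫ i (ihoms s y) =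
      (Ls s t x ≫ pre (𝟙 _ ≫ m) (ihoms s x) ≫ i (ihoms s x)) ≫ mapIhoms s f
    rw [Category.id_comp, reassoc_of% Ls_natural_right, Category.assoc, Category.assoc, ← i_natural,
      reassoc_of% pre_post]
  strength x y := by
    obtain ⟨_, s, t, m⟩ := m
    dsimp only at h
    subst h
    change (𝟙 _ ≫ L t x y) ≫ post (hom t x) (Ls s t y ≫ pre (𝟙 _ ≫ m) _ ≫ i _) =
      Ls s x y ≫ pre (Ls s t x ≫ pre (𝟙 _ ≫ m) _ ≫ i _) _
    simp only [post_comp, pre_comp, Category.id_comp, Category.assoc]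
    -- Beyond the pentagon and extranaturality used in the tight case, the final `i` has to be
    -- moved: the axiom `L_i`, read backwards, replaces precomposition with `i` by `L` followed by
    -- postcomposition with `i`.
    rw [reassoc_of% Ls_pentagon, ← L_i, reassoc_of% pre_post', pre_post',
      ← reassoc_of% (L_extranatural m), reassoc_of% pre_post', Category.assoc]

/-- Here compatibility with `L` is indispensable. Acting on `m` places the component of `P` in a
contravariant position; strength turns it into postcomposition, and naturality of `i` then brings it
to the end. -/
theorem looseTrans_act (m : Curried C) (h : m.dom = unit) (P : HomTrans C) (hP : m.src = P.src) :
    (m.act P hP).looseTrans h = (m.looseTrans h).comp P hP := by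
  obtain ⟨_, _, t, m⟩ := m
  obtain ⟨s, w, p, hp, hp'⟩ := P
  dsimp only at h hP
  subst h hP
  refine HomTrans.ext rfl rfl fun x => ?_
  simp only [eqToHom_refl, Category.id_comp, Category.comp_id, Category.assoc, pre_comp,
    ← reassoc_of% (hp' t x), ← i_natural, reassoc_of% pre_post]

/-- The computation common to `tightTrans_comp_act` and `looseTrans_comp_act`, without transports.
-/
theorem Ls_pre_comp_mapIhoms (P : HomTrans C) {d b c : C} (s : List C) (m : d ⟶ ihoms s b)
    (n : b ⟶ ihoms P.src c) (x : C) :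
    Ls P.tgt c x ≫ Ls s _ _ ≫ pre (m ≫ mapIhoms s (n ≫ P.app c)) _ =
      Ls P.src c x ≫ pre n _ ≫ Ls s _ _ ≫ pre m _ ≫ post d (mapIhoms s (P.app x)) := by
  rw [pre_post', ← reassoc_of% Ls_natural_right, reassoc_of% pre_post', reassoc_of% P.strength,
    reassoc_of% Ls_natural_middle, reassoc_of% Ls_natural_middle, mapIhoms_comp, pre_comp', pre_comp',
    Category.assoc]

/-- The shape is that of substitution into a tight multimap `n`: `m` goes into the first variable,
while `P` stands for the multimaps that go into the others. -/
theorem tightTrans_comp_act (m n : Curried C) (h : m.tgt = n.dom) (P : HomTrans C)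
    (hP : n.src = P.src) :
    (m.comp (n.act P hP) h).tightTrans =
      n.tightTrans.comp (m.tightTrans.tensor P) (congrArg₂ (· :: ·) h.symm hP) := by
  obtain ⟨d, s, _, m⟩ := m
  obtain ⟨d', _, t', n⟩ := n
  dsimp only at h hP
  subst h hP
  refine HomTrans.ext rfl rfl fun x => ?_
  have key := Ls_pre_comp_mapIhoms P s m n x
  simp only [Ls_append, Category.assoc, eqToHom_refl, Category.id_comp, Category.comp_id]
  rw [← Category.assoc m, eqToHom_pre_comp_eqToHom (ihoms_append s P.tgt x).symm
    (ihoms_append s P.tgt t').symm, reassoc_of% key]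

theorem looseTrans_comp_act (m n : Curried C) (h : m.tgt = n.dom) (hm : m.dom = unit)
    (P : HomTrans C) (hP : n.src = P.src) :
    (m.comp (n.act P hP) h).looseTrans hm =
      n.tightTrans.comp ((m.looseTrans hm).tensor P) (congrArg₂ (· :: ·) h.symm hP) := by
  obtain ⟨_, s, _, m⟩ := m
  obtain ⟨d', _, t', n⟩ := n
  dsimp only at h hP hm
  subst h hP hm
  refine HomTrans.ext rfl rfl fun x => ?_
  have key := Ls_pre_comp_mapIhoms P s m n x
  simp only [Ls_append, Category.assoc, eqToHom_refl, Category.id_comp, Category.comp_id]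
  rw [← Category.assoc m, reassoc_of% eqToHom_pre_comp_eqToHom (ihoms_append s P.tgt x).symm
    (ihoms_append s P.tgt t').symm, reassoc_of% key,
    eqToHom_i, reassoc_of% i_natural']

end Curried

end SkewCl

namespace SkewCl

open SkewClosed InternalHom

variable {C : SkewCl.{v, u}}

theorem Curried.mk_mor_eqToHom (m : Curried C) {as : List C} (h : m.src = as) :
    Curried.mk m.dom as m.tgt (m.mor ≫ eqToHom (congrArg (ihoms · m.tgt) h)) = m := by
  obtain ⟨d, s, t, m⟩ := m
  subst h
  simp

theorem Curried.looseTrans_congr {m n : Curried C} (h : m = n) (hm : m.dom = unit) :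
    m.looseTrans hm = n.looseTrans (h ▸ hm) := by
  subst h; rfl

theorem HomTrans.comp_congr {P P' Q Q' : HomTrans C} (hP : P = P') (hQ : Q = Q')
    (h : P.tgt = Q.src) : P.comp Q h = P'.comp Q' (hP ▸ hQ ▸ h) := by
  subst hP hQ; rfl

namespace Curried

theorem act_congr {m m' : Curried C} {P P' : HomTrans C} (hm : m = m') (hP : P = P')
    (h : m.src = P.src) : m.act P h = m'.act P' (hm ▸ hP ▸ h) := by
  subst hm hP; rfl

theorem comp_congr {m m' n n' : Curried C} (hm : m = m') (hn : n = n')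
    (h : m.tgt = n.dom) : m.comp n h = m'.comp n' (hm ▸ hn ▸ h) := by
  subst hm hn; rfl

/-- The identity as a curried multimap. -/
abbrev one (a : C) : Curried C := ⟨a, [], a, 𝟙 a⟩

theorem comp_one (m : Curried C) {b : C} (h : m.tgt = b) : m.comp (one b) h = m := by
  obtain ⟨d, s, t, m⟩ := m
  dsimp only at h
  subst h
  exact ext rfl (List.append_nil _) rfl (by simp)

theorem one_comp (m : Curried C) {a : C} (h : a = m.dom) : (one a).comp m h = m := by
  obtain ⟨d, s, t, m⟩ := m
  dsimp only at h
  subst h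
  exact ext rfl rfl rfl (by simp)

end Curried

/-! ### The skew multicategory of a skew closed category -/

/-- The multimaps `a₁,...,aₙ ⟶ b` in a skew closed category: a tight one is a morphism
`a₁ ⟶ [a₂,...,[aₙ,b]]` and a loose one is a morphism `I ⟶ [a₁,...,[aₙ,b]]`. -/
@[reducible] def MultiHom (C : SkewCl.{v, u}) : Tightness → List C → C → Type v
  | .tight, [], _ => PEmpty
  | .tight, a :: as, b => a ⟶ ihoms as b
  | .loose, as, b => unit ⟶ ihoms as b

/-- A multimap as a curried multimap. -/
def toCurried : MultiArrow (MultiHom C) → Curried C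
  | ⟨.tight, [], _, f⟩ => nomatch (f : PEmpty)
  | ⟨.tight, a :: as, b, f⟩ => ⟨a, as, b, f⟩
  | ⟨.loose, as, b, f⟩ => ⟨unit, as, b, f⟩

/-- A multimap as a transformation between iterated homs. -/
def toTrans : MultiArrow (MultiHom C) → HomTrans C
  | ⟨.tight, [], _, f⟩ => nomatch (f : PEmpty)
  | ⟨.tight, a :: as, b, f⟩ => (Curried.mk a as b f).tightTrans
  | ⟨.loose, as, b, f⟩ => (Curried.mk unit as b f).looseTrans rfl

/-- A list of multimaps as a transformation between iterated homs. -/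
def toTranss : List (MultiArrow (MultiHom C)) → HomTrans C
  | [] => .id []
  | f :: fs => (toTrans f).tensor (toTranss fs)

@[simp] theorem toTrans_src (f : MultiArrow (MultiHom C)) : (toTrans f).src = [f.tgt] := by
  rcases f with ⟨_ | _, _ | _, b, f⟩ <;> first | rfl | exact nomatch (f : PEmpty)

@[simp] theorem toTrans_tgt (f : MultiArrow (MultiHom C)) : (toTrans f).tgt = f.src := by
  rcases f with ⟨_ | _, _ | _, b, f⟩ <;> first | rfl | exact nomatch (f : PEmpty)

@[simp] theorem toCurried_tgt (f : MultiArrow (MultiHom C)) : (toCurried f).tgt = f.tgt := by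
  rcases f with ⟨_ | _, _ | _, b, f⟩ <;> first | rfl | exact nomatch (f : PEmpty)

@[simp] theorem toTranss_src (fs : List (MultiArrow (MultiHom C))) :
    (toTranss fs).src = fs.map MultiArrow.tgt := by
  induction fs with
  | nil => rfl
  | cons f fs ih => simp [toTranss, ih]

@[simp] theorem toTranss_tgt (fs : List (MultiArrow (MultiHom C))) :
    (toTranss fs).tgt = fs.flatMap MultiArrow.src := by
  induction fs with
  | nil => rfl
  | cons f fs ih => simp [toTranss, ih]

theorem toTranss_append (fs gs : List (MultiArrow (MultiHom C))) :
    toTranss (fs ++ gs) = (toTranss fs).tensor (toTranss gs) := by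
  induction fs with
  | nil => exact (HomTrans.id_tensor _).symm
  | cons f fs ih => simp only [List.cons_append, toTranss, ih, HomTrans.tensor_assoc]

theorem toTranss_singleton (f : MultiArrow (MultiHom C)) : toTranss [f] = toTrans f :=
  HomTrans.tensor_id _

/-- Equality of types has to be assumed: a loose multimap and a tight one whose first source is `I`
can have the same curried form. -/
theorem toCurried_injective {f g : MultiArrow (MultiHom C)} (h : f.type = g.type)
    (h' : toCurried f = toCurried g) : f = g := by
  have tight : ∀ {a a' : C} {as as' : List C} {b b' : C} (f : a ⟶ ihoms as b)
      (g : a' ⟶ ihoms as' b'), Curried.mk a as b f = Curried.mk a' as' b' g →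
      (⟨.tight, a :: as, b, f⟩ : MultiArrow (MultiHom C)) = ⟨.tight, a' :: as', b', g⟩ := by
    rintro _ _ _ _ _ _ _ _ ⟨⟩; rfl
  have loose : ∀ {as as' : List C} {b b' : C} (f : unit ⟶ ihoms as b)
      (g : unit ⟶ ihoms as' b'), Curried.mk unit as b f = Curried.mk unit as' b' g →
      (⟨.loose, as, b, f⟩ : MultiArrow (MultiHom C)) = ⟨.loose, as', b', g⟩ := by
    rintro _ _ _ _ _ _ ⟨⟩; rfl
  obtain ⟨x, as, b, f⟩ := f
  obtain ⟨_, as', b', g⟩ := g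
  obtain rfl : x = _ := h
  match x, as, f, as', g with
  | .tight, [], f, _, _ => exact nomatch (f : PEmpty)
  | .tight, _, _, [], g => exact nomatch (g : PEmpty)
  | .tight, _ :: _, f, _ :: _, g => exact tight f g h'
  | .loose, _, f, _, g => exact loose f g h'

/-- Substitution of multimaps. -/
def multiSub : ∀ {x : Tightness} {c : C} (fs : List (MultiArrow (MultiHom C))),
    MultiHom C x (fs.map MultiArrow.tgt) c →
      MultiHom C (x.comp (MultiArrow.headType fs)) (fs.flatMap MultiArrow.src) c
  | .loose, c, fs, g =>
    ((Curried.mk unit _ c g).act (toTranss fs) (toTranss_src fs).symm).mor ≫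
      eqToHom (congrArg (ihoms · c) (toTranss_tgt fs))
  | .tight, _, [], g => nomatch (g : PEmpty)
  | .tight, _, ⟨.tight, [], _, f⟩ :: _, _ => nomatch (f : PEmpty)
  | .tight, c, ⟨.tight, a :: as, b, f⟩ :: fs, g =>
    ((Curried.mk a as b f).comp
      ((Curried.mk b _ c g).act (toTranss fs) (toTranss_src fs).symm) rfl).mor ≫
      eqToHom (congrArg (fun bs => ihoms (as ++ bs) c) (toTranss_tgt fs))
  | .tight, c, ⟨.loose, as, b, f⟩ :: fs, g =>
    ((Curried.mk unit as b f).comp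
      ((Curried.mk b _ c g).act (toTranss fs) (toTranss_src fs).symm) rfl).mor ≫
      eqToHom (congrArg (fun bs => ihoms (as ++ bs) c) (toTranss_tgt fs))

/-- The data of the skew multicategory of a skew closed category. -/
@[reducible] def multicatData (C : SkewCl.{v, u}) : SkewMulticatData.{v, u} where
  Obj := C
  Hom := MultiHom C
  loosen {as _} f := match as, f with
    | [], f => nomatch (f : PEmpty)
    | a :: _, f => (j a ≫ post a f : unit ⟶ hom a _)
  one a := 𝟙 a
  sub fs g := multiSub fs g

open SkewMulticatData

theorem toCurried_subst_loose {as : List C} {c : C} (g : MultiHom C .loose as c)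
    (fs : List (multicatData C).Arrow) (h : as = fs.map MultiArrow.tgt) :
    toCurried (subst (A := multicatData C) ⟨.loose, as, c, g⟩ fs h) =
      (toCurried ⟨.loose, as, c, g⟩).act (toTranss fs) (h.trans (toTranss_src fs).symm) := by
  subst h
  exact Curried.mk_mor_eqToHom ((Curried.mk unit _ c g).act (toTranss fs) (toTranss_src fs).symm)
    (toTranss_tgt fs)

theorem toCurried_subst_tight {b : C} {bs : List C} {c : C} (g : MultiHom C .tight (b :: bs) c)
    (f : (multicatData C).Arrow) (fs : List (multicatData C).Arrow)
    (h : b :: bs = (f :: fs).map MultiArrow.tgt) :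
    toCurried (subst (A := multicatData C) ⟨.tight, b :: bs, c, g⟩ (f :: fs) h) =
      (toCurried f).comp ((toCurried ⟨.tight, b :: bs, c, g⟩).act (toTranss fs)
        ((List.cons.inj h).2.trans (toTranss_src fs).symm))
        ((toCurried_tgt f).trans (List.cons.inj h).1.symm) := by
  obtain ⟨rfl, rfl⟩ := List.cons.inj h
  rcases f with ⟨_ | _, _ | ⟨a, as⟩, b, f⟩
  · exact nomatch (f : PEmpty)
  · exact Curried.mk_mor_eqToHom ((Curried.mk a as b f).comp ((Curried.mk b _ c g).act
      (toTranss fs) (toTranss_src fs).symm) rfl) (congrArg (as ++ ·) (toTranss_tgt fs))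
  · exact Curried.mk_mor_eqToHom ((Curried.mk unit [] b f).comp ((Curried.mk b _ c g).act
      (toTranss fs) (toTranss_src fs).symm) rfl) (congrArg ([] ++ ·) (toTranss_tgt fs))
  · exact Curried.mk_mor_eqToHom ((Curried.mk unit (a :: as) b f).comp ((Curried.mk b _ c g).act
      (toTranss fs) (toTranss_src fs).symm) rfl) (congrArg ((a :: as) ++ ·) (toTranss_tgt fs))

theorem toTrans_eq_of_tight (f : MultiArrow (MultiHom C)) (h : f.type = .tight) :
    toTrans f = (toCurried f).tightTrans := by
  obtain ⟨x, as, b, f⟩ := f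
  obtain rfl : x = _ := h
  match as, f with
  | [], f => exact nomatch (f : PEmpty)
  | _ :: _, f => rfl

theorem toCurried_dom_of_loose (f : MultiArrow (MultiHom C)) (h : f.type = .loose) :
    (toCurried f).dom = unit := by
  obtain ⟨x, as, b, f⟩ := f
  obtain rfl : x = _ := h
  rfl

theorem toTrans_eq_of_loose (f : MultiArrow (MultiHom C)) (h : f.type = .loose) :
    toTrans f = (toCurried f).looseTrans (toCurried_dom_of_loose f h) := by
  obtain ⟨x, as, b, f⟩ := f
  obtain rfl : x = _ := h
  rfl

/-- The lemma behind associativity: passing to transformations turns substitution into vertical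
composition. For tight `g` the result is tight or loose according to the first multimap substituted,
whence the two subcases. -/
theorem toTrans_subst (g : (multicatData C).Arrow) (fs : List (multicatData C).Arrow)
    (h : g.src = fs.map MultiArrow.tgt) :
    toTrans (subst (A := multicatData C) g fs h) =
      (toTrans g).comp (toTranss fs)
        ((toTrans_tgt g).trans (h.trans (toTranss_src fs).symm)) := by
  rcases g with ⟨_ | _, _ | ⟨b, bs⟩, c, g⟩
  · exact nomatch (g : PEmpty)
  · obtain _ | ⟨f, fs⟩ := fs
    · exact nomatch h
    · have e := toCurried_subst_tight g f fs h
      obtain hf | hf : f.type = .tight ∨ f.type = .loose := by cases f.type <;> simp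
      · refine (toTrans_eq_of_tight (subst _ (f :: fs) h) hf).trans ((congrArg _ e).trans
          ((Curried.tightTrans_comp_act _ _ _ _ _).trans ?_))
        exact HomTrans.comp_congr rfl (congrArg (HomTrans.tensor · _)
          (toTrans_eq_of_tight f hf).symm) _
      · refine (toTrans_eq_of_loose (subst _ (f :: fs) h) hf).trans ((Curried.looseTrans_congr e _).trans
          ((Curried.looseTrans_comp_act _ _ _ (toCurried_dom_of_loose f hf) _ _).trans ?_))
        exact HomTrans.comp_congr rfl (congrArg (HomTrans.tensor · _)
          (toTrans_eq_of_loose f hf).symm) _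
  all_goals
    exact (toTrans_eq_of_loose _ rfl).trans
      ((Curried.looseTrans_congr (toCurried_subst_loose g fs h) _).trans
        (Curried.looseTrans_act _ rfl _ _))

theorem toTrans_one (a : C) : toTrans (idArrow (A := multicatData C) a) = .id [a] :=
  HomTrans.ext rfl rfl fun x => by
    change 𝟙 _ ≫ pre (𝟙 a) x = 𝟙 _ ≫ 𝟙 (hom a x) ≫ 𝟙 _
    simp

theorem toTranss_one (as : List C) :
    toTranss (as.map (idArrow (A := multicatData C))) = .id as := by
  induction as with
  | nil => rfl
  | cons a as ih =>
    exact (congrArg₂ HomTrans.tensor (toTrans_one a) ih).trans (HomTrans.id_tensor_id [a] as)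

/-- Transformations do not see tightness. Naturality of `L` in its middle variable isolates the
composite of `L`, precomposition with `j`, and `i`, which is the identity by the axiom `L_j_i`. -/
theorem toTrans_loosen (f : (multicatData C).Arrow) : toTrans (loosenArrow f) = toTrans f := by
  obtain ⟨_ | _, as, b, f⟩ := f
  · match as, f with
    | [], f => exact nomatch (f : PEmpty)
    | a :: as, f =>
      refine HomTrans.ext rfl rfl fun x => ?_
      change (Ls as b x ≫ L a _ _) ≫ pre (𝟙 _ ≫ j a ≫ post a (show a ⟶ ihoms as b from f)) _ ≫
        i _ = 𝟙 _ ≫ (Ls as b x ≫ pre (show a ⟶ ihoms as b from f) _) ≫ 𝟙 _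
      simp only [Category.id_comp, Category.comp_id, Category.assoc, pre_comp]
      rw [← reassoc_of% (L_natural_middle a (show a ⟶ ihoms as b from f)), L_j_i]
      simp
  · rfl

/-- By the interchange law, a list of substitutes may be formed in two layers; this is the form in
which associativity uses `toTrans_subst`. -/
theorem toTranss_comp (L : List (multicatData C).Composable) :
    toTranss (L.map Composable.comp) =
      (toTranss (L.map Composable.outer)).comp (toTranss (L.flatMap Composable.inner))
        ((toTranss_tgt _).trans ((flatMap_src_outer L).trans (toTranss_src _).symm)) := by
  induction L with
  | nil => exact (HomTrans.comp_id _ _ rfl).symm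
  | cons p L ih =>
    have h := HomTrans.tensor_comp_tensor (toTrans p.outer) (toTranss (L.map Composable.outer))
      (toTranss p.inner) (toTranss (L.flatMap Composable.inner))
      ((toTrans_tgt _).trans (p.src_eq.trans (toTranss_src _).symm))
      ((toTranss_tgt _).trans ((flatMap_src_outer L).trans (toTranss_src _).symm))
    rw [← ih, ← toTrans_subst] at h
    simp only [List.map_cons, List.flatMap_cons, toTranss_append]
    exact h.symm

theorem loosenArrow_of_loose (f : (multicatData C).Arrow) (h : f.type = .loose) :
    loosenArrow f = f := by
  obtain ⟨x, as, b, f⟩ := f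
  obtain rfl : x = _ := h
  rfl

/-- A Yoneda argument: evaluating the transformation of `f` at `j` returns `f` in its loose form, by
extranaturality of `j` and, when `f` is already loose, the axiom `j_i`. Statements about loosening
thus become statements about transformations. -/
theorem toCurried_loosen_eq (f : (multicatData C).Arrow) :
    toCurried (loosenArrow f) =
      (Curried.mk unit [f.tgt] f.tgt (j f.tgt)).act (toTrans f) (toTrans_src f).symm := by
  obtain ⟨_ | _, as, b, f⟩ := f
  · match as, f with
    | [], f => exact nomatch (f : PEmpty)
    | a :: as, f =>
      refine Curried.ext rfl rfl rfl ?_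
      change j a ≫ post a (show a ⟶ ihoms as b from f) =
        𝟙 _ ≫ (j b ≫ 𝟙 _ ≫ Ls as b b ≫ pre (show a ⟶ ihoms as b from f) _) ≫ 𝟙 _
      simp only [Category.id_comp, Category.comp_id]
      rw [reassoc_of% j_Ls]
      exact j_extranatural (show a ⟶ ihoms as b from f)
  · refine Curried.ext rfl rfl rfl ?_
    change (show unit ⟶ ihoms as b from f) = 𝟙 _ ≫ (j b ≫ 𝟙 _ ≫ Ls as b b ≫
        pre (𝟙 _ ≫ (show unit ⟶ ihoms as b from f)) _ ≫ i _) ≫ 𝟙 _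
    simp only [Category.id_comp, Category.comp_id]
    rw [reassoc_of% j_Ls, ← reassoc_of% (j_extranatural (show unit ⟶ ihoms as b from f)),
      i_natural, reassoc_of% (j_i (C := C))]

theorem toCurried_subst_of_loose (g : (multicatData C).Arrow) (fs : List (multicatData C).Arrow)
    (hg : g.type = .loose) (h : g.src = fs.map MultiArrow.tgt) :
    ∃ h₁, toCurried (subst g fs h) = (toCurried g).act (toTranss fs) h₁ := by
  obtain ⟨x, as, b, g⟩ := g
  obtain rfl : x = _ := hg
  exact ⟨_, toCurried_subst_loose g fs h⟩

theorem toCurried_subst_of_tight (g f : (multicatData C).Arrow)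
    (fs : List (multicatData C).Arrow) (hg : g.type = .tight)
    (h : g.src = (f :: fs).map MultiArrow.tgt) :
    ∃ h₁ h₂, toCurried (subst g (f :: fs) h) =
      (toCurried f).comp ((toCurried g).act (toTranss fs) h₁) h₂ := by
  obtain ⟨x, as, b, g⟩ := g
  obtain rfl : x = _ := hg
  match as, g with
  | [], g => exact nomatch (g : PEmpty)
  | _ :: _, g => exact ⟨_, _, toCurried_subst_tight g f fs h⟩

theorem src_ne_nil_of_tight (f : (multicatData C).Arrow) (h : f.type = .tight) : f.src ≠ [] := by
  obtain ⟨x, as, b, f⟩ := f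
  obtain rfl : x = _ := h
  match as, f with
  | [], f => exact nomatch (f : PEmpty)
  | _ :: _, _ => simp

theorem loosenArrow_type (f : (multicatData C).Arrow) : (loosenArrow f).type = .loose := by
  obtain ⟨_ | _, _, _, _⟩ := f <;> rfl

theorem subst_type (g : (multicatData C).Arrow) (fs : List (multicatData C).Arrow)
    (h : g.src = fs.map MultiArrow.tgt) :
    (subst g fs h).type = g.type.comp (MultiArrow.headType fs) := rfl

theorem toCurried_loosen_of_tight (f : (multicatData C).Arrow) (hf : f.type = .tight) {b : C}
    (h : b = (toCurried f).dom) :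
    toCurried (loosenArrow f) = (Curried.mk unit [b] b (j b)).comp (toCurried f) h := by
  obtain ⟨x, as, c, f⟩ := f
  obtain rfl : x = _ := hf
  match as, f with
  | [], f => exact nomatch (f : PEmpty)
  | a :: as, f =>
    obtain rfl : b = a := h
    exact Curried.ext rfl rfl rfl (by
      change j b ≫ post b (show b ⟶ ihoms as c from f) =
        𝟙 _ ≫ (j b ≫ post b (𝟙 _ ≫ (show b ⟶ ihoms as c from f)) ≫ 𝟙 _) ≫ 𝟙 _
      simp only [Category.id_comp, Category.comp_id])

/-- Three cases. If `h` is loose, everything is an action and `toTranss_comp` suffices. If `h` is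
tight and the first middle multimap is loose, `comp_act_tensor` splits the action between the two
factors. If both are tight, the first inner multimap is composed in front, and associativity of
`Curried.comp` is needed too. -/
theorem multicat_assoc (h : (multicatData C).Arrow) (L : List (multicatData C).Composable)
    (hh : h.src = (L.map Composable.outer).map MultiArrow.tgt) :
    toCurried (subst (subst h (L.map Composable.outer) hh) (L.flatMap Composable.inner)
        ((subst_src h _ hh).trans (flatMap_src_outer L))) =
      toCurried (subst h (L.map Composable.comp) (hh.trans (map_tgt_comp L).symm)) := by
  cases hx : h.type with
  | loose =>
    obtain ⟨_, e₁⟩ := toCurried_subst_of_loose h (L.map Composable.outer) hx hh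
    obtain ⟨_, e₂⟩ := toCurried_subst_of_loose (subst h (L.map Composable.outer) hh)
      (L.flatMap Composable.inner) (by rw [subst_type, hx]; rfl)
      ((subst_src h _ hh).trans (flatMap_src_outer L))
    obtain ⟨_, e₃⟩ := toCurried_subst_of_loose h (L.map Composable.comp) hx
      (hh.trans (map_tgt_comp L).symm)
    rw [e₂, e₃]
    refine (Curried.act_congr e₁ rfl _).trans ((Curried.act_act _ _ _ _ _).trans ?_)
    exact Curried.act_congr rfl (toTranss_comp L).symm _
  | tight =>
    obtain _ | ⟨p, L⟩ := L
    · exact absurd hh (src_ne_nil_of_tight h hx)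
    obtain ⟨_, _, e₁⟩ := toCurried_subst_of_tight h p.outer (L.map Composable.outer) hx hh
    obtain ⟨_, _, e₂⟩ := toCurried_subst_of_tight h p.comp (L.map Composable.comp) hx
      (hh.trans (map_tgt_comp (p :: L)).symm)
    cases hp : p.outer.type with
    | loose =>
      obtain ⟨_, e₃⟩ := toCurried_subst_of_loose (subst h ((p :: L).map Composable.outer) hh)
        ((p :: L).flatMap Composable.inner)
        (by rw [subst_type, hx]; exact hp)
        ((subst_src h _ hh).trans (flatMap_src_outer (p :: L)))
      obtain ⟨_, e₄⟩ := toCurried_subst_of_loose p.outer p.inner hp p.src_eq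
      refine e₃.trans (Eq.trans ?_ e₂.symm)
      refine (Curried.act_congr e₁ (toTranss_append p.inner (L.flatMap Composable.inner)) _).trans
        ((Curried.comp_act_tensor _ _ _ _ _ ((toCurried_subst_of_loose _ _ hp p.src_eq).1)
          ((toTranss_tgt _).trans ((flatMap_src_outer L).trans (toTranss_src _).symm))).trans
          (Curried.comp_congr e₄.symm ((Curried.act_act _ _ _ _ _).trans
            (Curried.act_congr rfl (toTranss_comp L).symm _)) _))
    | tight =>
      obtain ⟨g, gs, hg⟩ := p
      obtain _ | ⟨f, fs⟩ := gs
      · exact absurd hg (src_ne_nil_of_tight g hp)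
      obtain ⟨_, _, e₃⟩ := toCurried_subst_of_tight
        (subst h ((⟨g, f :: fs, hg⟩ :: L : List (multicatData C).Composable).map
          Composable.outer) hh) f (fs ++ L.flatMap Composable.inner)
        (by rw [subst_type, hx]; exact hp)
        ((subst_src h _ hh).trans (flatMap_src_outer (⟨g, f :: fs, hg⟩ :: L)))
      obtain ⟨hgs, _, e₄⟩ := toCurried_subst_of_tight g f fs hp hg
      refine e₃.trans (Eq.trans ?_ e₂.symm)
      refine (Curried.comp_congr rfl ((Curried.act_congr e₁
        (toTranss_append fs (L.flatMap Composable.inner)) _).trans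
        (Curried.comp_act_tensor _ _ _ _ _ hgs
          ((toTranss_tgt _).trans ((flatMap_src_outer L).trans (toTranss_src _).symm)))) _).trans
        ((Curried.comp_assoc _ _ _ _ _).symm.trans ?_)
      exact Curried.comp_congr e₄.symm ((Curried.act_act _ _ _ _ _).trans
        (Curried.act_congr rfl (toTranss_comp L).symm _)) _

/-- A tight multimap has a nonempty source, so the lists substituted into tight multimaps are
nonempty and the value of `headType` on the empty list does no harm. -/
theorem multicat_assoc_type (h : (multicatData C).Arrow) (L : List (multicatData C).Composable)
    (hh : h.src = (L.map Composable.outer).map MultiArrow.tgt) :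
    (h.type.comp (MultiArrow.headType (L.map Composable.outer))).comp
        (MultiArrow.headType (L.flatMap Composable.inner)) =
      h.type.comp (MultiArrow.headType (L.map Composable.comp)) := by
  cases hx : h.type with
  | loose => rfl
  | tight =>
    obtain _ | ⟨⟨g, fs, hg⟩, L⟩ := L
    · exact absurd hh (src_ne_nil_of_tight h hx)
    cases hp : g.type with
    | loose => simp [MultiArrow.headType, Tightness.comp, Composable.comp, subst_type, hp]
    | tight =>
      obtain _ | ⟨f, fs⟩ := fs
      · exact absurd hg (src_ne_nil_of_tight g hp)
      · simp [MultiArrow.headType, Tightness.comp, Composable.comp, subst_type, hp]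

/-- The skew multicategory of a skew closed category. -/
def multicat (C : SkewCl.{v, u}) : SkewMulticat.{v, u} where
  toSkewMulticatData := multicatData C
  tight_nullary _ := inferInstanceAs (IsEmpty PEmpty)
  one_subst f := by
    refine toCurried_injective rfl ((toCurried_subst_tight (b := f.tgt) (bs := []) (c := f.tgt)
      (𝟙 f.tgt) f [] rfl).trans ?_)
    refine (Curried.comp_congr rfl (Curried.act_id (.one f.tgt) [] rfl) _).trans ?_
    exact Curried.comp_one _ _
  subst_one f := by
    cases hf : f.type with
    | tight =>
      obtain ⟨x, as, b, f⟩ := f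
      obtain rfl : x = _ := hf
      match as, f with
      | [], f => exact nomatch (f : PEmpty)
      | a :: as, f =>
        refine toCurried_injective rfl ((toCurried_subst_tight f (idArrow a) (as.map idArrow)
          (map_tgt_idArrow (a :: as))).trans ?_)
        exact (Curried.comp_congr rfl ((Curried.act_congr rfl (toTranss_one as) _).trans
          (Curried.act_id _ _ _)) _).trans (Curried.one_comp (Curried.mk a as b f) rfl)
    | loose =>
      obtain ⟨_, e⟩ := toCurried_subst_of_loose f (f.src.map idArrow) hf (map_tgt_idArrow f.src)
      refine toCurried_injective (by rw [subst_type, hf]; rfl) (e.trans ?_)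
      exact (Curried.act_congr rfl (toTranss_one _) _).trans (Curried.act_id _ _ _)
  assoc h L hh := by
    exact toCurried_injective (multicat_assoc_type h L hh) (multicat_assoc h L hh)
  loosen_subst g fs h := by
    obtain ⟨_, e⟩ := toCurried_subst_of_loose (loosenArrow g) fs (loosenArrow_type g)
      ((loosenArrow_src g).trans h)
    refine toCurried_injective (by rw [subst_type, loosenArrow_type, loosenArrow_type]; rfl)
      (e.trans (Eq.trans ?_ (toCurried_loosen_eq _).symm))
    exact (Curried.act_congr (toCurried_loosen_eq g) rfl _).trans
      ((Curried.act_act _ _ _ _ _).trans (Curried.act_congr rfl (toTrans_subst g fs h).symm _))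
  subst_loosen_head g f fs h := by
    have e₀ : toTranss (loosenArrow f :: fs) = toTranss (f :: fs) :=
      congrArg (HomTrans.tensor · _) (toTrans_loosen f)
    have h' : g.src = (loosenArrow f :: fs).map MultiArrow.tgt := by simpa using h
    have ht : (subst g (loosenArrow f :: fs) h').type =
        (loosenArrow (subst g (f :: fs) h)).type := by
      rw [subst_type, loosenArrow_type, MultiArrow.headType, loosenArrow_type]
      cases g.type <;> rfl
    refine toCurried_injective ht ?_
    cases hg : g.type with
    | loose =>
      rw [loosenArrow_of_loose (subst g (f :: fs) h) (by rw [subst_type, hg]; rfl)]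
      obtain ⟨_, e₁⟩ := toCurried_subst_of_loose g _ hg h'
      obtain ⟨_, e₂⟩ := toCurried_subst_of_loose g _ hg h
      rw [e₁, e₂]
      exact Curried.act_congr rfl e₀ _
    | tight =>
      obtain ⟨h₁, h₂, e₁⟩ := toCurried_subst_of_tight g _ _ hg h'
      have h₃ : f.tgt = (toCurried g).dom := by
        rw [← h₂, toCurried_tgt, loosenArrow_tgt]
      refine e₁.trans (Eq.trans ?_ (toCurried_loosen_eq _).symm)
      -- The loosened `f` is `j` acted on by the transformation of `f`. Merging this action with
      -- that of `fs` leaves `j` composed with `g`, the loosening of `g`, acted on by the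
      -- transformation of `f :: fs`.
      refine (Curried.comp_congr (toCurried_loosen_eq f) rfl _).trans ?_
      refine (Curried.comp_act_tensor (Curried.mk unit [f.tgt] f.tgt (j f.tgt)) (toCurried g)
        (toTrans f) (toTranss fs) h₃ (toTrans_src f).symm h₁).symm.trans ?_
      refine (Curried.act_congr ((toCurried_loosen_of_tight g hg h₃).symm.trans
        (toCurried_loosen_eq g)) rfl _).trans ?_
      exact (Curried.act_act _ _ _ _ _).trans
        (Curried.act_congr rfl (toTrans_subst g (f :: fs) h).symm _)
  subst_loosen_tail g f₁ fs f fs' h := by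
    have e₀ : toTranss (fs ++ loosenArrow f :: fs') = toTranss (fs ++ f :: fs') := by
      rw [toTranss_append, toTranss_append, toTranss, toTranss, toTrans_loosen]
    have h' : g.src = (f₁ :: (fs ++ loosenArrow f :: fs')).map MultiArrow.tgt := by
      simpa using h
    refine toCurried_injective rfl ?_
    cases hg : g.type with
    | loose =>
      obtain ⟨_, e₁⟩ := toCurried_subst_of_loose g _ hg h'
      obtain ⟨_, e₂⟩ := toCurried_subst_of_loose g _ hg h
      rw [e₁, e₂]
      exact Curried.act_congr rfl (congrArg ((toTrans f₁).tensor ·) e₀) _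
    | tight =>
      obtain ⟨_, _, e₁⟩ := toCurried_subst_of_tight g _ _ hg h'
      obtain ⟨_, _, e₂⟩ := toCurried_subst_of_tight g _ _ hg h
      rw [e₁, e₂]
      exact Curried.comp_congr rfl (Curried.act_congr rfl e₀ _) _

end SkewCl

namespace SkewMulticat

open SkewMulticatData Multifunctor

variable {A : SkewMulticat.{v, u}}

/-! ### Substitution in unary, binary and ternary multimaps -/

theorem subst_subst_binary (h k k' : A.Arrow) (xs ys : List A.Arrow)
    (hh : h.src = [k, k'].map MultiArrow.tgt) (hk : k.src = xs.map MultiArrow.tgt)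
    (hk' : k'.src = ys.map MultiArrow.tgt)
    (H : (subst h [k, k'] hh).src = (xs ++ ys).map MultiArrow.tgt) :
    subst (subst h [k, k'] hh) (xs ++ ys) H = subst h [subst k xs hk, subst k' ys hk'] hh :=
  (subst_congr rfl (by simp) _ _).trans (A.assoc h [⟨k, xs, hk⟩, ⟨k', ys, hk'⟩] hh)

theorem subst_one' {a : A.Obj} (x : A.Arrow) (h : [a] = [x].map MultiArrow.tgt) :
    subst (idArrow a) [x] h = x := by
  obtain rfl : a = x.tgt := (List.cons.inj h).1
  exact A.one_subst x

/-- Substitution in a tight unary multimap. -/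
def un {a b : A.Obj} (f : A.Hom .tight [a] b) (x : A.Arrow) (hx : x.tgt = a) : A.Arrow :=
  subst (arrow f) [x] (by simp [hx])

@[simp] theorem un_src {a b : A.Obj} (f : A.Hom .tight [a] b) (x : A.Arrow) (hx : x.tgt = a) :
    (un f x hx).src = x.src := List.append_nil _

theorem un_one {a : A.Obj} (x : A.Arrow) (hx : x.tgt = a) : un (A.one a) x hx = x :=
  subst_one' _ _

theorem un_idArrow {a b : A.Obj} (f : A.Hom .tight [a] b) : un f (idArrow a) rfl = arrow f :=
  A.subst_one (arrow f)

theorem un_loosen {a b : A.Obj} (f : A.Hom .tight [a] b) (x : A.Arrow)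
    (hx : (loosenArrow x).tgt = a) :
    un f (loosenArrow x) hx = loosenArrow (un f x ((loosenArrow_tgt x).symm.trans hx)) :=
  A.subst_loosen_head (arrow f) x [] _

theorem un_subst {a b : A.Obj} (f : A.Hom .tight [a] b) (g : A.Arrow) (hg : g.tgt = a)
    (xs : List A.Arrow) (hxs : g.src = xs.map MultiArrow.tgt)
    (h : (un f g hg).src = xs.map MultiArrow.tgt) :
    subst (un f g hg) xs h = un f (subst g xs hxs) hg :=
  MultiTrans.subst_subst_unary _ _ _ _ _

theorem hom_ext_un {a b : A.Obj} {f g : A.Hom .tight [a] b}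
    (h : un f (idArrow a) rfl = un g (idArrow a) rfl) : f = g :=
  arrow_injective (by rwa [un_idArrow, un_idArrow] at h)

/-! ### The underlying category -/

/-- The objects of a skew multicategory, as the objects of its underlying category. -/
abbrev Underlying (A : SkewMulticat.{v, u}) : Type u := A.Obj

/-- The category of tight unary multimaps. -/
instance : Category.{v} (Underlying A) where
  Hom a b := A.Hom .tight [a] b
  id a := A.one a
  comp f g := A.sub [arrow f] g
  id_comp f := arrow_injective (A.subst_one (arrow f))
  comp_id f := arrow_injective (A.one_subst (arrow f))
  assoc f g h := arrow_injective
    (MultiTrans.subst_subst_unary (arrow h) (arrow g) [arrow f] rfl rfl).symm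

/-- Application of a morphism of the underlying category to a multimap. -/
def act {a b : Underlying A} (f : a ⟶ b) (x : A.Arrow) (hx : x.tgt = a) : A.Arrow :=
  un (A := A) f x hx

section Act

variable {a b c : Underlying A}

@[simp] theorem act_tgt (f : a ⟶ b) (x : A.Arrow) (hx : x.tgt = a) : (act f x hx).tgt = b := (rfl)

@[simp] theorem act_src (f : a ⟶ b) (x : A.Arrow) (hx : x.tgt = a) :
    (act f x hx).src = x.src := un_src _ _ _

@[simp] theorem act_type (f : a ⟶ b) (x : A.Arrow) (hx : x.tgt = a) :
    (act f x hx).type = x.type := rfl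

theorem act_id (x : A.Arrow) (hx : x.tgt = a) : act (𝟙 a) x hx = x := un_one _ _

theorem act_comp (f : a ⟶ b) (g : b ⟶ c) (x : A.Arrow) (hx : x.tgt = a) :
    act (f ≫ g) x hx = act g (act f x hx) (act_tgt f x hx) :=
  MultiTrans.subst_subst_unary (B := A) (arrow (A := A.toSkewMulticatData) g)
    (arrow (A := A.toSkewMulticatData) f) [x] rfl _

theorem act_loosen (f : a ⟶ b) (x : A.Arrow) (hx : (loosenArrow x).tgt = a) :
    act f (loosenArrow x) hx = loosenArrow (act f x ((loosenArrow_tgt x).symm.trans hx)) :=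
  un_loosen _ _ _

theorem act_idArrow (f : a ⟶ b) :
    act f (idArrow a) rfl = arrow (A := A.toSkewMulticatData) f :=
  un_idArrow (A := A) f

/-- The identity multimap is the generic element of `a`. Equations between morphisms are proved from
here on by applying both sides to generic elements. -/
theorem hom_ext_act {f g : a ⟶ b}
    (h : act f (idArrow a) rfl =
      act g (idArrow a) rfl) : f = g :=
  hom_ext_un (A := A) h

theorem subst_act (f : a ⟶ b) (g : A.Arrow) (hg : g.tgt = a)
    (xs : List A.Arrow) (hxs : g.src = xs.map MultiArrow.tgt)
    (h : (act f g hg).src = xs.map MultiArrow.tgt) :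
    subst (act f g hg) xs h = act f (subst g xs hxs) hg := un_subst (A := A) _ _ _ _ _ _

end Act

/-! ### Closed structures -/

/-- A choice of internal homs and of a nullary map classifier. -/
structure ClosedStructure (A : SkewMulticat.{v, u}) where
  hom : Underlying A → Underlying A → Underlying A
  ev : ∀ b c : A.Obj, A.Hom .tight [hom b c, b] c
  bijective_ev : ∀ (b c : A.Obj) (x : Tightness) (as : List A.Obj), (as = [] → x = .loose) →
    Function.Bijective (A.substFirst (ev b c) x as)
  unit : Underlying A
  theta : A.Hom .loose [] unit
  bijective_theta : ∀ b : A.Obj, Function.Bijective (A.substNullary theta b)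

theorem nonempty_closedStructure (h : A.IsClosed) (h' : A.HasUnit) :
    Nonempty (ClosedStructure A) := by
  choose hom ev hev using h
  obtain ⟨u, θ, hθ⟩ := h'
  exact ⟨⟨hom, ev, hev, u, θ, hθ⟩⟩

namespace ClosedStructure

variable (S : ClosedStructure A)

/-- The evaluation multimap. -/
abbrev evArrow (b c : Underlying A) : A.Arrow := arrow (S.ev b c)

/-- The universal nullary multimap. -/
abbrev thetaArrow : A.Arrow := arrow S.theta

/-- `e(x,y)`. -/
def ap {b c : Underlying A} (x y : A.Arrow) (hx : x.tgt = S.hom b c) (hy : y.tgt = b) :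
    A.Arrow :=
  subst (S.evArrow b c) [x, y] (by simp [hx, hy])

variable {a b c : Underlying A}

@[simp] theorem ap_tgt (x y : A.Arrow) (hx : x.tgt = S.hom b c) (hy : y.tgt = b) :
    (S.ap x y hx hy).tgt = c := (rfl)

@[simp] theorem ap_src (x y : A.Arrow) (hx : x.tgt = S.hom b c) (hy : y.tgt = b) :
    (S.ap x y hx hy).src = x.src ++ y.src := by
  simp [ap, subst]

@[simp] theorem ap_type (x y : A.Arrow) (hx : x.tgt = S.hom b c) (hy : y.tgt = b) :
    (S.ap x y hx hy).type = x.type := rfl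

theorem ap_loosen_left (x y : A.Arrow) (hx : (loosenArrow x).tgt = S.hom b c) (hy : y.tgt = b) :
    S.ap (loosenArrow x) y hx hy =
      loosenArrow (S.ap x y ((loosenArrow_tgt x).symm.trans hx) hy) :=
  A.subst_loosen_head _ _ _ _

theorem ap_loosen_right (x y : A.Arrow) (hx : x.tgt = S.hom b c) (hy : (loosenArrow y).tgt = b) :
    S.ap x (loosenArrow y) hx hy = S.ap x y hx ((loosenArrow_tgt y).symm.trans hy) :=
  A.subst_loosen_tail _ _ [] _ [] _

theorem type_eq_loose (x : A.Arrow) (h : x.src = []) : x.type = .loose := by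
  obtain ⟨_ | _, as, b, f⟩ := x
  · obtain rfl : as = _ := h
    exact ((A.tight_nullary b).false f).elim
  · rfl

/-- The uniqueness half of the universal property. Equality of the types and sources of `x` and `y`
need not be assumed, as both can be read off from `e(x,1)`. -/
theorem ap_ext {x y : A.Arrow} (hx : x.tgt = S.hom b c) (hy : y.tgt = S.hom b c)
    (h : S.ap x (idArrow b) hx rfl =
      S.ap y (idArrow b) hy rfl) : x = y := by
  have h₁ : x.type = y.type := by
    have := congrArg MultiArrow.type h
    exact this
  have h₂ : x.src = y.src := by
    have := congrArg MultiArrow.src h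
    simpa using this
  obtain ⟨t, as, d, f⟩ := x
  obtain ⟨t', as', d', g⟩ := y
  obtain rfl : t = t' := h₁
  obtain rfl : as = as' := h₂
  obtain rfl : d = _ := hx
  obtain rfl : d' = _ := hy
  rw [(S.bijective_ev b c t as fun has => type_eq_loose ⟨t, as, _, f⟩ has).1
    (arrow_injective h)]

/-- The existence half of the universal property. The last hypothesis excludes tight unary
multimaps, whose transposes would be tight and nullary. -/
theorem exists_ap (x : A.Arrow) (as : List A.Obj) (h : x.src = as ++ [b])
    (h' : as = [] → x.type = .loose) :
    ∃ (f : A.Arrow) (hf : f.tgt = S.hom b x.tgt), f.type = x.type ∧ f.src = as ∧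
      S.ap f (idArrow b) hf rfl = x := by
  obtain ⟨t, s, d, x⟩ := x
  obtain rfl : s = _ := h
  obtain ⟨f, rfl⟩ := (S.bijective_ev b d t as h').2 x
  exact ⟨arrow f, rfl, rfl, rfl, rfl⟩

/-- The tight unary multimap `a ⟶ [b,c]` that corresponds to a tight multimap `a, b ⟶ c`. -/
noncomputable def curry (f : A.Hom .tight [a, b] c) : a ⟶ S.hom b c :=
  Function.surjInv (S.bijective_ev b c .tight [a] (by simp)).2 f

theorem ap_curry (f : A.Hom .tight [a, b] c) (x y : A.Arrow) (hx : x.tgt = a)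
    (h : (act (S.curry f) x hx).tgt = S.hom b c)
    (hy : y.tgt = b) :
    S.ap (act (S.curry f) x hx) y h hy = subst (arrow f) [x, y] (by simp [hx, hy]) := by
  have e : S.ap (arrow (S.curry f)) (idArrow b) rfl rfl = arrow f :=
    congrArg arrow (Function.surjInv_eq (S.bijective_ev b c .tight [a] (by simp)).2 f)
  refine Eq.trans ?_ ((subst_subst_binary (S.evArrow b c) (arrow (S.curry f))
    (idArrow b) [x] [y] rfl (by simp [hx]) (by simp [hy])
    (by simp [hx, hy])).symm.trans (subst_congr e rfl _ _))
  simp only [subst_one']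
  rfl

/-- The tight unary multimap `u ⟶ b` that corresponds to a nullary multimap. -/
noncomputable def ofNullary (f : A.Hom .loose [] b) : S.unit ⟶ b :=
  Function.surjInv (S.bijective_theta b).2 f

theorem ofNullary_theta (f : A.Hom .loose [] b) :
    act (S.ofNullary f) S.thetaArrow rfl = arrow f :=
  congrArg arrow (Function.surjInv_eq (S.bijective_theta b).2 f)

theorem unit_hom_ext {f g : S.unit ⟶ b}
    (h : act f S.thetaArrow rfl = act g S.thetaArrow rfl) : f = g :=
  (S.bijective_theta b).1 (arrow_injective h)

theorem exists_act_theta (x : A.Arrow) (h : x.src = []) :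
    ∃ f : S.unit ⟶ x.tgt, act f S.thetaArrow rfl = x := by
  have h' := type_eq_loose x h
  obtain ⟨t, s, d, x⟩ := x
  obtain rfl : s = _ := h
  obtain rfl : t = _ := h'
  exact ⟨S.ofNullary x, S.ofNullary_theta x⟩

end ClosedStructure

end SkewMulticat

/-! ### The skew closed category of tight unary multimaps -/

namespace SkewMulticat

open SkewMulticatData Multifunctor

variable {A : SkewMulticat.{v, u}}

namespace ClosedStructure

variable (S : ClosedStructure A) {a a' b b' c c' d : Underlying A}

/-- `[b,f]`. -/
noncomputable def post (b : Underlying A) {c c' : Underlying A} (f : c ⟶ c') :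
    S.hom b c ⟶ S.hom b c' :=
  S.curry (A.sub [arrow (S.ev b c)] f)

/-- `[f,c]`. -/
noncomputable def pre {b b' : Underlying A} (f : b ⟶ b') (c : Underlying A) :
    S.hom b' c ⟶ S.hom b c :=
  S.curry (A.sub [idArrow (S.hom b' c), arrow (A := A.toSkewMulticatData) f] (S.ev b' c))

/-- The multimap `e(1,e) : [b,c], [a,b], a ⟶ c`. -/
def evEv (a b c : Underlying A) : A.Hom .tight ([S.hom b c, S.hom a b] ++ [a]) c :=
  A.sub [idArrow (S.hom b c), arrow (S.ev a b)] (S.ev b c)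

/-- `L : [b,c] ⟶ [[a,b],[a,c]]`. -/
noncomputable def L (a b c : Underlying A) : S.hom b c ⟶ S.hom (S.hom a b) (S.hom a c) :=
  S.curry (Function.surjInv (S.bijective_ev a c .tight [S.hom b c, S.hom a b] (by simp)).2
    (S.evEv a b c))

/-- `i : [u,a] ⟶ a`. -/
def i (a : Underlying A) : S.hom S.unit a ⟶ a :=
  A.sub [idArrow (S.hom S.unit a), S.thetaArrow] (S.ev S.unit a)

/-- `j : u ⟶ [a,a]`. -/
noncomputable def j (a : Underlying A) : S.unit ⟶ S.hom a a :=
  S.ofNullary (Function.surjInv (S.bijective_ev a a .loose [] (by simp)).2 (A.loosen (A.one a)))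

variable {S} in
theorem ap_congr {x x' y y' : A.Arrow} (hxx : x = x') (hyy : y = y') (hx : x.tgt = S.hom b c)
    (hy : y.tgt = b) : S.ap x y hx hy = S.ap x' y' (hxx ▸ hx) (hyy ▸ hy) := by
  subst hxx hyy; rfl

/-- This lemma, `ap_pre`, `ap_L`, `act_i` and `ap_j` form a rewriting system that evaluates the
structure morphisms on generalized elements. With the rules for `act` and for loosening it brings
both sides of each skew closed axiom to a common form. -/
theorem ap_post (f : c ⟶ c') (x y : A.Arrow) (hx : x.tgt = S.hom b c)
    (h : (act (S.post b f) x hx).tgt = S.hom b c') (hy : y.tgt = b) :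
    S.ap (act (S.post b f) x hx) y h hy = act f (S.ap x y hx hy) (S.ap_tgt x y hx hy) :=
  (S.ap_curry _ _ _ _ _ _).trans
    (MultiTrans.subst_subst_unary (B := A) (arrow (A := A.toSkewMulticatData) f)
      (S.evArrow b c) [x, y] rfl (by simp [hx, hy]))

theorem ap_pre (f : b ⟶ b') (x y : A.Arrow) (hx : x.tgt = S.hom b' c)
    (h : (act (S.pre f c) x hx).tgt = S.hom b c) (hy : y.tgt = b) :
    S.ap (act (S.pre f c) x hx) y h hy = S.ap x (act f y hy) hx (act_tgt f y hy) := by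
  refine (S.ap_curry _ _ _ _ _ _).trans ((subst_subst_binary (S.evArrow b' c)
    (idArrow (S.hom b' c)) (arrow (A := A.toSkewMulticatData) f) [x] [y] rfl
    (by simp [hx]) (by simp [hy]) (by simp [hx, hy])).trans ?_)
  simp only [subst_one']
  rfl

/-- Both sides are `e(1,e)` with `x`, `y`, `z` substituted: on the left because `L` is its double
transpose, on the right by associativity. -/
theorem ap_L (x y z : A.Arrow) (hx : x.tgt = S.hom b c)
    (h : (act (S.L a b c) x hx).tgt = S.hom (S.hom a b) (S.hom a c)) (hy : y.tgt = S.hom a b)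
    (h' : (S.ap (act (S.L a b c) x hx) y h hy).tgt = S.hom a c) (hz : z.tgt = a) :
    S.ap (S.ap (act (S.L a b c) x hx) y h hy) z h' hz = S.ap x (S.ap y z hy hz) hx (S.ap_tgt y z hy hz) := by
  have e₁ : S.ap (arrow (Function.surjInv (S.bijective_ev a c .tight [S.hom b c, S.hom a b]
      (by simp)).2 (S.evEv a b c))) (idArrow a) rfl rfl = arrow (S.evEv a b c) :=
    congrArg arrow (Function.surjInv_eq (S.bijective_ev a c .tight [S.hom b c, S.hom a b]
      (by simp)).2 (S.evEv a b c))
  have e₂ := subst_subst_binary (S.evArrow a c) (arrow (Function.surjInv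
    (S.bijective_ev a c .tight [S.hom b c, S.hom a b] (by simp)).2 (S.evEv a b c)))
    (idArrow a) [x, y] [z] rfl (by simp [hx, hy]) (by simp [hz]) (by simp [hx, hy, hz])
  have e₃ := subst_subst_binary (S.evArrow b c) (idArrow (S.hom b c)) (S.evArrow a b) [x] [y, z]
    rfl (by simp [hx]) (by simp [hy, hz]) (by simp [hx, hy, hz])
  simp only [subst_one'] at e₂ e₃
  refine Eq.trans ?_ (e₂.symm.trans ((subst_congr e₁ rfl _ _).trans e₃))
  exact subst_congr rfl (congrArg (fun k => [k, z]) (S.ap_curry _ x y hx h hy)) _ _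

theorem act_i (x : A.Arrow) (hx : x.tgt = S.hom S.unit a) :
    act (S.i a) x hx = S.ap x S.thetaArrow hx rfl := by
  have e := subst_subst_binary (S.evArrow S.unit a) (idArrow (S.hom S.unit a)) S.thetaArrow
    [x] [] rfl (by simp [hx]) rfl (by simp [hx])
  simp only [subst_one'] at e
  refine e.trans (subst_congr rfl ?_ _ _)
  have := A.subst_one S.thetaArrow
  simpa using this

/-- The loosening is forced, since `θ` is loose and `j(θ)` stands in the first argument, which
decides the type. The rule is first obtained for an identity, by construction of `j`, and then
substituted into. -/
theorem ap_j (y : A.Arrow) (h : (act (S.j a) S.thetaArrow rfl).tgt = S.hom a a)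
    (hy : y.tgt = a) :
    S.ap (act (S.j a) S.thetaArrow rfl) y h hy = loosenArrow y := by
  have e₁ : S.ap (act (S.j a) S.thetaArrow rfl) (idArrow a) rfl rfl =
      loosenArrow (idArrow a) := by
    have e := S.ofNullary_theta
      (Function.surjInv (S.bijective_ev a a .loose [] (by simp)).2 (A.loosen (A.one a)))
    exact (S.ap_congr e rfl rfl rfl).trans (congrArg arrow
      (Function.surjInv_eq (S.bijective_ev a a .loose [] (by simp)).2 (A.loosen (A.one a))))
  have e₂ := subst_subst_binary (S.evArrow a a) (act (S.j a) S.thetaArrow rfl) (idArrow a)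
    [] [y] rfl rfl (by simp [hy]) (by simp [hy, subst])
  have e₃ := A.subst_one (act (S.j a) S.thetaArrow rfl)
  simp only [act_src, List.map_nil] at e₃
  simp only [subst_one', e₃] at e₂
  refine e₂.symm.trans ((subst_congr e₁ rfl _ (by simp [hy])).trans ?_)
  refine (A.loosen_subst (idArrow a) [y] (by simp [hy])).trans ?_
  rw [subst_one']

variable {S}

/-- This and the next four lemmas supply a generic argument for each internal hom in the target; for
morphisms out of `u` the generic element is `θ`. -/
theorem hom_ext₁ {f g : d ⟶ S.hom a b}
    (h : S.ap (act f (idArrow d) rfl) (idArrow a) (act_tgt _ _ _) rfl =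
      S.ap (act g (idArrow d) rfl) (idArrow a) (act_tgt _ _ _) rfl) : f = g :=
  hom_ext_act (S.ap_ext _ _ h)

theorem hom_ext₂ {f g : d ⟶ S.hom a (S.hom b c)}
    (h : S.ap (S.ap (act f (idArrow d) rfl) (idArrow a) (act_tgt _ _ _) rfl) (idArrow b)
        (S.ap_tgt _ _ _ _) rfl =
      S.ap (S.ap (act g (idArrow d) rfl) (idArrow a) (act_tgt _ _ _) rfl) (idArrow b)
        (S.ap_tgt _ _ _ _) rfl) : f = g :=
  hom_ext₁ (S.ap_ext _ _ h)

theorem hom_ext₃ {f g : d ⟶ S.hom a (S.hom b (S.hom c c'))}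
    (h : S.ap (S.ap (S.ap (act f (idArrow d) rfl) (idArrow a) (act_tgt _ _ _) rfl) (idArrow b)
        (S.ap_tgt _ _ _ _) rfl) (idArrow c) (S.ap_tgt _ _ _ _) rfl =
      S.ap (S.ap (S.ap (act g (idArrow d) rfl) (idArrow a) (act_tgt _ _ _) rfl) (idArrow b)
        (S.ap_tgt _ _ _ _) rfl) (idArrow c) (S.ap_tgt _ _ _ _) rfl) : f = g :=
  hom_ext₂ (S.ap_ext _ _ h)

theorem unit_hom_ext₁ {f g : S.unit ⟶ S.hom a b}
    (h : S.ap (act f S.thetaArrow rfl) (idArrow a) (act_tgt _ _ _) rfl =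
      S.ap (act g S.thetaArrow rfl) (idArrow a) (act_tgt _ _ _) rfl) : f = g :=
  S.unit_hom_ext (S.ap_ext _ _ h)

theorem unit_hom_ext₂ {f g : S.unit ⟶ S.hom a (S.hom b c)}
    (h : S.ap (S.ap (act f S.thetaArrow rfl) (idArrow a) (act_tgt _ _ _) rfl) (idArrow b)
        (S.ap_tgt _ _ _ _) rfl =
      S.ap (S.ap (act g S.thetaArrow rfl) (idArrow a) (act_tgt _ _ _) rfl) (idArrow b)
        (S.ap_tgt _ _ _ _) rfl) : f = g :=
  unit_hom_ext₁ (S.ap_ext _ _ h)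

variable (S)

theorem post_id (b c : Underlying A) : S.post b (𝟙 c) = 𝟙 (S.hom b c) :=
  hom_ext₁ (by simp only [ap_post, act_id])

theorem post_comp (b : Underlying A) (f : c ⟶ c') (g : c' ⟶ d) :
    S.post b (f ≫ g) = S.post b f ≫ S.post b g :=
  hom_ext₁ (by simp only [ap_post, act_comp])

theorem pre_id (b c : Underlying A) : S.pre (𝟙 b) c = 𝟙 (S.hom b c) :=
  hom_ext₁ (by simp only [ap_pre, act_id])

theorem pre_comp (f : b ⟶ b') (g : b' ⟶ d) (c : Underlying A) :
    S.pre (f ≫ g) c = S.pre g c ≫ S.pre f c :=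
  hom_ext₁ (by simp only [ap_pre, act_comp])

theorem post_pre (f : b ⟶ b') (g : c ⟶ c') :
    S.post b' g ≫ S.pre f c' = S.pre f c ≫ S.post b g :=
  hom_ext₁ (by simp only [ap_pre, ap_post, act_comp])

/-- The internal hom functor. -/
@[reducible] noncomputable def ihom : (Underlying A)ᵒᵖ ⥤ Underlying A ⥤ Underlying A where
  obj b :=
    { obj := fun c => S.hom b.unop c
      map := fun f => S.post b.unop f
      map_id := fun c => S.post_id _ c
      map_comp := fun f g => S.post_comp _ f g }
  map f :=
    { app := fun c => S.pre f.unop c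
      naturality := fun _ _ g => S.post_pre f.unop g }
  map_id _ := NatTrans.ext (funext fun c => S.pre_id _ c)
  map_comp f g := NatTrans.ext (funext fun c => S.pre_comp g.unop f.unop c)

theorem L_natural_right (a b : Underlying A) (f : c ⟶ c') :
    S.post b f ≫ S.L a b c' = S.L a b c ≫ S.post (S.hom a b) (S.post a f) :=
  hom_ext₂ (by
    simp only [ap_L, ap_post, act_comp])

theorem L_natural_middle (a : Underlying A) (f : b ⟶ b') (c : Underlying A) :
    S.pre f c ≫ S.L a b c = S.L a b' c ≫ S.pre (S.post a f) (S.hom a c) :=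
  hom_ext₂ (by
    simp only [ap_L, ap_pre, ap_post, act_comp])

theorem L_extranatural (f : a ⟶ a') (b c : Underlying A) :
    S.L a b c ≫ S.pre (S.pre f b) (S.hom a c) = S.L a' b c ≫ S.post (S.hom a' b) (S.pre f c) :=
  hom_ext₂ (by
    simp only [ap_L, ap_pre, ap_post, act_comp])

theorem i_natural (f : a ⟶ a') : S.post S.unit f ≫ S.i a' = S.i a ≫ f :=
  hom_ext_act (by simp only [act_i, ap_post, act_comp])

theorem j_extranatural (f : a ⟶ a') : S.j a ≫ S.post a f = S.j a' ≫ S.pre f a' :=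
  unit_hom_ext₁ (by
    simp only [ap_j, ap_pre, ap_post, act_comp, act_loosen])

theorem pentagon (a b c d : Underlying A) :
    S.L a c d ≫ S.L (S.hom a b) (S.hom a c) (S.hom a d) ≫
        S.pre (S.L a b c) (S.hom (S.hom a b) (S.hom a d)) =
      S.L b c d ≫ S.post (S.hom b c) (S.L a b d) :=
  hom_ext₃ (by
    simp only [ap_L, ap_pre, ap_post, act_comp])

theorem L_j_i (a c : Underlying A) :
    S.L a a c ≫ S.pre (S.j a) (S.hom a c) ≫ S.i (S.hom a c) = 𝟙 (S.hom a c) :=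
  hom_ext₁ (by
    simp only [ap_L, ap_pre, act_i, ap_j, act_comp, act_id, ap_loosen_right])

theorem L_i (b c : Underlying A) :
    S.L S.unit b c ≫ S.post (S.hom S.unit b) (S.i c) = S.pre (S.i b) c :=
  hom_ext₁ (by
    simp only [ap_L, ap_pre, ap_post, act_i, act_comp])

theorem j_L (a b : Underlying A) : S.j b ≫ S.L a b b = S.j (S.hom a b) :=
  unit_hom_ext₂ (by
    simp only [ap_L, ap_j, act_comp, ap_loosen_left])

theorem j_i : S.j S.unit ≫ S.i S.unit = 𝟙 S.unit :=
  S.unit_hom_ext (by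
    simp only [ap_j, act_i, act_comp, act_id, loosenArrow])

/-- The skew closed structure on the underlying category. -/
@[reducible] noncomputable def skewClosed : SkewClosed (Underlying A) where
  ihom := S.ihom
  unit := S.unit
  L := S.L
  i := S.i
  j := S.j
  L_natural_right a _ _ _ f := S.L_natural_right a _ f
  L_natural_middle a _ _ f c := S.L_natural_middle a f c
  L_extranatural f b c := S.L_extranatural f b c
  i_natural f := S.i_natural f
  j_extranatural f := S.j_extranatural f
  pentagon := S.pentagon
  L_j_i := S.L_j_i
  L_i := S.L_i
  j_L := S.j_L
  j_i := S.j_i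

/-- The skew closed category of tight unary multimaps. -/
@[reducible] noncomputable def skewCl : SkewCl.{v, u} where
  carrier := Underlying A
  skewClosed := S.skewClosed

end ClosedStructure

end SkewMulticat

/-! ### Closed functors and closed transformations from morphisms and 2-cells of skew
multicategories -/

namespace SkewMulticat

open SkewMulticatData Multifunctor

variable {A B : SkewMulticat.{v, u}}

namespace Multifunctor

/-- The action on tight unary multimaps. -/
def mapHom (F : Multifunctor A B) {a b : Underlying A} (f : a ⟶ b) :
    (F.obj a : Underlying B) ⟶ (F.obj b : Underlying B) := F.map f

theorem arr_idArrow (F : Multifunctor A B) (a : A.Obj) :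
    F.arr (idArrow a) = idArrow (F.obj a) := congrArg arrow (F.map_one a)

theorem arr_act (F : Multifunctor A B) {a b : Underlying A} (f : a ⟶ b) (x : A.Arrow)
    (hx : x.tgt = a) : F.arr (act f x hx) = act (F.mapHom f) (F.arr x) (congrArg F.obj hx) :=
  F.arr_subst (arrow (A := A.toSkewMulticatData) f) [x] _

theorem act_mapHom (F : Multifunctor A B) {a b : Underlying A} (f : a ⟶ b) (x : A.Arrow)
    (hx : x.tgt = a) (h : (F.arr x).tgt = F.obj a) :
    act (F.mapHom f) (F.arr x) h = F.arr (act f x hx) := (F.arr_act f x hx).symm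

theorem arr_loosen (F : Multifunctor A B) (x : A.Arrow) :
    F.arr (loosenArrow x) = loosenArrow (F.arr x) := by
  obtain ⟨_ | _, as, b, f⟩ := x
  · exact congrArg arrow (F.map_loosen f)
  · rfl

/-- The functor between the underlying categories. -/
def underlying (F : Multifunctor A B) : Underlying A ⥤ Underlying B where
  obj a := F.obj a
  map f := F.mapHom f
  map_id a := F.map_one a
  map_comp f g := arrow_injective (F.arr_subst (arrow (A := A.toSkewMulticatData) g)
    [arrow (A := A.toSkewMulticatData) f] rfl)

variable (F : Multifunctor A B) (S : ClosedStructure A) (T : ClosedStructure B)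

/-- The comparison `F[a,b] ⟶ [Fa,Fb]`. -/
noncomputable def homComp (a b : Underlying A) :
    (F.obj (S.hom a b) : Underlying B) ⟶ T.hom (F.obj a) (F.obj b) :=
  T.curry (F.map (S.ev a b))

/-- The comparison `u ⟶ Fu`. -/
noncomputable def unitComp : T.unit ⟶ (F.obj S.unit : Underlying B) :=
  T.ofNullary (F.map S.theta)

/-- The computation rule for the comparison: it expresses that `F` preserves substitution into `e`.
The axioms of a closed functor follow by evaluation on generic elements. -/
theorem ap_homComp {a b : Underlying A} (x y : A.Arrow) (hx : x.tgt = S.hom a b)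
    (hy : y.tgt = a) (h : (F.arr x).tgt = F.obj (S.hom a b))
    (h' : (act (F.homComp S T a b) (F.arr x) h).tgt = T.hom (F.obj a) (F.obj b))
    (h'' : (F.arr y).tgt = F.obj a) :
    T.ap (act (F.homComp S T a b) (F.arr x) h) (F.arr y) h' h'' = F.arr (S.ap x y hx hy) :=
  (T.ap_curry (F.map (S.ev a b)) (F.arr x) (F.arr y) h h' h'').trans
    (F.arr_subst (S.evArrow a b) [x, y] (by simp [hx, hy])).symm

theorem unitComp_theta (h : T.thetaArrow.tgt = T.unit) :
    act (F.unitComp S T) T.thetaArrow h = F.arr S.thetaArrow := T.ofNullary_theta _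

open ClosedStructure

theorem homComp_natural_right (a : Underlying A) {b b' : Underlying A} (f : b ⟶ b') :
    F.mapHom (S.post a f) ≫ F.homComp S T a b' =
      F.homComp S T a b ≫ T.post (F.obj a) (F.mapHom f) :=
  hom_ext₁ (by
    -- The generic elements of `B` are rewritten as images of generic elements of `A`, so that `F`
    -- can be pulled out of every evaluation and the identity becomes one in `A`.
    simp (disch := simp) only [act_comp, ap_post, ← F.arr_idArrow, F.ap_homComp, F.act_mapHom])

theorem homComp_natural_left {a a' : Underlying A} (f : a ⟶ a') (b : Underlying A) :
    F.mapHom (S.pre f b) ≫ F.homComp S T a b =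
      F.homComp S T a' b ≫ T.pre (F.mapHom f) (F.obj b) :=
  hom_ext₁ (by
    simp (disch := simp) only [act_comp, ap_pre, ← F.arr_idArrow, F.ap_homComp, F.act_mapHom])

theorem map_j (a : Underlying A) :
    F.unitComp S T ≫ F.mapHom (S.j a) ≫ F.homComp S T a a = T.j (F.obj a) :=
  unit_hom_ext₁ (by
    simp (disch := simp) only [act_comp, ap_j, ← F.arr_idArrow, F.ap_homComp, F.act_mapHom,
      F.unitComp_theta, F.arr_loosen])

theorem map_i (a : Underlying A) :
    F.homComp S T S.unit a ≫ T.pre (F.unitComp S T) (F.obj a) ≫ T.i (F.obj a) =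
      F.mapHom (S.i a) :=
  hom_ext_act (by
    simp (disch := simp) only [act_comp, act_i, ap_pre, ← F.arr_idArrow, F.ap_homComp,
      F.act_mapHom, F.unitComp_theta])

theorem map_L (a b c : Underlying A) :
    F.mapHom (S.L a b c) ≫ F.homComp S T (S.hom a b) (S.hom a c) ≫
        T.post (F.obj (S.hom a b)) (F.homComp S T a c) =
      F.homComp S T b c ≫ T.L (F.obj a) (F.obj b) (F.obj c) ≫
        T.pre (F.homComp S T a b) (T.hom (F.obj a) (F.obj c)) :=
  hom_ext₂ (by
    simp (disch := simp) only [act_comp, ap_L, ap_pre, ap_post, ← F.arr_idArrow, F.ap_homComp,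
      F.act_mapHom])

/-- The closed functor induced by a morphism of skew multicategories. -/
noncomputable def closedFunctor : SkewCl.ClosedFunctor S.skewCl T.skewCl where
  toFunctor := F.underlying
  homComp := F.homComp S T
  unitComp := F.unitComp S T
  homComp_natural_right a _ _ f := F.homComp_natural_right S T a f
  homComp_natural_left f b := F.homComp_natural_left S T f b
  map_j := F.map_j S T
  map_i := F.map_i S T
  map_L := F.map_L S T

end Multifunctor

theorem ClosedFunctor.ext_of_toFunctor {C D : SkewCl.{v, u}} {F G : SkewCl.ClosedFunctor C D}
    (h : F.toFunctor = G.toFunctor)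
    (h' : ∀ a b, HEq (F.homComp a b) (G.homComp a b)) (h'' : HEq F.unitComp G.unitComp) :
    F = G := by
  obtain ⟨F, _, _, _, _, _, _, _⟩ := F
  obtain ⟨G, _, _, _, _, _, _, _⟩ := G
  obtain rfl : F = G := h
  exact SkewCl.ClosedFunctor.ext' rfl
    (heq_of_eq (funext fun a => funext fun b => eq_of_heq (h' a b))) h''

namespace MultiTrans

variable {F G : Multifunctor A B} (φ : MultiTrans F G)

/-- The components of a 2-cell, as morphisms of the underlying category. -/
def hom (a : Underlying A) : (F.obj a : Underlying B) ⟶ G.obj a := φ.app a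

theorem hom_naturality {a b : Underlying A} (f : a ⟶ b) :
    F.mapHom f ≫ φ.hom b = φ.hom a ≫ G.mapHom f :=
  arrow_injective (φ.naturality (arrow (A := A.toSkewMulticatData) f))

/-- A nullary multimap has no inputs on which `φ` could act. For `x = θ` this becomes the unit axiom
of a closed transformation. -/
theorem act_hom_nullary (x : A.Arrow) (hx : x.src = []) (h : (F.arr x).tgt = F.obj x.tgt) :
    act (φ.hom x.tgt) (F.arr x) h = G.arr x := by
  refine (φ.naturality x).trans (Eq.trans (subst_congr rfl ?_ _ ?_) (B.subst_one (G.arr x)))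
  · simp [hx, arr_src]
  · simp [hx, arr_src]

theorem act_hom_evArrow (S : ClosedStructure A) (a b : Underlying A)
    (h : (F.arr (S.evArrow a b)).tgt = F.obj b) :
    act (φ.hom b) (F.arr (S.evArrow a b)) h =
      subst (G.arr (S.evArrow a b)) [act (φ.hom (S.hom a b)) (idArrow (F.obj (S.hom a b))) rfl,
        act (φ.hom a) (idArrow (F.obj a)) rfl] rfl := by
  refine (φ.naturality (S.evArrow a b)).trans (subst_congr rfl ?_ _ _)
  simp only [act_idArrow]
  rfl

/-- Naturality of `φ` at the binary multimap `e`, transposed. -/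
theorem hom_homComp (S : ClosedStructure A) (T : ClosedStructure B) (a b : Underlying A) :
    F.homComp S T a b ≫ T.post (F.obj a) (φ.hom b) =
      φ.hom (S.hom a b) ≫ G.homComp S T a b ≫ T.pre (φ.hom a) (G.obj b) :=
  ClosedStructure.hom_ext₁ (by
    simp only [act_comp, ClosedStructure.ap_post, ClosedStructure.ap_pre]
    refine Eq.trans ?_ ((φ.act_hom_evArrow S a b rfl).trans (T.ap_curry (G.map (S.ev a b))
      (act (φ.hom (S.hom a b)) (idArrow (F.obj (S.hom a b))) rfl)
      (act (φ.hom a) (idArrow (F.obj a)) rfl) rfl rfl rfl).symm)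
    congr 1
    exact (T.ap_curry (F.map (S.ev a b)) _ _ rfl rfl rfl).trans (B.subst_one (F.arr (S.evArrow a b))))

/-- The closed transformation induced by a 2-cell of skew multicategories. -/
def closedTrans (S : ClosedStructure A) (T : ClosedStructure B) :
    SkewCl.ClosedTrans (F.closedFunctor S T) (G.closedFunctor S T) where
  app a := φ.hom a
  naturality f := φ.hom_naturality f
  app_unit := T.unit_hom_ext (by
    refine (act_comp (F.unitComp S T) (φ.hom S.unit) T.thetaArrow rfl).trans ?_
    simp only [F.unitComp_theta]
    exact (φ.act_hom_nullary S.thetaArrow rfl _).trans (G.unitComp_theta S T rfl).symm)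
  app_hom a b := φ.hom_homComp S T a b

end MultiTrans

namespace Multifunctor

theorem homComp_id (S : ClosedStructure A) (a b : Underlying A) :
    (Multifunctor.id A).homComp S S a b = 𝟙 (S.hom a b) :=
  ClosedStructure.hom_ext₁ (by
    refine ((Multifunctor.id A).ap_homComp S S (idArrow (S.hom a b)) (idArrow a) rfl rfl rfl rfl
      rfl).trans ?_
    rw [id_arr]
    exact S.ap_congr (act_id (idArrow _) rfl).symm rfl _ _)

theorem unitComp_id (S : ClosedStructure A) :
    (Multifunctor.id A).unitComp S S = 𝟙 S.unit :=
  S.unit_hom_ext (((Multifunctor.id A).unitComp_theta S S rfl).trans (act_id S.thetaArrow rfl).symm)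

theorem closedFunctor_id (S : ClosedStructure A) :
    (Multifunctor.id A).closedFunctor S S = SkewCl.ClosedFunctor.id S.skewCl :=
  ClosedFunctor.ext_of_toFunctor rfl (fun a b => heq_of_eq (homComp_id S a b))
    (heq_of_eq (unitComp_id S))

section Comp

variable {C : SkewMulticat.{v, u}} (F : Multifunctor A B) (G : Multifunctor B C)
  (S : ClosedStructure A) (T : ClosedStructure B) (R : ClosedStructure C)

theorem homComp_comp (a b : Underlying A) :
    (F.comp G).homComp S R a b =
      G.mapHom (F.homComp S T a b) ≫ G.homComp T R (F.obj a) (F.obj b) :=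
  ClosedStructure.hom_ext₁ (by
    have h := (F.comp G).ap_homComp S R (idArrow (S.hom a b)) (idArrow a) rfl rfl rfl rfl rfl
    simp only [arr_idArrow] at h
    refine h.trans ((comp_arr F G _).trans ?_)
    refine Eq.trans ?_ (R.ap_congr (act_comp (G.mapHom (F.homComp S T a b))
      (G.homComp T R (F.obj a) (F.obj b)) (idArrow _) rfl).symm rfl (act_tgt _ _ _) rfl)
    refine (congrArg G.arr (F.ap_homComp S T (idArrow (S.hom a b)) (idArrow a) rfl rfl rfl rfl
      rfl).symm).trans ((G.ap_homComp T R (act (F.homComp S T a b) (F.arr (idArrow (S.hom a b)))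
        rfl) (F.arr (idArrow a)) rfl rfl rfl rfl rfl).symm.trans ?_)
    refine R.ap_congr ?_ ?_ _ _
    · simp only [F.arr_idArrow, G.arr_act, G.arr_idArrow]
    · rw [F.arr_idArrow, G.arr_idArrow]; rfl)

theorem unitComp_comp :
    (F.comp G).unitComp S R = G.unitComp T R ≫ G.mapHom (F.unitComp S T) :=
  R.unit_hom_ext (((F.comp G).unitComp_theta S R rfl).trans (by
    refine (comp_arr F G _).trans (Eq.trans ?_
      (act_comp (G.unitComp T R) (G.mapHom (F.unitComp S T)) R.thetaArrow rfl).symm)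
    simp (disch := simp) only [G.unitComp_theta, G.act_mapHom]
    rw [F.unitComp_theta S T rfl]))

theorem closedFunctor_comp :
    (F.comp G).closedFunctor S R = (F.closedFunctor S T).comp (G.closedFunctor T R) :=
  ClosedFunctor.ext_of_toFunctor rfl (fun a b => heq_of_eq (homComp_comp F G S T R a b))
    (heq_of_eq (unitComp_comp F G S T R))

end Comp

end Multifunctor

/-- A choice of closed structure. -/
noncomputable def chosen (A : ClosedSkewMulticatWithUnit.{v, u}) :
    ClosedStructure (A : {A : SkewMulticat.{v, u} // A.IsClosed ∧ A.HasUnit}).1 :=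
  (nonempty_closedStructure A.2.1 A.2.2).some

open InducedBicategory

/-- The 2-functor that sends a closed skew multicategory with unit to the skew closed category of
its tight unary multimaps. -/
noncomputable def toSkewCl :
    StrictPseudofunctor ClosedSkewMulticatWithUnit.{v, u} SkewCl.{v, u} :=
  StrictPseudofunctor.mk''
    { obj A := (chosen A).skewCl
      map {A B} F := closedFunctor F.hom (chosen A) (chosen B)
      map₂ {A B F G} φ := MultiTrans.closedTrans φ.hom (chosen A) (chosen B)
      map₂_id _ := rfl
      map₂_comp _ _ := rfl
      map_id A := closedFunctor_id (chosen A)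
      map_comp {A B C} F G := closedFunctor_comp F.hom G.hom (chosen A) (chosen B) (chosen C)
      map₂_whisker_left F _ _ φ := SkewCl.hom₂_ext fun a => by
        simp only [SkewCl.comp_app, SkewCl.eqToHom_app]
        exact ((Category.id_comp _).trans (Category.comp_id _)).symm
      map₂_whisker_right φ F := SkewCl.hom₂_ext fun a => by
        simp only [SkewCl.comp_app, SkewCl.eqToHom_app]
        exact ((Category.id_comp _).trans (Category.comp_id _)).symm }

end SkewMulticat

namespace SkewMulticat

open SkewMulticatData Multifunctor

variable {A B : SkewMulticat.{v, u}}

namespace ClosedStructure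

variable (S : ClosedStructure A) (T : ClosedStructure B)

/-! ### Generation of multimaps -/

/-- A presentation of a multimap as `k(θ)`. -/
structure Nullary (x : A.Arrow) where
  k : S.unit ⟶ x.tgt
  eq : act k S.thetaArrow rfl = x

/-- A presentation of a multimap as a tight unary multimap. -/
structure Unary (x : A.Arrow) where
  a : Underlying A
  f : a ⟶ x.tgt
  eq : act f (idArrow a) rfl = x

/-- A presentation of a multimap as `e(f,1)`. -/
structure Application (x : A.Arrow) where
  b : Underlying A
  f : A.Arrow
  tgt_eq : f.tgt = S.hom b x.tgt
  eq : S.ap f (idArrow b) tgt_eq rfl = x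

variable {S}

theorem Application.src {x : A.Arrow} (p : S.Application x) : x.src = p.f.src ++ [p.b] := by
  conv_lhs => rw [← p.eq]
  exact S.ap_src _ _ _ _

theorem Unary.src {x : A.Arrow} (p : Unary x) : x.src = [p.a] := by
  conv_lhs => rw [← p.eq]
  exact act_src _ _ _

theorem Unary.type {x : A.Arrow} (p : Unary x) : x.type = .tight := by
  conv_lhs => rw [← p.eq]
  exact act_type _ _ _

theorem Nullary.src {x : A.Arrow} (p : S.Nullary x) : x.src = [] := by
  conv_lhs => rw [← p.eq]
  exact act_src _ _ _

/-- Presentations of each kind are unique, and by the lemmas that follow the three kinds exclude one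
another. Recursion on presentations is therefore independent of choices. -/
instance (x : A.Arrow) : Subsingleton (S.Nullary x) where
  allEq p q := by
    obtain ⟨k, h⟩ := p
    obtain ⟨k', h'⟩ := q
    obtain rfl : k = k' := S.unit_hom_ext (h.trans h'.symm)
    rfl

instance (x : A.Arrow) : Subsingleton (Unary x) where
  allEq p q := by
    have h₀ : p.a = q.a := by simpa using p.src.symm.trans q.src
    obtain ⟨a, f, h⟩ := p
    obtain ⟨a', f', h'⟩ := q
    obtain rfl : a = a' := h₀
    obtain rfl : f = f' := hom_ext_act (h.trans h'.symm)
    rfl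

instance (x : A.Arrow) : Subsingleton (S.Application x) where
  allEq p q := by
    have h₀ : p.b = q.b := by
      have := p.src.symm.trans q.src
      simpa using (List.append_inj' this rfl).2
    obtain ⟨b, f, hf, h⟩ := p
    obtain ⟨b', f', hf', h'⟩ := q
    obtain rfl : b = b' := h₀
    obtain rfl : f = f' := S.ap_ext hf hf' (h.trans h'.symm)
    rfl

theorem isEmpty_nullary_of_unary {x : A.Arrow} (p : Unary x) : ¬ Nonempty (S.Nullary x) :=
  fun ⟨q⟩ => by simpa using p.src.symm.trans q.src

theorem isEmpty_nullary_of_application {x : A.Arrow} (p : S.Application x) :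
    ¬ Nonempty (S.Nullary x) :=
  fun ⟨q⟩ => by simpa using p.src.symm.trans q.src

/-- If `e(f,1)` is unary then `f` is nullary, hence loose, and so `e(f,1)` is loose; a multimap
presented as tight unary is not. -/
theorem isEmpty_unary_of_application {x : A.Arrow} (p : S.Application x) :
    ¬ Nonempty (Unary x) := fun ⟨q⟩ => by
  have h₁ : p.f.src = [] := (List.append_inj' (t₁ := [p.b]) (s₂ := []) (t₂ := [q.a])
    (p.src.symm.trans q.src) rfl).1
  have h₂ : p.f.type = x.type := by
    conv_rhs => rw [← p.eq]
    exact (S.ap_type _ _ _ _).symm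
  rw [q.type, type_eq_loose p.f h₁] at h₂
  cases h₂

variable (S)

/-- A multimap that is not nullary has a last source, along which it can be transposed unless the
transpose would be tight and nullary. That happens only for tight unary multimaps. -/
theorem nonempty_application {x : A.Arrow} (h : ¬ Nonempty (S.Nullary x))
    (h' : ¬ Nonempty (Unary x)) : Nonempty (S.Application x) := by
  rcases List.eq_nil_or_concat x.src with hx | ⟨as, b, hx⟩
  · obtain ⟨k, hk⟩ := S.exists_act_theta x hx
    exact (h ⟨⟨k, hk⟩⟩).elim
  · rw [List.concat_eq_append] at hx
    by_cases has : as = [] → x.type = .loose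
    · obtain ⟨f, hf, -, -, e⟩ := S.exists_ap x as hx has
      exact ⟨⟨b, f, hf, e⟩⟩
    · push Not at has
      obtain ⟨rfl, ht⟩ := has
      obtain ⟨t, s, c, f⟩ := x
      obtain rfl : s = [b] := hx
      obtain _ | _ := t
      · exact (h' ⟨⟨b, f, act_idArrow (A := A) (a := b) (b := c) f⟩⟩).elim
      · exact (ht rfl).elim

variable {S} in
theorem Application.length_lt {x : A.Arrow} (p : S.Application x) :
    p.f.src.length < x.src.length := by
  rw [p.src]; simp

/-- Every multimap is built from `θ` and the tight unary multimaps by `f ↦ e(f,1)` and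
composition with tight unary multimaps. -/
theorem arrow_induction {P : A.Arrow → Prop}
    (nullary : ∀ {b : Underlying A} (k : S.unit ⟶ b), P (act k S.thetaArrow rfl))
    (unary : ∀ {a b : Underlying A} (f : a ⟶ b), P (act f (idArrow a) rfl))
    (application : ∀ {b c : Underlying A} (x : A.Arrow) (hx : x.tgt = S.hom b c), P x →
      P (S.ap x (idArrow b) hx rfl)) (x : A.Arrow) : P x := by
  by_cases h : Nonempty (S.Nullary x)
  · obtain ⟨p⟩ := h
    exact p.eq ▸ nullary p.k
  · by_cases h' : Nonempty (Unary x)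
    · obtain ⟨p⟩ := h'
      exact p.eq ▸ unary p.f
    · obtain ⟨p⟩ := S.nonempty_application h h'
      have := p.length_lt
      exact p.eq ▸ application p.f p.tgt_eq (arrow_induction nullary unary application p.f)
termination_by x.src.length

theorem subst_ap {b c : Underlying A} (x y : A.Arrow) (hx : x.tgt = S.hom b c) (hy : y.tgt = b)
    (xs ys : List A.Arrow) (hxs : x.src = xs.map MultiArrow.tgt)
    (hys : y.src = ys.map MultiArrow.tgt)
    (h : (S.ap x y hx hy).src = (xs ++ ys).map MultiArrow.tgt) :
    subst (S.ap x y hx hy) (xs ++ ys) h = S.ap (subst x xs hxs) (subst y ys hys) hx hy :=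
  subst_subst_binary _ _ _ _ _ _ _ _ _

theorem subst_ap_idArrow {b c : Underlying A} (x y : A.Arrow) (hx : x.tgt = S.hom b c)
    (xs : List A.Arrow) (hxs : x.src = xs.map MultiArrow.tgt)
    (h : (S.ap x (idArrow b) hx rfl).src = (xs ++ [y]).map MultiArrow.tgt) (hy : y.tgt = b) :
    subst (S.ap x (idArrow b) hx rfl) (xs ++ [y]) h = S.ap (subst x xs hxs) y hx hy := by
  refine (S.subst_ap x (idArrow b) hx rfl xs [y] hxs (by simp [hy]) h).trans ?_
  exact S.ap_congr rfl (subst_one' _ _) _ _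

end ClosedStructure

/-! ### The morphism of skew multicategories that corresponds to a closed functor -/

namespace ClosedExtension

open ClosedStructure

variable {S : ClosedStructure A} {T : ClosedStructure B}
  (Φ : SkewCl.ClosedFunctor S.skewCl T.skewCl)

/-- The action on objects. -/
noncomputable abbrev obj (a : Underlying A) : Underlying B := Φ.obj a

/-- The action on tight unary multimaps. -/
noncomputable def mapHom {a b : Underlying A} (f : a ⟶ b) : obj Φ a ⟶ obj Φ b := Φ.map f

/-- The multimap `Φ₀(θ)`. -/
noncomputable def theta : B.Arrow := act (b := obj Φ S.unit) Φ.unitComp T.thetaArrow rfl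

/-- `e(Φ̂(x),y)`. -/
noncomputable def ap {b c : Underlying A} (x y : B.Arrow) (hx : x.tgt = obj Φ (S.hom b c))
    (hy : y.tgt = obj Φ b) : B.Arrow :=
  T.ap (act (a := obj Φ (S.hom b c)) (b := T.hom (obj Φ b) (obj Φ c)) (Φ.homComp b c) x hx) y
    (act_tgt _ _ _) hy

variable {a a' b b' c c' : Underlying A}

@[simp] theorem theta_tgt : (theta Φ).tgt = obj Φ S.unit := (rfl)

@[simp] theorem ap_tgt (x y : B.Arrow) (hx : x.tgt = obj Φ (S.hom b c)) (hy : y.tgt = obj Φ b) :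
    (ap Φ x y hx hy).tgt = obj Φ c := (rfl)

theorem mapHom_id (a : Underlying A) : mapHom Φ (𝟙 a) = 𝟙 (obj Φ a) := Φ.map_id a

theorem mapHom_comp (f : a ⟶ b) (g : b ⟶ c) : mapHom Φ (f ≫ g) = mapHom Φ f ≫ mapHom Φ g :=
  Φ.map_comp f g

variable {Φ} in
theorem ap_congr {x x' y y' : B.Arrow} (hxx : x = x') (hyy : y = y')
    (hx : x.tgt = obj Φ (S.hom b c)) (hy : y.tgt = obj Φ b) :
    ap Φ x y hx hy = ap Φ x' y' (hxx ▸ hx) (hyy ▸ hy) := by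
  subst hxx hyy; rfl

/-- From here to `ap_L`, the computation rules of `T` are twisted by the comparison of `Φ`. Each
rule encodes an axiom of a closed functor: the two naturalities of the comparison, then `map_j`,
`map_i` and `map_L`. -/
theorem ap_post (f : c ⟶ c') (x y : B.Arrow) (hx : x.tgt = obj Φ (S.hom b c))
    (h : (act (mapHom Φ (S.post b f)) x hx).tgt = obj Φ (S.hom b c')) (hy : y.tgt = obj Φ b) :
    ap Φ (act (mapHom Φ (S.post b f)) x hx) y h hy =
      act (mapHom Φ f) (ap Φ x y hx hy) (ap_tgt Φ x y hx hy) := by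
  have e := congrArg (fun k : obj Φ (S.hom b c) ⟶ T.hom (obj Φ b) (obj Φ c') => act k x hx)
    (Φ.homComp_natural_right b f)
  exact (T.ap_congr ((act_comp _ _ _ _).symm.trans (e.trans (act_comp _ _ _ _))) rfl _ _).trans
    (T.ap_post _ _ _ _ _ _)

theorem ap_pre (f : b ⟶ b') (x y : B.Arrow) (hx : x.tgt = obj Φ (S.hom b' c))
    (h : (act (mapHom Φ (S.pre f c)) x hx).tgt = obj Φ (S.hom b c)) (hy : y.tgt = obj Φ b) :
    ap Φ (act (mapHom Φ (S.pre f c)) x hx) y h hy =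
      ap Φ x (act (mapHom Φ f) y hy) hx (act_tgt _ _ _) := by
  have e := congrArg (fun k : obj Φ (S.hom b' c) ⟶ T.hom (obj Φ b) (obj Φ c) => act k x hx)
    (Φ.homComp_natural_left f c)
  exact (T.ap_congr ((act_comp _ _ _ _).symm.trans (e.trans (act_comp _ _ _ _))) rfl _ _).trans
    (T.ap_pre _ _ _ _ _ _)

theorem ap_j (y : B.Arrow) (h : (act (mapHom Φ (S.j a)) (theta Φ) (theta_tgt Φ)).tgt =
      obj Φ (S.hom a a)) (hy : y.tgt = obj Φ a) :
    ap Φ (act (mapHom Φ (S.j a)) (theta Φ) (theta_tgt Φ)) y h hy = loosenArrow y := by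
  have e := congrArg (fun k : T.unit ⟶ T.hom (obj Φ a) (obj Φ a) => act k T.thetaArrow rfl)
    (Φ.map_j a)
  refine (T.ap_congr ((act_comp _ _ _ _).symm.trans ((act_comp _ _ _ _).symm.trans e)) rfl _
    _).trans (T.ap_j _ _ _)

theorem act_i (x : B.Arrow) (hx : x.tgt = obj Φ (S.hom S.unit a)) :
    act (mapHom Φ (S.i a)) x hx = ap Φ x (theta Φ) hx (theta_tgt Φ) := by
  have e := congrArg (fun k : obj Φ (S.hom S.unit a) ⟶ obj Φ a => act k x hx) (Φ.map_i a)
  refine e.symm.trans ((act_comp _ _ _ _).trans ((act_comp _ _ _ _).trans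
    ((T.act_i _ _).trans (T.ap_pre _ _ _ _ _ _))))

theorem ap_L (x y z : B.Arrow) (hx : x.tgt = obj Φ (S.hom b c))
    (h : (act (mapHom Φ (S.L a b c)) x hx).tgt = obj Φ (S.hom (S.hom a b) (S.hom a c)))
    (hy : y.tgt = obj Φ (S.hom a b))
    (h' : (ap Φ (act (mapHom Φ (S.L a b c)) x hx) y h hy).tgt = obj Φ (S.hom a c))
    (hz : z.tgt = obj Φ a) :
    ap Φ (ap Φ (act (mapHom Φ (S.L a b c)) x hx) y h hy) z h' hz =
      ap Φ x (ap Φ y z hy hz) hx (ap_tgt Φ y z hy hz) := by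
  have e := congrArg (fun k : obj Φ (S.hom b c) ⟶ T.hom (obj Φ (S.hom a b))
    (T.hom (obj Φ a) (obj Φ c)) => act k x hx) (Φ.map_L a b c)
  have e' := (act_comp _ _ _ _).symm.trans ((act_comp _ _ _ _).symm.trans
    (e.trans ((act_comp _ _ _ _).trans (act_comp _ _ _ _))))
  refine (T.ap_congr ((T.ap_post _ _ _ _ (act_tgt _ _ _) _).symm.trans ((T.ap_congr e' rfl _ _).trans
    (T.ap_pre _ _ _ _ _ _))) rfl _ _).trans (T.ap_L _ _ _ _ _ _ _ _)

theorem ap_loosen_left (x y : B.Arrow) (hx : (loosenArrow x).tgt = obj Φ (S.hom b c))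
    (hy : y.tgt = obj Φ b) :
    ap Φ (loosenArrow x) y hx hy =
      loosenArrow (ap Φ x y ((loosenArrow_tgt x).symm.trans hx) hy) :=
  (T.ap_congr (act_loosen _ _ _) rfl _ _).trans (T.ap_loosen_left _ _ _ _)

theorem subst_ap_idArrow (x y : B.Arrow) (hx : x.tgt = obj Φ (S.hom b c)) (xs : List B.Arrow)
    (hxs : x.src = xs.map MultiArrow.tgt)
    (h : (ap Φ x (idArrow (obj Φ b)) hx rfl).src = (xs ++ [y]).map MultiArrow.tgt)
    (hy : y.tgt = obj Φ b) :
    subst (ap Φ x (idArrow (obj Φ b)) hx rfl) (xs ++ [y]) h = ap Φ (subst x xs hxs) y hx hy :=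
  (T.subst_ap_idArrow _ y _ xs ((act_src _ _ _).trans hxs) h hy).trans
    (T.ap_congr (subst_act _ _ _ _ hxs _) rfl _ _)

end ClosedExtension

end SkewMulticat

/-! ### The action of a closed functor on multimaps, by recursion on arity -/

namespace SkewMulticat

open SkewMulticatData Multifunctor

variable {A B : SkewMulticat.{v, u}}

namespace ClosedExtension

open ClosedStructure

variable {S : ClosedStructure A} {T : ClosedStructure B}
  (Φ : SkewCl.ClosedFunctor S.skewCl T.skewCl)

open Classical in
/-- The action on multimaps, with its target. -/
noncomputable def arrWithTgt (x : A.Arrow) : {y : B.Arrow // y.tgt = obj Φ x.tgt} :=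
  if h : Nonempty (S.Nullary x) then
    ⟨act (mapHom Φ h.some.k) (theta Φ) (theta_tgt Φ), act_tgt _ _ _⟩
  else if h' : Nonempty (Unary x) then
    ⟨act (mapHom Φ h'.some.f) (idArrow (obj Φ h'.some.a)) rfl, act_tgt _ _ _⟩
  else
    let p := (S.nonempty_application h h').some
    have := p.length_lt
    ⟨ap Φ (arrWithTgt p.f).1 (idArrow (obj Φ p.b))
      ((arrWithTgt p.f).2.trans (congrArg (obj Φ) p.tgt_eq)) rfl, ap_tgt _ _ _ _ _⟩
termination_by x.src.length

/-- The action on multimaps. -/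
noncomputable def arr (x : A.Arrow) : B.Arrow := (arrWithTgt Φ x).1

@[simp] theorem arr_tgt (x : A.Arrow) : (arr Φ x).tgt = obj Φ x.tgt := (arrWithTgt Φ x).2

variable {a b c : Underlying A}

/-- The first of the three recursion equations for `arr`; uniqueness of presentations replaces the
chosen presentation by the given one. -/
theorem arr_nullary (k : S.unit ⟶ b) :
    arr Φ (act k S.thetaArrow rfl) = act (mapHom Φ k) (theta Φ) (theta_tgt Φ) := by
  have h : Nonempty (S.Nullary (act k S.thetaArrow rfl)) := ⟨⟨k, rfl⟩⟩
  rw [arr, arrWithTgt, dif_pos h, Subsingleton.elim h.some ⟨k, rfl⟩]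
  rfl

theorem arr_unary (f : a ⟶ b) :
    arr Φ (act f (idArrow a) rfl) = act (mapHom Φ f) (idArrow (obj Φ a)) rfl := by
  have h : Nonempty (Unary (act f (idArrow a) rfl)) := ⟨⟨a, f, rfl⟩⟩
  have key : ∀ q : Unary (act f (idArrow a) rfl),
      act (mapHom Φ q.f) (idArrow (obj Φ q.a)) rfl =
        act (mapHom Φ f) (idArrow (obj Φ a)) rfl := fun q => by
    obtain rfl := Subsingleton.elim q ⟨a, f, rfl⟩
    rfl
  rw [arr, arrWithTgt, dif_neg (isEmpty_nullary_of_unary h.some), dif_pos h]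
  exact key _

theorem arr_application (x : A.Arrow) (hx : x.tgt = S.hom b c)
    (h : (arr Φ x).tgt = obj Φ (S.hom b c)) :
    arr Φ (S.ap x (idArrow b) hx rfl) = ap Φ (arr Φ x) (idArrow (obj Φ b)) h rfl := by
  let p : S.Application (S.ap x (idArrow b) hx rfl) := ⟨b, x, hx, rfl⟩
  have key : ∀ (q : S.Application (S.ap x (idArrow b) hx rfl))
      (h' : (arr Φ q.f).tgt = obj Φ (S.hom q.b c)),
      ap Φ (arr Φ q.f) (idArrow (obj Φ q.b)) h' rfl =
        ap Φ (arr Φ x) (idArrow (obj Φ b)) h rfl := fun q _ => by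
    obtain rfl := Subsingleton.elim q p
    rfl
  rw [arr, arrWithTgt, dif_neg (isEmpty_nullary_of_application p),
    dif_neg (isEmpty_unary_of_application p)]
  exact key _ _

theorem arr_idArrow (a : Underlying A) : arr Φ (idArrow a) = idArrow (obj Φ a) := by
  have h := arr_unary Φ (𝟙 a)
  rwa [act_id, mapHom_id, act_id] at h

theorem arr_theta : arr Φ S.thetaArrow = theta Φ := by
  have h := arr_nullary Φ (𝟙 S.unit)
  rwa [act_id, mapHom_id, act_id] at h

/-- Induction on `x` for all `f` at once: in the case of an application, `f` is moved inside as
`[b',f]`, and the induction hypothesis is used for that morphism. -/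
theorem arr_act (f : a ⟶ b) (x : A.Arrow) (hx : x.tgt = a) (h : (arr Φ x).tgt = obj Φ a) :
    arr Φ (act f x hx) = act (mapHom Φ f) (arr Φ x) h := by
  induction x using S.arrow_induction generalizing a b with
  | @nullary b' k =>
    obtain rfl : b' = a := hx
    refine (congrArg (arr Φ) (act_comp k f S.thetaArrow rfl).symm).trans
      ((arr_nullary Φ (k ≫ f)).trans ?_)
    simp only [arr_nullary, mapHom_comp, act_comp]
  | @unary a' b' g =>
    obtain rfl : b' = a := hx
    refine (congrArg (arr Φ) (act_comp g f (idArrow a') rfl).symm).trans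
      ((arr_unary Φ (g ≫ f)).trans ?_)
    simp only [arr_unary, mapHom_comp, act_comp]
  | @application b' c' x hx' ih =>
    obtain rfl : c' = a := hx
    have h' : (arr Φ x).tgt = obj Φ (S.hom b' c') := by rw [arr_tgt, hx']
    refine (congrArg (arr Φ) (S.ap_post f x (idArrow b') hx' (act_tgt _ _ _) rfl).symm).trans ?_
    simp only [arr_application Φ x hx' h']
    rw [arr_application Φ _ _ (by simp), ← ap_post Φ f _ _ _ (act_tgt _ _ _)]
    exact ap_congr (ih _ _ _) rfl _ _

/-- The recursion covers only evaluation at an identity; induction on `y` reduces the general case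
to it. One has `e(x,k(θ)) = i([k,1](x))`, then `e(x,g) = e([g,1](x),1)`, and finally `e(x,e(y,1)) =
e(e(L(x),y),1)`, where the hypothesis is applied to `y` with `L(x)` in place of `x`. -/
theorem arr_ap (x y : A.Arrow) (hx : x.tgt = S.hom b c) (hy : y.tgt = b)
    (h : (arr Φ x).tgt = obj Φ (S.hom b c)) (h' : (arr Φ y).tgt = obj Φ b) :
    arr Φ (S.ap x y hx hy) = ap Φ (arr Φ x) (arr Φ y) h h' := by
  induction y using S.arrow_induction generalizing b c x with
  | @nullary b' k =>
    obtain rfl : b' = b := hy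
    refine (congrArg (arr Φ) ((S.ap_pre k x S.thetaArrow hx (act_tgt _ _ _) rfl).symm.trans
      (S.act_i _ (act_tgt _ _ _)).symm)).trans ?_
    rw [arr_act Φ _ _ _ (by simp), act_i]
    refine (ap_congr (arr_act Φ _ _ _ h) rfl _ _).trans ((ap_pre Φ _ _ _ _ _ _).trans ?_)
    exact ap_congr rfl (arr_nullary Φ k).symm _ _
  | @unary a' b' g =>
    obtain rfl : b' = b := hy
    refine (congrArg (arr Φ) (S.ap_pre g x (idArrow a') hx (act_tgt _ _ _) rfl).symm).trans ?_
    rw [arr_application Φ _ _ (by simp)]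
    refine (ap_congr (arr_act Φ _ _ _ h) rfl _ _).trans ((ap_pre Φ _ _ _ _ _ _).trans ?_)
    exact ap_congr rfl (arr_unary Φ g).symm _ _
  | @application b' c' y hy' ih =>
    obtain rfl : c' = b := hy
    have h'' : (arr Φ y).tgt = obj Φ (S.hom b' c') := by rw [arr_tgt, hy']
    refine (congrArg (arr Φ) (S.ap_L x y (idArrow b') hx (act_tgt _ _ _) hy' (by simp)
      rfl).symm).trans ?_
    rw [arr_application Φ _ _ (by simp)]
    refine (ap_congr ((ih _ _ hy' (by simp) h'').trans (ap_congr (arr_act Φ _ _ _ h) rfl _ _))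
      rfl _ _).trans ((ap_L Φ _ _ _ _ _ _ _ _).trans ?_)
    exact ap_congr rfl (arr_application Φ y hy' h'').symm _ _

theorem arr_type (x : A.Arrow) : (arr Φ x).type = x.type := by
  induction x using S.arrow_induction with
  | nullary k => rw [arr_nullary]; rfl
  | unary f => rw [arr_unary]; rfl
  | application x hx ih => rw [arr_application Φ x hx (by simp [hx])]; exact ih

theorem arr_src (x : A.Arrow) : (arr Φ x).src = x.src.map (obj Φ) := by
  induction x using S.arrow_induction with
  | nullary k => rw [arr_nullary]; simp [theta]
  | unary f => rw [arr_unary]; simp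
  | application x hx ih =>
    rw [arr_application Φ x hx (by simp [hx])]
    refine (T.ap_src _ _ _ _).trans ((congrArg (· ++ _) ((act_src _ _ _).trans ih)).trans ?_)
    simp

theorem arr_loosen (x : A.Arrow) : arr Φ (loosenArrow x) = loosenArrow (arr Φ x) := by
  induction x using S.arrow_induction with
  | nullary k => rw [arr_nullary]; exact arr_nullary Φ k
  | @unary a b f =>
    -- A loosened tight unary multimap is no longer a generator. It is `f` applied to `e(j(θ),1)`,
    -- so the compatibility of `Φ` with `j` determines its image.
    have e : loosenArrow (act f (idArrow a) rfl) =
        act f (S.ap (act (S.j a) S.thetaArrow rfl) (idArrow a) (act_tgt _ _ _) rfl)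
          (S.ap_tgt _ _ _ _) := by
      simp only [S.ap_j, act_loosen]
    have e' : arr Φ (S.ap (act (S.j a) S.thetaArrow rfl) (idArrow a) (act_tgt _ _ _) rfl) =
        loosenArrow (idArrow (obj Φ a)) :=
      (arr_application Φ _ _ (by simp)).trans ((ap_congr (arr_nullary Φ (S.j a)) rfl _ _).trans
        (ap_j Φ _ (act_tgt _ _ _) rfl))
    rw [e, arr_act Φ _ _ _ (by simp), arr_unary]
    simp only [e', act_loosen]
  | application x hx ih =>
    rw [← S.ap_loosen_left _ _ (by simp [hx]), arr_application Φ _ _ (by simp [hx])]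
    rw [arr_application Φ x hx (by simp [hx])]
    exact (ap_congr ih rfl _ _).trans (ap_loosen_left Φ _ _ _ _)

theorem src_eq {g : A.Arrow} {fs : List A.Arrow} (h : g.src = fs.map MultiArrow.tgt) :
    (arr Φ g).src = (fs.map (arr Φ)).map MultiArrow.tgt := by
  rw [arr_src, h, List.map_map, List.map_map]
  exact List.map_congr_left fun f _ => (arr_tgt Φ f).symm

/-- Induction on the outer multimap. Into `k(θ)` nothing is substituted, for a tight unary `g` the
claim is `arr_act`, and for an application it is `arr_ap` together with the induction hypothesis. -/
theorem arr_subst (g : A.Arrow) (fs : List A.Arrow) (h : g.src = fs.map MultiArrow.tgt) :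
    arr Φ (subst g fs h) = subst (arr Φ g) (fs.map (arr Φ)) (src_eq Φ h) := by
  induction g using S.arrow_induction generalizing fs with
  | nullary k =>
    obtain rfl : fs = [] := by simpa using h.symm
    have e : subst (act k S.thetaArrow rfl) [] h = act k S.thetaArrow rfl :=
      (subst_congr rfl (by simp) _ _).trans (A.subst_one _)
    rw [e]
    exact ((subst_congr rfl (by simp [arr_src]) _ _).trans (B.subst_one _)).symm
  | @unary a b f =>
    obtain ⟨x, rfl⟩ : ∃ x, fs = [x] := by
      rw [← List.length_eq_one_iff]
      simpa using (congrArg List.length h).symm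
    have hx : x.tgt = a := by simpa using h.symm
    have h₁ : (arr Φ x).tgt = obj Φ a := by rw [arr_tgt, hx]
    have e : subst (act f (idArrow a) rfl) [x] h = act f x hx :=
      (subst_congr (act_idArrow f) rfl _ _)
    have e' : subst (act (mapHom Φ f) (idArrow (obj Φ a)) rfl) [arr Φ x]
        (by simp [h₁, -arr_tgt]) = act (mapHom Φ f) (arr Φ x) h₁ :=
      (subst_congr (act_idArrow _) rfl _ _)
    rw [e, arr_act Φ f x hx h₁, ← e']
    exact subst_congr (arr_unary Φ f).symm rfl _ _
  | @application b c x hx ih =>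
    -- The last multimap is split off because `e(x,1)` has its new variable at the end.
    obtain ⟨xs, y, rfl⟩ : ∃ xs y, fs = xs ++ [y] := by
      rcases List.eq_nil_or_concat fs with rfl | ⟨xs, y, rfl⟩
      · simp at h
      · exact ⟨xs, y, List.concat_eq_append⟩
    have h₁ : x.src = xs.map MultiArrow.tgt ∧ y.tgt = b := by
      have e := (S.ap_src x (idArrow b) hx rfl).symm.trans h
      rw [List.map_append] at e
      have e' := List.append_inj' e rfl
      exact ⟨e'.1, by simpa using e'.2.symm⟩
    have h₂ : (arr Φ x).tgt = obj Φ (S.hom b c) := by rw [arr_tgt, hx]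
    have h₃ : (arr Φ y).tgt = obj Φ b := by rw [arr_tgt, h₁.2]
    have h₄ : (arr Φ (subst x xs h₁.1)).tgt = obj Φ (S.hom b c) := by simp [hx]
    refine (congrArg (arr Φ) (S.subst_ap_idArrow x y hx xs h₁.1 h h₁.2)).trans
      ((arr_ap Φ _ _ _ _ h₄ h₃).trans ?_)
    have h₅ := (src_eq Φ h₁.1)
    refine (ap_congr (ih xs h₁.1) rfl _ _).trans ?_
    refine (subst_ap_idArrow Φ (arr Φ x) (arr Φ y) h₂ (xs.map (arr Φ)) h₅ ?_ h₃).symm.trans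
      (subst_congr (arr_application Φ x hx h₂).symm (by simp) _ _)
    refine (T.ap_src _ _ _ _).trans ((congrArg (· ++ _) ((act_src _ _ _).trans h₅)).trans ?_)
    simp [h₁.2]

theorem exists_map {x : Tightness} {as : List A.Obj} {b : A.Obj} (f : A.Hom x as b) :
    ∃ g : B.Hom x (as.map (obj Φ)) (obj Φ b), arrow g = arr Φ (arrow f) := by
  have h₁ := arr_type Φ (arrow f)
  have h₂ := arr_src Φ (arrow f)
  have h₃ := arr_tgt Φ (arrow f)
  generalize arr Φ (arrow f) = y at *
  obtain ⟨t, s, d, g⟩ := y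
  obtain rfl : t = x := h₁
  obtain rfl : s = _ := h₂
  obtain rfl : d = _ := h₃
  exact ⟨g, rfl⟩

/-- The morphism of skew multicategories that corresponds to a closed functor. -/
noncomputable def multifunctor : Multifunctor A B where
  obj a := obj Φ a
  map f := (exists_map Φ f).choose
  map_loosen f := arrow_injective ((exists_map Φ _).choose_spec.trans
    ((arr_loosen Φ (arrow f)).trans (congrArg loosenArrow (exists_map Φ f).choose_spec.symm)))
  map_one a := arrow_injective ((exists_map Φ _).choose_spec.trans (arr_idArrow Φ a))
  map_subst g fs h := by
    have e : ∀ f : A.Arrow, MultiArrow.mapArrow (Hom := A.Hom) (Hom' := B.Hom)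
        (fun a => obj Φ a) (fun _ _ _ f => (exists_map Φ f).choose) f = arr Φ f :=
      fun f => (exists_map Φ f.map).choose_spec
    rw [e, arr_subst]
    exact subst_congr (e _).symm (List.map_congr_left fun f _ => (e f).symm) _ _

theorem multifunctor_arr (x : A.Arrow) : (multifunctor Φ).arr x = arr Φ x :=
  (exists_map Φ x.map).choose_spec

theorem closedFunctor_multifunctor : (multifunctor Φ).closedFunctor S T = Φ := by
  refine ClosedFunctor.ext_of_toFunctor (CategoryTheory.Functor.hext (fun _ => rfl) fun a b f => heq_of_eq ?_)
    (fun a b => heq_of_eq ?_) (heq_of_eq ?_)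
  · refine arrow_injective (A := B.toSkewMulticatData) ((multifunctor_arr Φ
      (arrow (A := A.toSkewMulticatData) f)).trans ?_)
    rw [← act_idArrow (A := A) f, arr_unary]
    exact act_idArrow _
  · refine ClosedStructure.hom_ext₁ ?_
    have h := (multifunctor Φ).ap_homComp S T (idArrow (S.hom a b)) (idArrow a) rfl rfl rfl rfl rfl
    simp only [Multifunctor.arr_idArrow] at h
    refine h.trans ((multifunctor_arr Φ _).trans ((arr_ap Φ _ _ _ _ (by simp) (by simp)).trans ?_))
    exact ap_congr (arr_idArrow Φ _) (arr_idArrow Φ _) _ _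
  · exact T.unit_hom_ext (((multifunctor Φ).unitComp_theta S T rfl).trans
      ((multifunctor_arr Φ _).trans (arr_theta Φ)))

end ClosedExtension

end SkewMulticat

namespace SkewMulticat

open SkewMulticatData Multifunctor

variable {A B : SkewMulticat.{v, u}}

/-! ### The 2-functor is bijective on 1-cells and 2-cells -/

namespace Multifunctor

/-- A morphism of skew multicategories satisfies the three recursion equations of its own closed
functor, so it can be recovered from that functor. This gives injectivity on 1-cells. -/
theorem arr_eq (F : Multifunctor A B) (S : ClosedStructure A) (T : ClosedStructure B)
    (x : A.Arrow) : F.arr x = ClosedExtension.arr (F.closedFunctor S T) x := by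
  induction x using S.arrow_induction with
  | nullary k =>
    rw [F.arr_act, ClosedExtension.arr_nullary]
    simp only [← F.unitComp_theta S T rfl]
    rfl
  | unary f =>
    rw [F.arr_act, ClosedExtension.arr_unary]
    simp only [F.arr_idArrow]
    rfl
  | @application b c x hx ih =>
    rw [ClosedExtension.arr_application _ x hx (by rw [ClosedExtension.arr_tgt, hx])]
    refine (F.ap_homComp S T x (idArrow b) hx rfl (congrArg F.obj hx) rfl rfl).symm.trans ?_
    simp only [F.arr_idArrow]
    exact ClosedExtension.ap_congr (Φ := F.closedFunctor S T) ih rfl _ rfl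

theorem closedFunctor_injective (S : ClosedStructure A) (T : ClosedStructure B)
    {F G : Multifunctor A B} (h : F.closedFunctor S T = G.closedFunctor S T) : F = G :=
  Multifunctor.ext
    (fun a => congrArg (fun Φ : SkewCl.ClosedFunctor S.skewCl T.skewCl => Φ.obj a) h)
    fun x => by rw [F.arr_eq S T, G.arr_eq S T, h]

theorem closedFunctor_bijective (S : ClosedStructure A) (T : ClosedStructure B) :
    Function.Bijective fun F : Multifunctor A B => F.closedFunctor S T :=
  ⟨fun _ _ h => closedFunctor_injective S T h,
    fun Φ => ⟨ClosedExtension.multifunctor Φ, ClosedExtension.closedFunctor_multifunctor Φ⟩⟩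

end Multifunctor

theorem act_congr {a b : Underlying A} (f : a ⟶ b) {x y : A.Arrow} (h : x = y) (hx : x.tgt = a) :
    act f x hx = act f y (h ▸ hx) := by
  subst h; rfl

section ClosedTrans

open ClosedStructure

variable {S : ClosedStructure A} {T : ClosedStructure B} {F G : Multifunctor A B}
  (α : SkewCl.ClosedTrans (F.closedFunctor S T) (G.closedFunctor S T))

/-- The components of a closed transformation. -/
def closedTransApp (a : Underlying A) : (F.obj a : Underlying B) ⟶ G.obj a := α.app a

theorem closedTransApp_naturality {a b : Underlying A} (f : a ⟶ b) :
    F.mapHom f ≫ closedTransApp α b = closedTransApp α a ≫ G.mapHom f := α.naturality f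

theorem closedTransApp_unit : F.unitComp S T ≫ closedTransApp α S.unit = G.unitComp S T :=
  α.app_unit

theorem closedTransApp_hom (a b : Underlying A) :
    F.homComp S T a b ≫ T.post (F.obj a) (closedTransApp α b) =
      closedTransApp α (S.hom a b) ≫ G.homComp S T a b ≫ T.pre (closedTransApp α a) (G.obj b) :=
  α.app_hom a b

theorem act_closedTransApp_mapHom {a b : Underlying A} (f : a ⟶ b) (y : B.Arrow)
    (hy : y.tgt = F.obj a) (h : (act (F.mapHom f) y hy).tgt = F.obj b) :
    act (closedTransApp α b) (act (F.mapHom f) y hy) h =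
      act (G.mapHom f) (act (closedTransApp α a) y hy) (act_tgt _ _ _) :=
  (act_comp _ _ _ _).symm.trans ((congrArg (fun k => act k y hy)
    (closedTransApp_naturality α f)).trans (act_comp _ _ _ _))

theorem act_closedTransApp_unit (h : (F.arr S.thetaArrow).tgt = F.obj S.unit) :
    act (closedTransApp α S.unit) (F.arr S.thetaArrow) h = G.arr S.thetaArrow := by
  have e := congrArg (fun k => act k T.thetaArrow rfl) (closedTransApp_unit α)
  simp only [act_comp, unitComp_theta] at e
  exact e

theorem act_closedTransApp_ap {b c : Underlying A} (x y : B.Arrow)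
    (hx : x.tgt = F.obj (S.hom b c)) (hx' : (act (F.homComp S T b c) x hx).tgt =
      T.hom (F.obj b) (F.obj c)) (hy : y.tgt = F.obj b)
    (h : (T.ap (act (F.homComp S T b c) x hx) y hx' hy).tgt = F.obj c) :
    act (closedTransApp α c) (T.ap (act (F.homComp S T b c) x hx) y hx' hy) h =
      T.ap (act (G.homComp S T b c) (act (closedTransApp α (S.hom b c)) x hx) (act_tgt _ _ _))
        (act (closedTransApp α b) y hy) (act_tgt _ _ _) (act_tgt _ _ _) := by
  have e := congrArg (fun k => T.ap (act k x hx) y (act_tgt _ _ _) hy) (closedTransApp_hom α b c)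
  simp only [act_comp, ap_post, ap_pre] at e
  exact e

theorem src_eq_map_closedTransApp (x : A.Arrow) : (G.arr x).src =
    (x.src.map fun a => act (closedTransApp α a) (idArrow (F.obj a)) rfl).map MultiArrow.tgt := by
  rw [arr_src, List.map_map]
  exact List.map_congr_left fun a _ => rfl

/-- Naturality at all multimaps follows from the generators: the unit axiom handles `θ`, ordinary
naturality the tight unary multimaps, and compatibility with the comparisons the passage from `x` to
`e(x,1)`. -/
theorem act_closedTransApp (x : A.Arrow) {a : Underlying A} (hx : x.tgt = a)
    (h : (F.arr x).tgt = F.obj a) :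
    act (closedTransApp α a) (F.arr x) h =
      subst (G.arr x) (x.src.map fun a => act (closedTransApp α a) (idArrow (F.obj a)) rfl)
        (src_eq_map_closedTransApp α x) := by
  induction x using S.arrow_induction generalizing a with
  | @nullary b k =>
    obtain rfl : b = a := hx
    have e : act (closedTransApp α b) (F.arr (act k S.thetaArrow rfl)) h =
        G.arr (act k S.thetaArrow rfl) := by
      simp only [F.arr_act, G.arr_act]
      refine (act_closedTransApp_mapHom α k (F.arr S.thetaArrow) rfl rfl).trans ?_
      exact act_congr _ (act_closedTransApp_unit α rfl) _
    refine e.trans ((subst_congr rfl ?_ _ ?_).trans (B.subst_one _)).symm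
    · simp
    · simp
  | @unary b c f =>
    obtain rfl : c = a := hx
    have e : act (closedTransApp α c) (F.arr (act f (idArrow b) rfl)) h =
        act (G.mapHom f) (act (closedTransApp α b) (idArrow (F.obj b)) rfl) (act_tgt _ _ _) := by
      simp only [F.arr_act, F.arr_idArrow, act_closedTransApp_mapHom]
    refine e.trans (subst_congr ?_ ?_ rfl _)
    · simp only [G.arr_act, G.arr_idArrow]
      exact (act_idArrow _).symm
    · simp
  | @application b c x hx' ih =>
    obtain rfl : c = a := hx
    have h₁ : (F.arr x).tgt = F.obj (S.hom b c) := congrArg F.obj hx'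
    have h₂ : (G.arr x).tgt = G.obj (S.hom b c) := congrArg G.obj hx'
    have e : act (closedTransApp α c) (F.arr (S.ap x (idArrow b) hx' rfl)) h =
        T.ap (act (G.homComp S T b c) (act (closedTransApp α (S.hom b c)) (F.arr x) h₁)
          (act_tgt _ _ _)) (act (closedTransApp α b) (idArrow (F.obj b)) rfl) (act_tgt _ _ _)
          (act_tgt _ _ _) := by
      rw [← act_closedTransApp_ap α (F.arr x) (idArrow (F.obj b)) h₁ (act_tgt _ _ _) rfl
        (T.ap_tgt _ _ _ _)]
      simp only [← F.arr_idArrow, F.ap_homComp S T x (idArrow b) hx' rfl h₁ (act_tgt _ _ _)]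
    have e' : G.arr (S.ap x (idArrow b) hx' rfl) =
        T.ap (act (G.homComp S T b c) (G.arr x) h₂) (idArrow (G.obj b)) (act_tgt _ _ _) rfl := by
      rw [← G.ap_homComp S T x (idArrow b) hx' rfl h₂ (act_tgt _ _ _) rfl]
      simp only [G.arr_idArrow]
    have hs := src_eq_map_closedTransApp α x
    refine e.trans (Eq.trans ?_ ((T.subst_ap_idArrow (act (G.homComp S T b c) (G.arr x) h₂)
      (act (closedTransApp α b) (idArrow (F.obj b)) rfl) (act_tgt _ _ _) _
      ((act_src _ _ _).trans hs) ?_ (act_tgt _ _ _)).symm.trans (subst_congr e'.symm ?_ _ _)))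
    · refine T.ap_congr ?_ rfl _ _
      refine Eq.trans ?_ (subst_act _ _ _ _ hs _).symm
      simp only [ih hx' h₁]
    · refine (T.ap_src _ _ _ _).trans ((congrArg (· ++ _) ((act_src _ _ _).trans hs)).trans ?_)
      simp
    · simp

/-- The 2-cell of skew multicategories that corresponds to a closed transformation. -/
def ofClosedTrans : MultiTrans F G where
  app a := closedTransApp α a
  naturality x := by
    refine (act_closedTransApp α x rfl rfl).trans (subst_congr rfl ?_ _ _)
    exact List.map_congr_left fun a _ => act_idArrow _

end ClosedTrans

theorem MultiTrans.closedTrans_bijective (S : ClosedStructure A) (T : ClosedStructure B)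
    (F G : Multifunctor A B) :
    Function.Bijective fun φ : MultiTrans F G => φ.closedTrans S T :=
  ⟨fun _ _ h => MultiTrans.ext fun a => congrArg arrow (congrArg (fun α :
    SkewCl.ClosedTrans (F.closedFunctor S T) (G.closedFunctor S T) => α.app a) h),
    fun α => ⟨ofClosedTrans α, SkewCl.ClosedTrans.ext fun _ => rfl⟩⟩

theorem toSkewCl_map_bijective (A B : ClosedSkewMulticatWithUnit.{v, u}) :
    Function.Bijective fun F : A ⟶ B => toSkewCl.map F := by
  refine ⟨fun F G h => InducedBicategory.hom_ext (closedFunctor_injective _ _ h), fun Φ => ?_⟩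
  obtain ⟨F, hF⟩ := (closedFunctor_bijective (chosen A) (chosen B)).2 Φ
  exact ⟨InducedBicategory.mkHom F, hF⟩

theorem toSkewCl_map₂_bijective {A B : ClosedSkewMulticatWithUnit.{v, u}} (F G : A ⟶ B) :
    Function.Bijective fun φ : F ⟶ G => toSkewCl.map₂ φ := by
  have h := MultiTrans.closedTrans_bijective (chosen A) (chosen B) F.hom G.hom
  refine ⟨fun φ ψ e => InducedBicategory.hom₂_ext (h.1 e), fun α => ?_⟩
  obtain ⟨φ, hφ⟩ := h.2 α
  exact ⟨⟨φ⟩, hφ⟩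

end SkewMulticat

namespace SkewCl

open SkewClosed InternalHom SkewMulticatData SkewMulticat

variable {C : SkewCl.{v, u}}

/-! ### The closed structure of the skew multicategory of a skew closed category -/

/-- The curried multimap `[b,c] ⟶ [b,c]`. -/
@[reducible] def Curried.ev (b c : C) : Curried C := ⟨hom b c, [b], c, 𝟙 _⟩

theorem Curried.comp_ev_injective {d : C} {s : List C} {b c : C} {f g : d ⟶ ihoms s (hom b c)}
    (h : (Curried.mk d s _ f).comp (.ev b c) rfl = (Curried.mk d s _ g).comp (.ev b c) rfl) :
    f = g := by
  have h' := eq_of_heq (Curried.mk.inj h).2.2.2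
  simpa [cancel_mono] using h'

theorem Curried.eq_comp_ev {d : C} {s : List C} {b c : C} (f : d ⟶ ihoms (s ++ [b]) c) :
    (Curried.mk d s (hom b c) (f ≫ eqToHom (ihoms_append s [b] c))).comp (.ev b c) rfl =
      ⟨d, s ++ [b], c, f⟩ :=
  Curried.ext rfl rfl rfl (by simp)

theorem toCurried_substFirst {b c : C} (f : (multicatData C).Arrow) (hf : f.tgt = hom b c) :
    toCurried (subst (A := multicatData C) ⟨.tight, [hom b c, b], c, (𝟙 _ : hom b c ⟶ hom b c)⟩
      [f, idArrow b] (by simp [hf])) =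
      (toCurried f).comp (.ev b c) ((toCurried_tgt f).trans hf) := by
  refine (toCurried_subst_tight (b := hom b c) (bs := [b]) (c := c) (𝟙 _) f [idArrow b]
    (by simp [hf])).trans ?_
  exact Curried.comp_congr rfl ((Curried.act_congr rfl (toTranss_one [b]) _).trans
    (Curried.act_id _ _ rfl)) _

theorem toCurried_subst_unary {a b : C} (f : a ⟶ b) (x : (multicatData C).Arrow) (hx : x.tgt = a) :
    toCurried (subst (A := multicatData C) ⟨.tight, [a], b, f⟩ [x] (by simp [hx])) =
      (toCurried x).comp ⟨a, [], b, f⟩ ((toCurried_tgt x).trans hx) :=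
  (toCurried_subst_tight (b := a) (bs := []) (c := b) f x [] (by simp [hx])).trans
    (Curried.comp_congr rfl (Curried.act_id _ [] rfl) _)

/-- With the identity of `[b,c]` as evaluation, `e(f,1)` is `f` followed by the equality of objects
`ihoms_append`, which is invertible. -/
theorem bijective_substFirst (b c : C) (x : Tightness) (as : List C)
    (hx : as = [] → x = .loose) :
    Function.Bijective (SkewMulticat.substFirst (multicat C) (h := hom b c) (b := b) (c := c)
      (𝟙 (hom b c)) x as) := by
  refine ⟨fun f g h => ?_, fun f => ?_⟩
  · have h' := (toCurried_substFirst (C := C) (arrow f) rfl).symm.trans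
      ((congrArg (fun k => toCurried (C := C) (arrow (A := multicatData C) k)) h).trans
        (toCurried_substFirst (arrow g) rfl))
    match x, as, f, g with
    | .tight, [], f, _ => exact nomatch (f : PEmpty)
    | .tight, a :: as, f, g => exact Curried.comp_ev_injective h'
    | .loose, as, f, g => exact Curried.comp_ev_injective h'
  · match x, as, f with
    | .tight, [], f => exact nomatch hx rfl
    | .tight, a :: as, f =>
      let g : a ⟶ ihoms as (hom b c) := (show a ⟶ _ from f) ≫ eqToHom (ihoms_append as [b] c)
      exact ⟨g, Multifunctor.arrow_injective (A := multicatData C) (toCurried_injective rfl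
        ((toCurried_substFirst (C := C) ⟨.tight, a :: as, hom b c, g⟩ rfl).trans
          (Curried.eq_comp_ev (show a ⟶ _ from f))))⟩
    | .loose, as, f =>
      let g : unit ⟶ ihoms as (hom b c) := (show unit ⟶ _ from f) ≫ eqToHom (ihoms_append as [b] c)
      exact ⟨g, Multifunctor.arrow_injective (A := multicatData C) (toCurried_injective rfl
        ((toCurried_substFirst (C := C) ⟨.loose, as, hom b c, g⟩ rfl).trans
          (Curried.eq_comp_ev (show unit ⟶ _ from f))))⟩

/-- Tight multimaps `I ⟶ b` and nullary multimaps with target `b` are the same morphisms of `C`.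
With the identity of `I` as `θ`, the function in question is the identity. -/
theorem bijective_substNullary (b : C) :
    Function.Bijective (SkewMulticat.substNullary (multicat C) (i := (unit : C)) (𝟙 (unit : C)) b) := by
  have h : SkewMulticat.substNullary (multicat C) (i := (unit : C)) (𝟙 (unit : C)) b = fun f => f := by
    funext f
    exact Multifunctor.arrow_injective (A := multicatData C) (toCurried_injective rfl
        ((toCurried_subst_unary (show unit ⟶ b from f) ⟨.loose, [], unit, 𝟙 _⟩ rfl).trans
          (Curried.one_comp (Curried.mk unit [] b (show unit ⟶ b from f)) rfl)))
  rw [h]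
  exact Function.bijective_id

variable (C) in
/-- The closed structure on the skew multicategory of a skew closed category. -/
def closedStructure : ClosedStructure (multicat C) where
  hom b c := hom (C := C) b c
  ev b c := (𝟙 _ : hom (C := C) b c ⟶ hom b c)
  bijective_ev b c x as h := bijective_substFirst b c x as h
  unit := unit (C := C)
  theta := (𝟙 _ : unit (C := C) ⟶ unit)
  bijective_theta b := bijective_substNullary b

/-- A tight unary multimap, as a morphism. -/
def toHom {a b : Underlying (multicat C)} (f : a ⟶ b) : (show C from a) ⟶ (show C from b) := f

/-- A multimap of the skew multicategory of a skew closed category, as a curried multimap. -/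
def curried (x : (multicat C).Arrow) : Curried C := toCurried x

theorem curried_injective {x y : (multicat C).Arrow} (h : x.type = y.type)
    (h' : curried x = curried y) : x = y := toCurried_injective h h'

theorem curried_tgt (x : (multicat C).Arrow) : (curried x).tgt = x.tgt := toCurried_tgt x

theorem curried_act {a b : Underlying (multicat C)} (f : a ⟶ b) (x : (multicat C).Arrow)
    (hx : x.tgt = a) :
    curried (act f x hx) = (curried x).comp ⟨a, [], b, toHom f⟩ ((curried_tgt x).trans hx) :=
  toCurried_subst_unary _ x hx

theorem curried_ap_idArrow {b c : Underlying (multicat C)} (x : (multicat C).Arrow)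
    (hx : x.tgt = (closedStructure C).hom b c) :
    curried ((closedStructure C).ap x (idArrow b) hx rfl) =
      (curried x).comp (.ev b c) ((curried_tgt x).trans hx) :=
  toCurried_substFirst (b := b) (c := c) x hx

theorem curried_ap {b c : Underlying (multicat C)} (x y : (multicat C).Arrow)
    (hx : x.tgt = (closedStructure C).hom b c) (hy : y.tgt = b) :
    curried ((closedStructure C).ap x y hx hy) =
      (curried x).comp ((Curried.ev b c).act (toTrans y)
        ((congrArg (fun a => [a]) hy.symm).trans (toTrans_src y).symm))
        ((curried_tgt x).trans hx) :=
  (toCurried_subst_tight (b := hom (C := C) b c) (bs := [b]) (c := c) (𝟙 _) x [y]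
    (congrArg₂ (fun s t => [s, t]) hx hy).symm).trans (Curried.comp_congr rfl (Curried.act_congr rfl
      (toTranss_singleton y) _) _)

end SkewCl

/-! ### Recovering a skew closed category from its skew multicategory -/

namespace SkewCl

open SkewClosed InternalHom SkewMulticatData SkewMulticat

variable {C : SkewCl.{v, u}}

theorem Curried.mor_injective {d : C} {s : List C} {t : C} {f g : d ⟶ ihoms s t}
    (h : Curried.mk d s t f = Curried.mk d s t g) : f = g :=
  eq_of_heq (Curried.mk.inj h).2.2.2

theorem Curried.comp_unary {a b c : C} (f : a ⟶ b) (g : b ⟶ c) :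
    (Curried.mk a [] b f).comp ⟨b, [], c, g⟩ rfl = ⟨a, [], c, f ≫ g⟩ :=
  Curried.ext rfl rfl rfl (by simp)

theorem Curried.ev_comp_unary {b c d : C} (f : c ⟶ d) :
    (Curried.ev b c).comp ⟨c, [], d, f⟩ rfl = ⟨hom b c, [b], d, post b f⟩ :=
  Curried.ext rfl rfl rfl (by simp)

theorem Curried.comp_ev {b c d : C} (f : d ⟶ hom b c) :
    (Curried.mk d [] (hom b c) f).comp (.ev b c) rfl = ⟨d, [b], c, f⟩ :=
  Curried.ext rfl rfl rfl (by simp)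

theorem Curried.comp_comp_ev {a b c d : C} (f : d ⟶ hom a (hom b c)) :
    (Curried.mk d [a] (hom b c) f).comp (.ev b c) rfl = ⟨d, [a, b], c, f⟩ :=
  Curried.ext rfl rfl rfl (by simp)

/-- In this lemma and the next two, the transformations of a unary multimap, of the evaluation and
of `θ` act on an evaluation to give back precomposition, `L` and `i`. This is how the original
structure reappears. -/
theorem Curried.ev_act_unary {a b : C} (f : a ⟶ b) (c : C) :
    (Curried.ev b c).act (Curried.mk a [] b f).tightTrans rfl = ⟨hom b c, [a], c, pre f c⟩ :=
  Curried.ext rfl rfl rfl (by simp)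

theorem Curried.ev_act_ev (a b c : C) :
    (Curried.ev b c).act (Curried.ev a b).tightTrans rfl =
      ⟨hom b c, [hom a b, a], c, L a b c⟩ :=
  Curried.ext rfl rfl rfl (by simp)

theorem Curried.ev_act_unit (a : C) :
    (Curried.ev unit a).act ((Curried.mk unit [] unit (𝟙 unit)).looseTrans rfl) rfl =
      ⟨hom unit a, [], a, i a⟩ :=
  Curried.ext rfl rfl rfl (by simp)

theorem Curried.mk_j (a : C) :
    Curried.mk unit [a] a (j a ≫ post a (𝟙 a)) = ⟨unit, [a], a, j a⟩ :=
  Curried.ext rfl rfl rfl (by simp)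

section

variable {a b c d : Underlying (multicat C)}

theorem curried_arrow (f : a ⟶ b) : curried (act f (idArrow a) rfl) = ⟨a, [], b, toHom f⟩ :=
  (curried_act f (idArrow a) rfl).trans (Curried.one_comp ⟨a, [], b, toHom f⟩ rfl)

theorem toHom_eq_of_curried {f : a ⟶ b} {g : (show C from a) ⟶ (show C from b)}
    (h : curried (act f (idArrow a) rfl) = ⟨a, [], b, g⟩) : toHom f = g :=
  Curried.mor_injective ((curried_arrow f).symm.trans h)

theorem toHom_comp (f : a ⟶ b) (g : b ⟶ c) : toHom (f ≫ g) = toHom f ≫ toHom g :=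
  toHom_eq_of_curried ((congrArg curried (act_comp f g (idArrow a) rfl)).trans
    ((curried_act _ _ _).trans ((Curried.comp_congr (curried_arrow f) rfl _).trans
      (Curried.comp_unary (toHom f) (toHom g)))))

theorem curried_ap_arrow (f : d ⟶ (closedStructure C).hom b c) :
    curried ((closedStructure C).ap (act f (idArrow d) rfl) (idArrow b) (act_tgt _ _ _) rfl) =
      ⟨d, [b], c, toHom f⟩ :=
  (curried_ap_idArrow _ _).trans ((Curried.comp_congr (curried_arrow f) rfl _).trans
    (Curried.comp_ev (toHom f)))

theorem toHom_eq_of_curried₁ {f : d ⟶ (closedStructure C).hom b c}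
    {g : (show C from d) ⟶ hom (show C from b) c}
    (h : curried ((closedStructure C).ap (act f (idArrow d) rfl) (idArrow b) (act_tgt _ _ _) rfl) =
      ⟨d, [b], c, g⟩) : toHom f = g :=
  Curried.mor_injective (s := [show C from b]) (t := c) ((curried_ap_arrow f).symm.trans h)

theorem curried_ev (b c : Underlying (multicat C)) :
    curried ((closedStructure C).ap (c := c) (idArrow ((closedStructure C).hom b c)) (idArrow b)
      rfl rfl) = .ev b c :=
  (curried_ap_idArrow (b := b) (c := c) _ _).trans (Curried.one_comp (.ev b c) rfl)

theorem curried_idArrow_ap (y : (multicat C).Arrow) (hy : y.tgt = b)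
    (h : (Curried.ev (C := C) b c).src = (toTrans y).src) :
    curried ((closedStructure C).ap (c := c) (idArrow ((closedStructure C).hom b c)) y
      rfl hy) = (Curried.ev (C := C) b c).act (toTrans y) h :=
  (curried_ap (b := b) (c := c) _ _ _ _).trans
    (Curried.one_comp ((Curried.ev (C := C) b c).act (toTrans y) h) rfl)

/-- Here and below, a reconstructed structure morphism is identified by its evaluation on generic
elements: the rule in `multicat C` computes that evaluation, and its curried form is the one given
by the original morphism. -/
theorem toHom_post (b : Underlying (multicat C)) (f : c ⟶ d) :
    toHom ((closedStructure C).post b f) = post (C := C) b (toHom f) :=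
  toHom_eq_of_curried₁ ((congrArg curried ((closedStructure C).ap_post f (idArrow _) (idArrow b)
    rfl (act_tgt _ _ _) rfl)).trans ((curried_act _ _ _).trans
      ((Curried.comp_congr (curried_ev b c) rfl _).trans (Curried.ev_comp_unary (toHom f)))))

theorem toHom_pre (f : a ⟶ b) (c : Underlying (multicat C)) :
    toHom ((closedStructure C).pre f c) = pre (C := C) (toHom f) c :=
  toHom_eq_of_curried₁ ((congrArg curried ((closedStructure C).ap_pre f (idArrow _) (idArrow a)
    rfl (act_tgt _ _ _) rfl)).trans ((curried_idArrow_ap _ _ (toTrans_src _).symm).trans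
      ((Curried.act_congr rfl (congrArg toTrans (act_idArrow f)) _).trans
        (Curried.ev_act_unary (toHom f) c))))

theorem toHom_i (a : Underlying (multicat C)) :
    toHom ((closedStructure C).i a) = i (show C from a) :=
  toHom_eq_of_curried ((congrArg curried ((closedStructure C).act_i (idArrow _) rfl)).trans
    ((curried_idArrow_ap (b := (closedStructure C).unit) (c := a) (closedStructure C).thetaArrow
      rfl rfl).trans (Curried.ev_act_unit (show C from a))))

theorem toHom_L (a b c : Underlying (multicat C)) :
    toHom ((closedStructure C).L a b c) = L (show C from a) b c := by
  let S := closedStructure C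
  have h₁ : curried (S.ap (S.ap (act (S.L a b c) (idArrow _) rfl) (idArrow (S.hom a b))
      (act_tgt _ _ _) rfl) (idArrow a) (S.ap_tgt _ _ _ _) rfl) =
      ⟨hom (C := C) b c, [hom (C := C) a b, a], c, toHom ((closedStructure C).L a b c)⟩ :=
    (curried_ap_idArrow _ _).trans ((Curried.comp_congr (curried_ap_arrow (S.L a b c)) rfl _).trans
      (Curried.comp_comp_ev (toHom (S.L a b c))))
  have h₂ : S.ap (idArrow (S.hom a b)) (idArrow a) rfl rfl = S.evArrow a b :=
    curried_injective rfl (curried_ev a b)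
  exact Curried.mor_injective (s := [hom (C := C) a b, a]) (t := c) (h₁.symm.trans
    ((congrArg curried (S.ap_L (idArrow _) (idArrow (S.hom a b)) (idArrow a) rfl (act_tgt _ _ _)
      rfl (S.ap_tgt _ _ _ _) rfl)).trans ((curried_idArrow_ap _ _ (toTrans_src _).symm).trans
      ((Curried.act_congr rfl (congrArg toTrans h₂) _).trans
        (Curried.ev_act_ev (show C from a) b c)))))

theorem toHom_j (a : Underlying (multicat C)) :
    toHom ((closedStructure C).j a) = j (show C from a) := by
  let S := closedStructure C
  have h₁ : curried (S.ap (act (S.j a) S.thetaArrow rfl) (idArrow a) (act_tgt _ _ _) rfl) =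
      ⟨unit (C := C), [a], a, toHom (S.j a)⟩ :=
    (curried_ap_idArrow _ _).trans ((Curried.comp_congr ((curried_act _ _ _).trans
      (Curried.one_comp ⟨unit (C := C), [], _, toHom (S.j a)⟩ rfl)) rfl _).trans
      (Curried.comp_ev (toHom (S.j a))))
  exact Curried.mor_injective (s := [show C from a]) (t := a) (h₁.symm.trans
    ((congrArg curried (S.ap_j (idArrow a) (act_tgt _ _ _) rfl)).trans
      (Curried.mk_j (show C from a))))

end

theorem id_comp_pre_id_comp_i (a : C) : 𝟙 (hom unit a) ≫ pre (𝟙 unit) a ≫ i a = i a := by simp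

theorem L_comp_post_id (a b c : C) :
    L a b c ≫ 𝟙 _ ≫ post (hom a b) (𝟙 (hom a c)) = 𝟙 _ ≫ L a b c ≫ pre (𝟙 (hom a b)) (hom a c) := by
  simp

variable (C) in
/-- The identity, as a closed functor from the skew closed category of tight unary multimaps. -/
noncomputable def ofMulticat : ClosedFunctor (closedStructure C).skewCl C where
  obj a := a
  map f := toHom f
  map_id _ := rfl
  map_comp f g := toHom_comp f g
  homComp a b := 𝟙 (hom (C := C) a b)
  unitComp := 𝟙 (unit (C := C))
  homComp_natural_right a b b' f := by
    refine (Category.comp_id _).trans ((toHom_post a f).trans (Category.id_comp _).symm)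
  homComp_natural_left f b := by
    refine (Category.comp_id _).trans ((toHom_pre f b).trans (Category.id_comp _).symm)
  map_j a := (Category.id_comp _).trans ((Category.comp_id _).trans (toHom_j a))
  map_i a := by
    exact (id_comp_pre_id_comp_i (C := C) a).trans (toHom_i a).symm
  map_L a b c := by
    exact (congrArg (fun k : hom (C := C) b c ⟶ hom (hom a b) (hom a c) =>
      k ≫ 𝟙 _ ≫ post _ (𝟙 _)) (toHom_L a b c)).trans (L_comp_post_id (C := C) a b c)

variable (C) in
/-- The identity, as a closed functor to the skew closed category of tight unary multimaps. -/
noncomputable def toMulticat : ClosedFunctor C (closedStructure C).skewCl where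
  obj a := a
  map f := f
  map_id _ := rfl
  map_comp f g := (toHom_comp (C := C) f g).symm
  homComp a b := 𝟙 ((closedStructure C).hom a b)
  unitComp := 𝟙 (closedStructure C).unit
  homComp_natural_right a b b' f := by
    refine (Category.comp_id _).trans (Eq.trans ?_ (Category.id_comp _).symm)
    exact (toHom_post (C := C) a f).symm
  homComp_natural_left f b := by
    refine (Category.comp_id _).trans (Eq.trans ?_ (Category.id_comp _).symm)
    exact (toHom_pre (C := C) f b).symm
  map_j a := (Category.id_comp _).trans ((Category.comp_id _).trans (toHom_j (C := C) a).symm)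
  map_i a := (Category.id_comp _).trans ((congrArg (· ≫ (closedStructure C).i a)
    ((closedStructure C).pre_id _ a)).trans ((Category.id_comp _).trans (toHom_i (C := C) a)))
  map_L a b c := by
    let S := closedStructure C
    have h₁ : S.post (S.hom a b) (𝟙 (S.hom a c)) = 𝟙 _ := S.post_id _ _
    have h₂ : S.pre (𝟙 (S.hom a b)) (S.hom a c) = 𝟙 _ := S.pre_id _ _
    refine Eq.trans ?_ (Category.id_comp _).symm
    refine (congrArg (_ ≫ ·) (Category.id_comp _)).trans ?_
    refine (congrArg (_ ≫ ·) h₁).trans (Eq.trans ?_ (congrArg (_ ≫ ·) h₂).symm)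
    refine (Category.comp_id _).trans (Eq.trans ?_ (Category.comp_id _).symm)
    exact (toHom_L (C := C) a b c).symm

theorem ofMulticat_toMulticat : (ofMulticat C).comp (toMulticat C) = .id _ :=
  SkewMulticat.ClosedFunctor.ext_of_toFunctor
    (CategoryTheory.Functor.hext (fun _ => rfl) fun _ _ _ => HEq.rfl)
    (fun a b => heq_of_eq (Category.id_comp (𝟙 ((closedStructure C).hom a b))))
    (heq_of_eq (Category.id_comp (𝟙 (closedStructure C).unit)))

theorem toMulticat_ofMulticat : (toMulticat C).comp (ofMulticat C) = .id _ :=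
  SkewMulticat.ClosedFunctor.ext_of_toFunctor
    (CategoryTheory.Functor.hext (fun _ => rfl) fun _ _ _ => HEq.rfl)
    (fun a b => heq_of_eq (Category.id_comp (𝟙 (hom (C := C) a b))))
    (heq_of_eq (Category.id_comp (𝟙 (unit (C := C)))))

end SkewCl

/-! ### Change of closed structure, and essential surjectivity -/

namespace SkewMulticat

theorem ClosedStructure.isClosed {A : SkewMulticat.{v, u}} (S : ClosedStructure A) : A.IsClosed :=
  fun b c => ⟨S.hom b c, S.ev b c, S.bijective_ev b c⟩

theorem ClosedStructure.hasUnit {A : SkewMulticat.{v, u}} (S : ClosedStructure A) : A.HasUnit :=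
  ⟨S.unit, S.theta, S.bijective_theta⟩

/-- The identity functor between the skew closed categories of two closed structures. -/
noncomputable def ClosedStructure.change {A : SkewMulticat.{v, u}} (S T : ClosedStructure A) :
    S.skewCl ⟶ T.skewCl :=
  (Multifunctor.id A).closedFunctor S T

theorem ClosedStructure.change_comp {A : SkewMulticat.{v, u}} (S T : ClosedStructure A) :
    S.change T ≫ T.change S = 𝟙 S.skewCl :=
  (Multifunctor.closedFunctor_comp (Multifunctor.id A) (Multifunctor.id A) S T S).symm.trans
    ((congrArg (fun F => Multifunctor.closedFunctor F S S)
      (SkewMulticat.id_comp' (𝟙 A))).trans (Multifunctor.closedFunctor_id S))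

theorem toSkewCl_essSurj (C : SkewCl.{v, u}) :
    ∃ (A : ClosedSkewMulticatWithUnit.{v, u}) (e : toSkewCl.obj A ⟶ C) (e' : C ⟶ toSkewCl.obj A),
      e ≫ e' = 𝟙 _ ∧ e' ≫ e = 𝟙 C := by
  let S := SkewCl.closedStructure C
  let A : ClosedSkewMulticatWithUnit.{v, u} := ⟨C.multicat, S.isClosed, S.hasUnit⟩
  -- `toSkewCl` is built from the structure supplied by choice, which need not be `S`. The identity
  -- isomorphism between `S.skewCl` and `C` is therefore composed with the change of structure
  -- between `T` and `S`.
  let T : ClosedStructure C.multicat := chosen A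
  let f : S.skewCl ⟶ C := SkewCl.ofMulticat C
  let g : C ⟶ S.skewCl := SkewCl.toMulticat C
  have h₁ : f ≫ g = 𝟙 S.skewCl := SkewCl.ofMulticat_toMulticat
  have h₂ : g ≫ f = 𝟙 C := SkewCl.toMulticat_ofMulticat
  refine ⟨A, T.change S ≫ f, g ≫ S.change T, ?_, ?_⟩
  · refine (SkewCl.assoc' _ _ _).trans ((congrArg (T.change S ≫ ·) ((SkewCl.assoc' _ _ _).symm.trans
      ((congrArg (· ≫ S.change T) h₁).trans (SkewCl.id_comp' _)))).trans (T.change_comp S))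
  · refine (SkewCl.assoc' _ _ _).trans ((congrArg (g ≫ ·) ((SkewCl.assoc' _ _ _).symm.trans
      ((congrArg (· ≫ f) (S.change_comp T)).trans (SkewCl.id_comp' _)))).trans h₂)

end SkewMulticat

/-- The 2-category of skew closed categories, closed functors and closed transformations is
2-equivalent to the full sub-2-category of the 2-category of skew multicategories on the closed
skew multicategories with unit. -/
theorem mainTheorem2 :
    Nonempty (TwoEquivalence SkewCl.{v, u} ClosedSkewMulticatWithUnit.{v, u}) :=
  TwoEquivalence.nonempty_of_locally_bijective SkewMulticat.toSkewCl
    SkewMulticat.toSkewCl_map_bijective SkewMulticat.toSkewCl_map₂_bijective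
    SkewMulticat.toSkewCl_essSurj
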